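/- Let $A$ be an expansive integral $d\times d$ matrix (all entries are integers and all complex eigenvalues have modulus $>1$; in particular $A$ is invertible), let $A^*$ be its transpose, and let $\Psi=\{\psi_1,\dots,\psi_r\}$, $\Phi=\{\phi_1,\dots,\phi_r\}\subset L^2(\mathbb R^d)$. For $f \in L^2(\mathbb R^d)$ put $T_\alpha f=f(\cdot-\alpha)$, $D_Af=\sqrt{|\det A|}\,f(A\,\cdot)$, $\widetilde D_Af=|\det A|\,f(A\,\cdot)$, and let $\hat f$ be the Fourier transform, $\hat f(\xi)=\int f(x)e^{-2\pi i x\cdot\xi}\,dx$ for $f\in L^1\cap L^2$. The affine system is $\mathcal U_A(\Psi)=\{D_A^nT_z\psi_i : n\in\mathbb Z,\ z\in\mathbb Z^d,\ 1\le i\le r\}$; the quasi-affine system $\mathcal U^q_A(\Psi)$ consists of $D_A^nT_z\psi_i$ for $n\ge 0$ and $T_z\widetilde D_A^n\psi_i$ for $n<0$. Both are regarded as sequences indexed by $(n,z,i)\in \mathbb Z\times\mathbb Z^d\times\{1,\dots,r\}$. A sequence $(x_j)$ in a Hilbert space $H$ is Bessel if there is a constant $C$ with $\sum_j|\langle v,x_j\rangle|^2\le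 C\|v\|^2$ for all $v \in H$; two Bessel sequences $(x_j)$, $(y_j)$ with the same index set are orthogonal if their mixed dual Gramian $v\mapsto\sum_j\langle v,x_j\rangle y_j$ is the zero operator. Suppose that $\mathcal U_A(\Psi)$ and $\mathcal U_A(\Phi)$ are Bessel sequences. Then they are orthogonal if and only if for all $q\in\mathbb Z^d\setminus A^*\mathbb Z^d$, $$\sum_{i=1}^r\sum_{j\ge0}\overline{\hat\psi_i(A^{*j}\xi)}\,\hat\phi_i(A^{*j}(\xi+q))=0\quad\text{for a.e. }\xi,$$ and $$\sum_{i=1}^r\sum_{j\in\mathbb Z}\overline{\hat\psi_i(A^{*j}\xi)}\,\hat\phi_i(A^{*j}\xi)=0\quad\text{for a.e. }\xi$$ (the series being absolutely convergent for a.e. $\xi$). Moreover, the quasi-affine systems $\mathcal U^q_A(\Psi)$ and $\mathcal U^q_A(\Phi)$ are Bessel sequences as well, and they are orthogonal if and only if the same two conditions hold. -/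

import Mathlib

open MeasureTheory FourierTransform
open scoped ENNReal ComplexConjugate

noncomputable section

namespace OrthFrames

/-! ### Bessel sequences and orthogonality in a Hilbert space -/

section Bessel

variable {H : Type*} [NormedAddCommGroup H] [InnerProductSpace ℂ H] {J : Type*}

/-- `X` is a Bessel sequence: the coefficients `⟨v, x_j⟩` satisfy
`∑ j, |⟨v, x_j⟩|² ≤ C ‖v‖²` for some constant `C` and all `v`. The inner product of Mathlib is
linear in the second variable, so `inner ℂ (X j) v` is `⟨v, x_j⟩` in the convention of analysis. -/
def IsBessel (X : J → H) : Prop :=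
  ∃ C : ℝ, 0 < C ∧ ∀ v : H,
    Summable (fun j => ‖inner ℂ (X j) v‖ ^ 2) ∧
      ∑' j, ‖inner ℂ (X j) v‖ ^ 2 ≤ C * ‖v‖ ^ 2

/-- Two Bessel sequences over the same index set are orthogonal if their mixed dual Gramian
`v ↦ ∑ j, ⟨v, x_j⟩ y_j` is the zero operator. -/
def IsOrthogonal (X Y : J → H) : Prop :=
  IsBessel X ∧ IsBessel Y ∧ ∀ v : H, HasSum (fun j => inner ℂ (X j) v • Y j) 0

end Bessel

/-! ### Operators on `L²(ℝᵈ)` -/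

/-- The Hilbert space `L²(ℝᵈ)` of complex valued functions. -/
abbrev L2 (d : ℕ) : Type := Lp (α := EuclideanSpace ℝ (Fin d)) ℂ 2 volume

variable {d : ℕ}

/-- The matrix-vector product `M x` for `x` in Euclidean space. -/
def matVec (M : Matrix (Fin d) (Fin d) ℝ) (x : EuclideanSpace ℝ (Fin d)) :
    EuclideanSpace ℝ (Fin d) :=
  WithLp.toLp 2 (M.mulVec x.ofLp)

/-- A point of `ℤᵈ`, seen in `ℝᵈ`. -/
def intVec (z : Fin d → ℤ) : EuclideanSpace ℝ (Fin d) :=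
  WithLp.toLp 2 (fun i => (z i : ℝ))

/-- The translation operator `(T_α f)(x) = f(x - α)`. -/
def translation (α : EuclideanSpace ℝ (Fin d)) : L2 d →+ L2 d :=
  Lp.compMeasurePreserving (fun x => x - α) (measurePreserving_sub_right volume α)

theorem matVec_mul (M N : Matrix (Fin d) (Fin d) ℝ) (x : EuclideanSpace ℝ (Fin d)) :
    matVec (M * N) x = matVec M (matVec N x) := by
  simp [matVec, Matrix.mulVec_mulVec]

theorem matVec_one (x : EuclideanSpace ℝ (Fin d)) :
    matVec (1 : Matrix (Fin d) (Fin d) ℝ) x = x := by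
  simp [matVec]

theorem matVec_eq (M : Matrix (Fin d) (Fin d) ℝ) :
    matVec M = ⇑(Matrix.toEuclideanLin M) := by
  funext x
  simp [matVec, Matrix.toLpLin_apply]

theorem measurable_matVec (M : Matrix (Fin d) (Fin d) ℝ) : Measurable (matVec M) := by
  rw [matVec_eq]
  exact (LinearMap.continuous_of_finiteDimensional _).measurable

theorem map_matVec (A : GL (Fin d) ℝ) :
    Measure.map (matVec (A : Matrix (Fin d) (Fin d) ℝ)) volume =
      ENNReal.ofReal |(A : Matrix (Fin d) (Fin d) ℝ).det⁻¹| •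
        (volume : Measure (EuclideanSpace ℝ (Fin d))) := by
  have hdet : LinearMap.det (Matrix.toEuclideanLin (A : Matrix (Fin d) (Fin d) ℝ))
      = (A : Matrix (Fin d) (Fin d) ℝ).det := by
    rw [Matrix.toEuclideanLin, Matrix.toLpLin_eq_toLin, LinearMap.det_toLin]
  have h0 : (A : Matrix (Fin d) (Fin d) ℝ).det ≠ 0 := by
    have := A.isUnit.map (Matrix.detMonoidHom (n := Fin d) (R := ℝ))
    exact this.ne_zero
  rw [matVec_eq, Measure.map_linearMap_addHaar_eq_smul_addHaar _ (by rwa [hdet]), hdet]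

theorem quasiMeasurePreserving_matVec (A : GL (Fin d) ℝ) :
    Measure.QuasiMeasurePreserving (matVec (A : Matrix (Fin d) (Fin d) ℝ)) volume volume := by
  refine ⟨measurable_matVec _, ?_⟩
  rw [map_matVec]
  exact Measure.smul_absolutelyContinuous

theorem eLpNorm_comp_matVec (A : GL (Fin d) ℝ) (f : L2 d) :
    eLpNorm (fun x => f (matVec (A : Matrix (Fin d) (Fin d) ℝ) x)) 2 volume =
      ENNReal.ofReal |(A : Matrix (Fin d) (Fin d) ℝ).det⁻¹| ^ (1 / (2 : ℝ)) *
        eLpNorm f 2 volume := by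
  have h := eLpNorm_map_measure (p := 2) (f := matVec (A : Matrix (Fin d) (Fin d) ℝ))
    (g := f) (μ := volume)
    (by rw [map_matVec]; exact (Lp.aestronglyMeasurable f).mono_ac
          Measure.smul_absolutelyContinuous)
    (measurable_matVec _).aemeasurable
  rw [map_matVec, eLpNorm_smul_measure_of_ne_top (by simp)] at h
  simpa [Function.comp_def] using h.symm

theorem memLp_comp_matVec (A : GL (Fin d) ℝ) (f : L2 d) :
    MemLp (fun x => f (matVec (A : Matrix (Fin d) (Fin d) ℝ) x)) 2 volume := by
  refine ⟨(Lp.aestronglyMeasurable f).comp_quasiMeasurePreserving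
    (quasiMeasurePreserving_matVec A), ?_⟩
  rw [eLpNorm_comp_matVec]
  exact ENNReal.mul_lt_top (ENNReal.rpow_lt_top_of_nonneg (by norm_num) ENNReal.ofReal_ne_top)
    (Lp.eLpNorm_lt_top f)

/-- The substitution `f ↦ f(A ·)` as a continuous linear map of `L²(ℝᵈ)`. -/
def substCLM (A : GL (Fin d) ℝ) : L2 d →L[ℂ] L2 d :=
  LinearMap.mkContinuous
    { toFun := fun f => (memLp_comp_matVec A f).toLp _
      map_add' := fun f g => by
        apply Lp.ext
        filter_upwards [(memLp_comp_matVec A (f + g)).coeFn_toLp,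
          (memLp_comp_matVec A f).coeFn_toLp, (memLp_comp_matVec A g).coeFn_toLp,
          Lp.coeFn_add ((memLp_comp_matVec A f).toLp _) ((memLp_comp_matVec A g).toLp _),
          (quasiMeasurePreserving_matVec A).ae (Lp.coeFn_add f g)] with x h1 h2 h3 h4 h5
        rw [h1, h4, Pi.add_apply, h2, h3, h5, Pi.add_apply]
      map_smul' := fun c f => by
        apply Lp.ext
        filter_upwards [(memLp_comp_matVec A (c • f)).coeFn_toLp,
          (memLp_comp_matVec A f).coeFn_toLp,
          Lp.coeFn_smul c ((memLp_comp_matVec A f).toLp _),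
          (quasiMeasurePreserving_matVec A).ae (Lp.coeFn_smul c f)] with x h1 h2 h4 h5
        rw [h1, RingHom.id_apply, h4, Pi.smul_apply, h2, h5, Pi.smul_apply] }
    (ENNReal.ofReal |(A : Matrix (Fin d) (Fin d) ℝ).det⁻¹| ^ (1 / (2 : ℝ))).toReal
    (fun f => by
      simp only [LinearMap.coe_mk, AddHom.coe_mk, Lp.norm_toLp, eLpNorm_comp_matVec,
        ENNReal.toReal_mul]
      rfl)

theorem substCLM_coeFn (A : GL (Fin d) ℝ) (f : L2 d) :
    substCLM A f =ᵐ[volume] fun x => f (matVec (A : Matrix (Fin d) (Fin d) ℝ) x) :=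
  (memLp_comp_matVec A f).coeFn_toLp

theorem substCLM_comp (A B : GL (Fin d) ℝ) (f : L2 d) :
    substCLM A (substCLM B f) = substCLM (B * A) f := by
  apply Lp.ext
  filter_upwards [substCLM_coeFn A (substCLM B f), substCLM_coeFn (B * A) f,
    (quasiMeasurePreserving_matVec A).ae (substCLM_coeFn B f)] with x h1 h2 h3
  rw [h1, h2, h3, Units.val_mul, matVec_mul]

theorem substCLM_one (f : L2 d) : substCLM 1 f = f := by
  apply Lp.ext
  filter_upwards [substCLM_coeFn 1 f] with x h1
  rw [h1, Units.val_one, matVec_one]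

/-- The substitution `f ↦ f(A ·)` as an invertible operator of `L²(ℝᵈ)`. -/
def subst (A : GL (Fin d) ℝ) : L2 d ≃L[ℂ] L2 d :=
  ContinuousLinearEquiv.equivOfInverse (substCLM A) (substCLM A⁻¹)
    (fun f => by rw [substCLM_comp, mul_inv_cancel, substCLM_one])
    (fun f => by rw [substCLM_comp, inv_mul_cancel, substCLM_one])

/-- Multiplication by a nonzero complex scalar as an invertible operator of `L²(ℝᵈ)`. -/
def scalar (c : ℂˣ) : L2 d ≃L[ℂ] L2 d :=
  ContinuousLinearEquiv.smulLeft c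

theorem abs_det_ne_zero (A : GL (Fin d) ℝ) : |(A : Matrix (Fin d) (Fin d) ℝ).det| ≠ 0 :=
  abs_ne_zero.mpr (A.isUnit.map (Matrix.detMonoidHom (n := Fin d) (R := ℝ))).ne_zero

theorem sqrt_abs_det_ne_zero (A : GL (Fin d) ℝ) :
    Real.sqrt |(A : Matrix (Fin d) (Fin d) ℝ).det| ≠ 0 := by
  have := abs_det_ne_zero A
  positivity

/-- The dilation operator `(D_A f)(x) = √|det A| f(A x)`. Integer powers `D_A ^ n` are taken in
the group of invertible operators. -/
def dilation (A : GL (Fin d) ℝ) : L2 d ≃L[ℂ] L2 d :=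
  scalar (Units.mk0 ((Real.sqrt |(A : Matrix (Fin d) (Fin d) ℝ).det| : ℝ) : ℂ)
    (by exact_mod_cast sqrt_abs_det_ne_zero A)) * subst A

/-- The renormalized dilation operator `f ↦ |det A| f(A ·)`. -/
def renormDilation (A : GL (Fin d) ℝ) : L2 d ≃L[ℂ] L2 d :=
  scalar (Units.mk0 ((|(A : Matrix (Fin d) (Fin d) ℝ).det| : ℝ) : ℂ)
    (by exact_mod_cast abs_det_ne_zero A)) * subst A

/-! ### Expansive integral matrices, affine and quasi-affine systems -/

/-- All complex eigenvalues have modulus strictly greater than `1`. -/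
def IsExpansive (M : Matrix (Fin d) (Fin d) ℝ) : Prop :=
  ∀ μ : ℂ, Module.End.HasEigenvalue (Matrix.toLin' (M.map (fun t : ℝ => (t : ℂ)))) μ → 1 < ‖μ‖

/-- All entries are integers. -/
def IsIntegerValued (M : Matrix (Fin d) (Fin d) ℝ) : Prop :=
  ∀ i j, ∃ m : ℤ, M i j = (m : ℝ)

variable {r : ℕ}

/-- The affine system `D_A ^ n T_z ψ_i`, indexed by `n ∈ ℤ`, `z ∈ ℤᵈ` and `i`. -/
def affineSystem (A : GL (Fin d) ℝ) (Ψ : Fin r → L2 d) :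
    ℤ × (Fin d → ℤ) × Fin r → L2 d :=
  fun p => (dilation A ^ p.1) (translation (intVec p.2.1) (Ψ p.2.2))

/-- The quasi-affine system: `D_A ^ n T_z ψ_i` for `n ≥ 0`, and `T_z D̃_A ^ n ψ_i` for `n < 0`,
where `D̃_A` is the renormalized dilation. -/
def quasiAffineSystem (A : GL (Fin d) ℝ) (Ψ : Fin r → L2 d) :
    ℤ × (Fin d → ℤ) × Fin r → L2 d :=
  fun p =>
    if 0 ≤ p.1 then (dilation A ^ p.1) (translation (intVec p.2.1) (Ψ p.2.2))
    else translation (intVec p.2.1) ((renormDilation A ^ p.1) (Ψ p.2.2))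

/-- The two families of equations, with `A* = Aᵀ`. The vanishing of a double series is `HasSum`
over the pairs `(j, i)`, so absolute convergence is part of it. -/
def OrthogonalityEquations (A : GL (Fin d) ℝ) (Ψ Φ : Fin r → L2 d) : Prop :=
  (∀ q : Fin d → ℤ,
    (¬ ∃ z : Fin d → ℤ, intVec q = matVec (A : Matrix (Fin d) (Fin d) ℝ).transpose (intVec z)) →
    ∀ᵐ ξ : EuclideanSpace ℝ (Fin d),
      HasSum (fun p : ℕ × Fin r =>
        conj ((𝓕 (Ψ p.2) : L2 d)
          (matVec ((A : Matrix (Fin d) (Fin d) ℝ).transpose ^ p.1) ξ)) *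
        (𝓕 (Φ p.2) : L2 d)
          (matVec ((A : Matrix (Fin d) (Fin d) ℝ).transpose ^ p.1) (ξ + intVec q))) 0) ∧
  (∀ᵐ ξ : EuclideanSpace ℝ (Fin d),
      HasSum (fun p : ℤ × Fin r =>
        conj ((𝓕 (Ψ p.2) : L2 d)
          (matVec ((A : Matrix (Fin d) (Fin d) ℝ).transpose ^ p.1) ξ)) *
        (𝓕 (Φ p.2) : L2 d)
          (matVec ((A : Matrix (Fin d) (Fin d) ℝ).transpose ^ p.1) ξ)) 0)

end OrthFrames

end

/-! Put b = A*. On the Fourier side the elements with fixed scale n and generator i are one function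
ψ̂ᵢ(b⁻ⁿ·) times the characters attached to the lattice b^(ε n) ℤᵈ, with ε n = n for the affine and ε
n = max n 0 for the quasi-affine system (`LatticeForm`). Let f, g have bounded transforms F, G
supported in an annulus around 0. Parseval's identity turns the sum over translations in the mixed
form of f and g into a sum over shifts p ∈ b^(ε n) ℤᵈ of ∫ F(x) conj(ψ̂ᵢ(b⁻ⁿx)) conj(G(x+p))
φ̂ᵢ(b⁻ⁿ(x+p)) dx (`LatticeForm.hasSum_layer`).

Everything rests on absolute summability over n, i and p (`FiniteMass`). For p ≠ 0 only square
integrability is needed: large n give shifts too long to meet the annulus twice, for the other n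
lattice points are counted by volume, and an orbit of b meets the annulus a bounded number of times.
For p = 0 the Bessel property enters: in the form of one system with itself the diagonal is the full
layer minus the off-diagonal part, and its terms are nonnegative.

Now group by p. Translating f and g by y multiplies the p-part by exp(2πi⟨y,p⟩), so vanishing of the
form is vanishing of an absolutely convergent trigonometric series in y. Its coefficients vanish
(`fiber_tsum_eq_zero`), and varying F and G gives tₚ = 0 a.e., where tₚ(x) is the sum of
conj(ψ̂ᵢ(b⁻ⁿx)) φ̂ᵢ(b⁻ⁿ(x+p)) over i and over the n with p ∈ b^(ε n) ℤᵈ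
(`LatticeForm.isOrthogonal_iff`). In the affine case t₀ = 0 is the second equation. A nonzero p in
one of the lattices is bᵐq with q ∈ ℤᵈ \ bℤᵈ, only n ≤ m contribute, and tₚ = 0 is the first
equation for q after dilation.

For the quasi-affine system, b^(max n 0) ℤᵈ = bⁿℤᵈ ∩ ℤᵈ: its tₚ agrees with the affine one for p ∈
ℤᵈ and is zero otherwise. The equations only involve the shifts 0 and q ∈ ℤᵈ, so they are the same.
Also, its quadratic form at f is a limit of averages over integer translates of f of the affine
form, which gives the Bessel bound with the same constant (`LatticeForm.isBessel_max`). -/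

namespace OrthFrames

/-! ### Characters, unit cubes and Parseval on the torus -/

/-- The character `t ↦ exp (2 π i t)` of the real line. -/
noncomputable def ex (t : ℝ) : ℂ := Complex.exp (2 * Real.pi * t * Complex.I)

theorem ex_zero : ex 0 = 1 := by simp [ex]

theorem ex_add (s t : ℝ) : ex (s + t) = ex s * ex t := by
  rw [ex, ex, ex, ← Complex.exp_add]; push_cast; ring_nf

theorem norm_ex (t : ℝ) : ‖ex t‖ = 1 := by
  have : (2 * Real.pi * t * Complex.I : ℂ) = ((2 * Real.pi * t : ℝ) : ℂ) * Complex.I := by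
    push_cast; ring
  rw [ex, this, Complex.norm_exp_ofReal_mul_I]

theorem conj_ex (t : ℝ) : conj (ex t) = ex (-t) := by
  rw [ex, ex, ← Complex.exp_conj]; simp [Complex.conj_ofNat]

theorem ex_mul_neg (t : ℝ) : ex t * ex (-t) = 1 := by
  rw [← ex_add, add_neg_cancel, ex_zero]

theorem continuous_ex : Continuous ex := by
  unfold ex; fun_prop

theorem ex_int (m : ℤ) : ex m = 1 := by
  rw [ex, Complex.exp_eq_one_iff]; exact ⟨m, by push_cast; ring⟩

theorem ex_eq_one_iff (t : ℝ) : ex t = 1 ↔ ∃ m : ℤ, t = m := by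
  constructor
  · intro h
    rw [ex, Complex.exp_eq_one_iff] at h
    obtain ⟨m, hm⟩ := h
    refine ⟨m, ?_⟩
    have h1 : (2 * Real.pi * Complex.I : ℂ) ≠ 0 := Complex.two_pi_I_ne_zero
    have h2 : (2 * Real.pi * Complex.I : ℂ) * t = (2 * Real.pi * Complex.I) * m := by
      linear_combination hm
    exact_mod_cast mul_left_cancel₀ h1 h2
  · rintro ⟨m, rfl⟩
    exact ex_int m

variable {d : ℕ}

/-- The translates by integer vectors of a half-open unit cube. -/
def cube (m : Fin d → ℤ) : Set (EuclideanSpace ℝ (Fin d)) := {x | ∀ i, ⌈x i⌉ = m i}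

theorem measurableSet_cube (m : Fin d → ℤ) : MeasurableSet (cube m) := by
  rw [cube, Set.ofPred_forall]
  refine MeasurableSet.iInter fun i => ?_
  exact (Int.measurable_ceil.comp (by fun_prop : Measurable fun x : EuclideanSpace ℝ (Fin d) => x i))
    (measurableSet_singleton (m i))

theorem pairwise_disjoint_cube : Pairwise (Function.onFun Disjoint (cube (d := d))) := by
  intro m m' h
  refine Set.disjoint_left.mpr fun x hx hx' => h ?_
  funext i
  rw [← hx i, hx' i]

theorem iUnion_cube : ⋃ m, cube (d := d) m = Set.univ :=
  Set.eq_univ_of_forall fun x => Set.mem_iUnion.mpr ⟨fun i => ⌈x i⌉, fun _ => rfl⟩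

theorem intVec_apply (z : Fin d → ℤ) (i : Fin d) : intVec z i = (z i : ℝ) := rfl

theorem intVec_zero : intVec (0 : Fin d → ℤ) = 0 := by ext i; simp [intVec_apply]

theorem intVec_add (z w : Fin d → ℤ) : intVec (z + w) = intVec z + intVec w := by
  ext i; simp [intVec_apply]

theorem intVec_neg (z : Fin d → ℤ) : intVec (-z) = -intVec z := by
  ext i; simp [intVec_apply]

theorem intVec_injective : Function.Injective (intVec (d := d)) := by
  intro z w h
  funext i
  have := congrArg (fun x : EuclideanSpace ℝ (Fin d) => x i) h
  simpa [intVec_apply] using this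

theorem add_intVec_mem_cube (x : EuclideanSpace ℝ (Fin d)) (m k : Fin d → ℤ) :
    x + intVec k ∈ cube (m + k) ↔ x ∈ cube m := by
  simp [cube, intVec_apply]

theorem cube_preimage (m k : Fin d → ℤ) :
    (fun x => x + intVec k) ⁻¹' cube (m + k) = cube m := by
  ext x; exact add_intVec_mem_cube x m k

theorem setIntegral_cube_add (f : EuclideanSpace ℝ (Fin d) → ℂ) (m k : Fin d → ℤ) :
    ∫ x in cube m, f (x + intVec k) = ∫ x in cube (m + k), f x := by
  rw [← cube_preimage m k]
  exact (measurePreserving_add_right volume (intVec k)).setIntegral_preimage_emb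
    (MeasurableEquiv.addRight (intVec k)).measurableEmbedding f _

theorem setLIntegral_cube_add (f : EuclideanSpace ℝ (Fin d) → ℝ≥0∞) (m k : Fin d → ℤ) :
    ∫⁻ x in cube m, f (x + intVec k) = ∫⁻ x in cube (m + k), f x := by
  rw [← cube_preimage m k]
  exact (measurePreserving_add_right volume (intVec k)).setLIntegral_comp_preimage_emb
    (MeasurableEquiv.addRight (intVec k)).measurableEmbedding f _

/-- A point of the torus, represented in the unit cube. -/
noncomputable def torusRep (t : UnitAddTorus (Fin d)) : EuclideanSpace ℝ (Fin d) :=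
  WithLp.toLp 2 (UnitAddTorus.measurableEquivPiIoc (fun _ => -1) t).1

/-- The product Haar measure of the torus. -/
noncomputable abbrev torusVol (d : ℕ) : Measure (UnitAddTorus (Fin d)) :=
  Measure.pi fun _ => AddCircle.haarAddCircle

theorem measurePreserving_torusRep :
    MeasurePreserving (torusRep (d := d)) (torusVol d)
      (volume.restrict (cube 0)) := by
  have h1 := UnitAddTorus.measurePreserving_equivPiIoc (d := Fin d) (fun _ => -1)
  have hset : MeasurableSet {x : Fin d → ℝ | ∀ i, x i ∈ Set.Ioc (-1 : ℝ) (-1 + 1)} :=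
    MeasurableSet.univ_pi' (fun i => measurableSet_Ioc)
  have h2 := measurePreserving_subtype_coe (μa := (volume : Measure (Fin d → ℝ))) hset
  have h3 : MeasurePreserving (WithLp.toLp 2 : (Fin d → ℝ) → EuclideanSpace ℝ (Fin d))
      (volume.restrict {x : Fin d → ℝ | ∀ i, x i ∈ Set.Ioc (-1 : ℝ) (-1 + 1)})
      (volume.restrict (cube 0)) := by
    have : (WithLp.toLp 2 : (Fin d → ℝ) → EuclideanSpace ℝ (Fin d)) ⁻¹' (cube 0)
        = {x : Fin d → ℝ | ∀ i, x i ∈ Set.Ioc (-1 : ℝ) (-1 + 1)} := by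
      ext x
      -- `⌈t⌉ = 0` means `-1 < t ≤ 0`: the ceiling in `cube` and the base point `-1` of the torus
      -- are chosen to match.
      simp [cube, Int.ceil_eq_iff]
    rw [← this]
    exact (PiLp.volume_preserving_toLp (Fin d)).restrict_preimage (measurableSet_cube 0)
  exact h3.comp (h2.comp h1)

theorem mFourier_eq_ex (n : Fin d → ℤ) (t : UnitAddTorus (Fin d)) :
    UnitAddTorus.mFourier n t = ex (inner ℝ (intVec n) (torusRep t)) := by
  have ht : t = fun i => ((torusRep t i : ℝ) : UnitAddCircle) := by
    have := (UnitAddTorus.measurableEquivPiIoc (fun _ : Fin d => (-1 : ℝ))).symm_apply_apply t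
    rw [UnitAddTorus.coe_symm_measurableEquivPiIoc_apply] at this
    exact this.symm
  have hx : ∀ s : Finset (Fin d), ∀ a : Fin d → ℝ, ex (∑ i ∈ s, a i) = ∏ i ∈ s, ex (a i) := by
    intro s a
    induction s using Finset.cons_induction with
    | empty => simp [ex_zero]
    | cons i s hi ih => rw [Finset.sum_cons, Finset.prod_cons, ex_add, ih]
  rw [PiLp.inner_apply, hx]
  change ∏ i, fourier (n i) (t i) = _
  refine Finset.prod_congr rfl fun i _ => ?_
  conv_lhs => rw [ht]
  rw [fourier_coe_apply, ex]
  congr 1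
  simp [intVec_apply]
  ring

/-- Parseval's identity on the unit cube. -/
theorem parseval_cube (u v : EuclideanSpace ℝ (Fin d) → ℂ)
    (hu : MemLp u 2 (volume.restrict (cube 0))) (hv : MemLp v 2 (volume.restrict (cube 0))) :
    HasSum (fun z : Fin d → ℤ => (∫ x in cube 0, u x * ex (inner ℝ (intVec z) x)) *
      conj (∫ x in cube 0, v x * ex (inner ℝ (intVec z) x)))
      (∫ x in cube 0, u x * conj (v x)) := by
  have hm := measurePreserving_torusRep (d := d)
  have hU := hu.comp_measurePreserving hm
  have hV := hv.comp_measurePreserving hm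
  have hint : ∀ H : EuclideanSpace ℝ (Fin d) → ℂ, AEStronglyMeasurable H (volume.restrict (cube 0)) →
      ∫ t, H (torusRep t) ∂(torusVol d) = ∫ x in cube 0, H x := by
    intro H hH
    rw [← hm.map_eq, integral_map hm.aemeasurable (by rwa [hm.map_eq])]
  have hcoef : ∀ (w : EuclideanSpace ℝ (Fin d) → ℂ) (hw : MemLp w 2 (volume.restrict (cube 0)))
      (z : Fin d → ℤ),
      UnitAddTorus.mFourierCoeff ((hw.comp_measurePreserving hm).toLp (w ∘ torusRep)) z
        = ∫ x in cube 0, w x * ex (inner ℝ (intVec (-z)) x) := by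
    intro w hw z
    rw [← hint (fun x => w x * ex (inner ℝ (intVec (-z)) x))]
    · rw [UnitAddTorus.mFourierCoeff]
      refine integral_congr_ae ?_
      filter_upwards [(hw.comp_measurePreserving hm).coeFn_toLp] with t ht
      rw [ht, mFourier_eq_ex, smul_eq_mul, mul_comm, Function.comp_apply]
    · refine hw.1.mul (Continuous.aestronglyMeasurable ?_)
      exact continuous_ex.comp (by fun_prop)
  have key := UnitAddTorus.hasSum_prod_mFourierCoeff (hV.toLp (v ∘ torusRep))
    (hU.toLp (u ∘ torusRep))
  simp only [hcoef u hu, hcoef v hv] at key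
  have e1 : ∫ t, conj ((hV.toLp (v ∘ torusRep)) t) * (hU.toLp (u ∘ torusRep)) t ∂(torusVol d)
      = ∫ x in cube 0, u x * conj (v x) := by
    rw [← hint (fun x => u x * conj (v x))]
    · refine integral_congr_ae ?_
      filter_upwards [hU.coeFn_toLp, hV.coeFn_toLp] with t h1 h2
      rw [h1, h2, mul_comm]; rfl
    · exact hu.1.mul (Complex.continuous_conj.comp_aestronglyMeasurable hv.1)
  have key2 : HasSum (fun z : Fin d → ℤ =>
      conj (∫ x in cube 0, v x * ex (inner ℝ (intVec (-z)) x)) *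
      (∫ x in cube 0, u x * ex (inner ℝ (intVec (-z)) x)))
      (∫ x in cube 0, u x * conj (v x)) := by
    rw [← e1]; exact key
  -- A Fourier coefficient at `z` pairs with the character of `-z`; negating the index restores the
  -- sign.
  have := (Equiv.neg (Fin d → ℤ)).hasSum_iff.mpr key2
  refine this.congr_fun fun z => ?_
  simp [mul_comm]

end OrthFrames

/-! ### Linear changes of variables and Parseval along a lattice -/

namespace OrthFrames

variable {d : ℕ}

/-- The absolute value of the determinant of an invertible linear map. -/
noncomputable def adet (g : EuclideanSpace ℝ (Fin d) ≃L[ℝ] EuclideanSpace ℝ (Fin d)) : ℝ :=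
  |LinearMap.det (g : EuclideanSpace ℝ (Fin d) →ₗ[ℝ] EuclideanSpace ℝ (Fin d))|

section ChangeOfVariables

variable (g : EuclideanSpace ℝ (Fin d) ≃L[ℝ] EuclideanSpace ℝ (Fin d))

theorem det_ne_zero_of_equiv :
    LinearMap.det (g : EuclideanSpace ℝ (Fin d) →ₗ[ℝ] EuclideanSpace ℝ (Fin d)) ≠ 0 :=
  (LinearEquiv.isUnit_det' g.toLinearEquiv).ne_zero

theorem adet_pos : 0 < adet g := abs_pos.mpr (det_ne_zero_of_equiv g)

theorem map_equiv_volume :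
    Measure.map g volume = ENNReal.ofReal (adet g)⁻¹ •
      (volume : Measure (EuclideanSpace ℝ (Fin d))) := by
  have := Measure.map_linearMap_addHaar_eq_smul_addHaar
    (volume : Measure (EuclideanSpace ℝ (Fin d))) (det_ne_zero_of_equiv g)
  rw [abs_inv] at this
  exact this

theorem integral_comp_equiv {E : Type*} [NormedAddCommGroup E] [NormedSpace ℝ E]
    (f : EuclideanSpace ℝ (Fin d) → E) :
    ∫ x, f (g x) = (adet g)⁻¹ • ∫ x, f x := by
  have h := g.toHomeomorph.measurableEmbedding.integral_map (μ := volume) f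
  rw [show (⇑g.toHomeomorph : _ → _) = g from rfl, map_equiv_volume, integral_smul_measure,
    ENNReal.toReal_ofReal (by have := adet_pos g; positivity)] at h
  exact h.symm

theorem lintegral_comp_equiv (f : EuclideanSpace ℝ (Fin d) → ℝ≥0∞) :
    ∫⁻ x, f (g x) = ENNReal.ofReal (adet g)⁻¹ * ∫⁻ x, f x := by
  have h := g.toHomeomorph.measurableEmbedding.lintegral_map (μ := volume) f
  rw [show (⇑g.toHomeomorph : _ → _) = g from rfl, map_equiv_volume, lintegral_smul_measure] at h
  exact h.symm

theorem quasiMeasurePreserving_equiv :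
    Measure.QuasiMeasurePreserving g volume volume := by
  refine ⟨g.continuous.measurable, ?_⟩
  rw [map_equiv_volume]
  exact Measure.smul_absolutelyContinuous

theorem memLp_comp_equiv {f : EuclideanSpace ℝ (Fin d) → ℂ} (hf : MemLp f 2) :
    MemLp (fun x => f (g x)) 2 := by
  have h : MemLp f 2 (Measure.map g volume) := by
    rw [map_equiv_volume]
    exact hf.smul_measure ENNReal.ofReal_ne_top
  exact h.comp_of_map g.continuous.aemeasurable

end ChangeOfVariables

theorem integrable_of_memLp_of_bounded_support {u : EuclideanSpace ℝ (Fin d) → ℂ}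
    (hu : MemLp u 2) {R : ℝ} (hu0 : ∀ x, R < ‖x‖ → u x = 0) : Integrable u := by
  have hs : Function.support u ⊆ Metric.closedBall 0 R := by
    intro x hx
    rw [mem_closedBall_zero_iff]
    by_contra! h
    exact hx (hu0 x h)
  rw [← integrableOn_iff_integrable_of_support_subset hs]
  have : IsFiniteMeasure ((volume : Measure (EuclideanSpace ℝ (Fin d))).restrict
      (Metric.closedBall 0 R)) :=
    ⟨by rw [Measure.restrict_apply_univ]; exact measure_closedBall_lt_top⟩
  exact (hu.restrict _).integrable (by norm_num)

theorem integral_eq_sum_cube {w : EuclideanSpace ℝ (Fin d) → ℂ} (hw : Integrable w)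
    (S : Finset (Fin d → ℤ)) (hS : ∀ m ∉ S, ∀ x ∈ cube m, w x = 0) :
    ∫ x, w x = ∑ m ∈ S, ∫ x in cube 0, w (x + intVec m) := by
  have h1 := hasSum_integral_iUnion (fun m => measurableSet_cube (d := d) m)
    pairwise_disjoint_cube (f := w) (μ := volume) hw.integrableOn
  rw [iUnion_cube, setIntegral_univ] at h1
  have h2 : HasSum (fun m : Fin d → ℤ => ∫ x in cube m, w x) (∑ m ∈ S, ∫ x in cube m, w x) :=
    hasSum_sum_of_ne_finset_zero fun m hm => by
      rw [setIntegral_congr_fun (measurableSet_cube m) (g := fun _ => 0) (hS m hm)]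
      simp
  rw [h1.unique h2]
  refine Finset.sum_congr rfl fun m _ => ?_
  rw [setIntegral_cube_add w 0 m, zero_add]

theorem exists_finset_cube (R : ℝ) :
    ∃ S : Finset (Fin d → ℤ), ∀ m ∉ S, ∀ x ∈ cube m, R < ‖x‖ := by
  refine ⟨Fintype.piFinset fun _ => Finset.Icc (-(⌈R⌉ + 1)) (⌈R⌉ + 1), fun m hm x hx => ?_⟩
  by_contra! h
  refine hm (Fintype.mem_piFinset.mpr fun i => ?_)
  have h1 : |x i| ≤ R := (PiLp.norm_apply_le x i).trans h
  have h2 := Int.le_ceil R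
  rw [← hx i, Finset.mem_Icc]
  obtain ⟨h3, h4⟩ := abs_le.mp h1
  constructor
  · have : ((-(⌈R⌉ + 1) : ℤ) : ℝ) ≤ ⌈x i⌉ := by
      have := Int.le_ceil (x i)
      push_cast; linarith
    exact_mod_cast this
  · exact (Int.ceil_le_ceil h4).trans (by omega)

theorem inner_intVec_intVec (z m : Fin d → ℤ) :
    ex (inner ℝ (intVec z) (intVec m)) = 1 := by
  have : inner ℝ (intVec z) (intVec m) = ((∑ i, z i * m i : ℤ) : ℝ) := by
    rw [PiLp.inner_apply]
    push_cast
    refine Finset.sum_congr rfl fun i _ => ?_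
    simp [intVec_apply, mul_comm]
  rw [this, ex_int]

/-- Parseval's identity for the integer translates of a function on Euclidean space. -/
theorem hasSum_lattice_coeff {u v : EuclideanSpace ℝ (Fin d) → ℂ}
    (hu : MemLp u 2) (hv : MemLp v 2) {R : ℝ}
    (hu0 : ∀ x, R < ‖x‖ → u x = 0) (hv0 : ∀ x, R < ‖x‖ → v x = 0) :
    ∃ s : ℂ, HasSum (fun z : Fin d → ℤ => (∫ x, u x * ex (inner ℝ (intVec z) x)) *
        conj (∫ x, v x * ex (inner ℝ (intVec z) x))) s ∧
      HasSum (fun k : Fin d → ℤ => ∫ x, u x * conj (v (x + intVec k))) s := by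
  -- Bounded support makes the periodization a finite sum over `S`, so no convergence question
  -- arises.
  obtain ⟨S, hS⟩ := exists_finset_cube (d := d) R
  have hadd : ∀ (w : EuclideanSpace ℝ (Fin d) → ℂ), MemLp w 2 → ∀ m : Fin d → ℤ,
      MemLp (fun x => w (x + intVec m)) 2 := fun w hw m =>
    hw.comp_measurePreserving (measurePreserving_add_right volume (intVec m))
  have haddr : ∀ (w : EuclideanSpace ℝ (Fin d) → ℂ), MemLp w 2 → ∀ m : Fin d → ℤ,
      MemLp (fun x => w (x + intVec m)) 2 (volume.restrict (cube 0)) :=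
    fun w hw m => (hadd w hw m).restrict _
  have hsum : ∀ (w : EuclideanSpace ℝ (Fin d) → ℂ), MemLp w 2 →
      MemLp (fun x => ∑ m ∈ S, w (x + intVec m)) 2 (volume.restrict (cube 0)) :=
    fun w hw => memLp_finsetSum S fun m _ => haddr w hw m
  have hex : ∀ z : Fin d → ℤ, Continuous fun x : EuclideanSpace ℝ (Fin d) =>
      ex (inner ℝ (intVec z) x) := fun z => continuous_ex.comp (by fun_prop)
  have hexi : ∀ (μ : Measure (EuclideanSpace ℝ (Fin d))) (w : EuclideanSpace ℝ (Fin d) → ℂ),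
      Integrable w μ → ∀ z : Fin d → ℤ,
      Integrable (fun x => w x * ex (inner ℝ (intVec z) x)) μ := fun μ w hw z =>
    hw.mul_bdd (c := 1) (hex z).aestronglyMeasurable (ae_of_all _ fun x => (norm_ex _).le)
  have hfin : IsFiniteMeasure ((volume : Measure (EuclideanSpace ℝ (Fin d))).restrict
      (cube 0)) := by
    constructor
    have h := (measurePreserving_torusRep (d := d)).measure_preimage
      (s := Set.univ) MeasurableSet.univ.nullMeasurableSet
    rw [← h]
    exact measure_lt_top _ _
  -- The character of `z` is invariant under integer shifts, so a Fourier integral over the whole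
  -- space is a Fourier coefficient of the periodization.
  have hcoef : ∀ (w : EuclideanSpace ℝ (Fin d) → ℂ), MemLp w 2 → (∀ x, R < ‖x‖ → w x = 0) →
      ∀ z : Fin d → ℤ, ∫ x, w x * ex (inner ℝ (intVec z) x) =
        ∫ x in cube 0, (∑ m ∈ S, w (x + intVec m)) * ex (inner ℝ (intVec z) x) := by
    intro w hw hw0 z
    rw [integral_eq_sum_cube (hexi _ w (integrable_of_memLp_of_bounded_support hw hw0) z) S
      (fun m hm x hx => by rw [hw0 x (hS m hm x hx), zero_mul])]
    simp only [inner_add_right, ex_add, inner_intVec_intVec, mul_one, Finset.sum_mul]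
    rw [integral_finsetSum]
    intro m _
    exact hexi _ _ ((haddr w hw m).integrable (by norm_num)) z
  refine ⟨∫ x in cube 0, (∑ m ∈ S, u (x + intVec m)) * conj (∑ m ∈ S, v (x + intVec m)), ?_, ?_⟩
  · simp only [hcoef u hu hu0, hcoef v hv hv0]
    exact parseval_cube _ _ (hsum u hu) (hsum v hv)
  · have hconj : ∀ (w : EuclideanSpace ℝ (Fin d) → ℂ) (μ : Measure (EuclideanSpace ℝ (Fin d))),
        MemLp w 2 μ → MemLp (fun x => conj (w x)) 2 μ := fun w μ hw => hw.star
    have hprod : ∀ (w w' : EuclideanSpace ℝ (Fin d) → ℂ) (μ : Measure (EuclideanSpace ℝ (Fin d))),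
        MemLp w 2 μ → MemLp w' 2 μ → Integrable (fun x => w x * conj (w' x)) μ :=
      fun w w' μ hw hw' => hw.integrable_mul (hconj w' μ hw')
    have h1 : ∀ k : Fin d → ℤ, ∫ x, u x * conj (v (x + intVec k)) =
        ∑ m ∈ S, ∫ x in cube 0, u (x + intVec m) * conj (v (x + intVec m + intVec k)) :=
      fun k => integral_eq_sum_cube (hprod _ _ _ hu (hadd v hv k)) S
        (fun m hm x hx => by rw [hu0 x (hS m hm x hx), zero_mul])
    have h2 : ∫ x in cube 0, (∑ m ∈ S, u (x + intVec m)) * conj (∑ m ∈ S, v (x + intVec m)) =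
        ∑ m ∈ S, ∑ m' ∈ S, ∫ x in cube 0, u (x + intVec m) * conj (v (x + intVec m')) := by
      simp only [map_sum, Finset.sum_mul_sum]
      rw [integral_finsetSum]
      · refine Finset.sum_congr rfl fun m _ => integral_finsetSum _ fun m' _ => ?_
        exact hprod _ _ _ (haddr u hu m) (haddr v hv m')
      · exact fun m _ => integrable_finsetSum _ fun m' _ =>
          hprod _ _ _ (haddr u hu m) (haddr v hv m')
    rw [h2]
    simp only [h1]
    refine hasSum_sum fun m _ => ?_
    have h3 : HasSum (fun m' : Fin d → ℤ =>
        ∫ x in cube 0, u (x + intVec m) * conj (v (x + intVec m')))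
        (∑ m' ∈ S, ∫ x in cube 0, u (x + intVec m) * conj (v (x + intVec m'))) := by
      refine hasSum_sum_of_ne_finset_zero fun m' hm' => ?_
      rw [setIntegral_congr_fun (measurableSet_cube 0) (g := fun _ => 0)]
      · simp
      · intro x hx
        have : x + intVec m' ∈ cube m' := by
          have := (add_intVec_mem_cube x 0 m').mpr hx
          rwa [zero_add] at this
        simp only [hv0 _ (hS m' hm' _ this), map_zero, mul_zero]
    -- A pair `(m, m')` of cubes corresponds to the shift `k = m' - m`.
    refine ((Equiv.addLeft m).hasSum_iff.mpr h3).congr_fun fun k => ?_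
    simp only [Function.comp_apply, Equiv.coe_addLeft, intVec_add, add_assoc]

/-- Parseval's identity for the translates along the lattice `g⁻¹ ℤᵈ`. -/
theorem hasSum_lattice_coeff_equiv (g : EuclideanSpace ℝ (Fin d) ≃L[ℝ] EuclideanSpace ℝ (Fin d))
    {u v : EuclideanSpace ℝ (Fin d) → ℂ} (hu : MemLp u 2) (hv : MemLp v 2) {R : ℝ}
    (hu0 : ∀ x, R < ‖x‖ → u x = 0) (hv0 : ∀ x, R < ‖x‖ → v x = 0) :
    ∃ s : ℂ, HasSum (fun z : Fin d → ℤ => (adet g : ℂ) *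
        ((∫ x, u x * ex (inner ℝ (intVec z) (g x))) *
        conj (∫ x, v x * ex (inner ℝ (intVec z) (g x))))) s ∧
      HasSum (fun k : Fin d → ℤ => ∫ x, u x * conj (v (x + g.symm (intVec k)))) s := by
  have hbd : ∀ w : EuclideanSpace ℝ (Fin d) → ℂ, (∀ x, R < ‖x‖ → w x = 0) →
      ∀ x, ‖(g : EuclideanSpace ℝ (Fin d) →L[ℝ] EuclideanSpace ℝ (Fin d))‖ * R < ‖x‖ →
        w (g.symm x) = 0 := by
    intro w hw x hx
    refine hw _ ?_
    by_contra! h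
    have := (g : EuclideanSpace ℝ (Fin d) →L[ℝ] EuclideanSpace ℝ (Fin d)).le_opNorm (g.symm x)
    simp only [ContinuousLinearEquiv.coe_coe, ContinuousLinearEquiv.apply_symm_apply] at this
    exact absurd hx (not_lt.mpr (this.trans (by gcongr)))
  obtain ⟨s, h1, h2⟩ := hasSum_lattice_coeff (memLp_comp_equiv g.symm hu)
    (memLp_comp_equiv g.symm hv) (hbd u hu0) (hbd v hv0)
  have hg : (adet g : ℂ) ≠ 0 := by exact_mod_cast (adet_pos g).ne'
  have hch : ∀ f : EuclideanSpace ℝ (Fin d) → ℂ, ∫ x, f x = adet g * ∫ x, f (g x) := by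
    intro f
    rw [integral_comp_equiv g f, Complex.real_smul]
    push_cast
    rw [mul_inv_cancel_left₀ hg]
  -- Changing variables yields two Jacobian factors in the product of coefficients but one in the
  -- correlation; this normalization leaves `adet g` and `1`.
  refine ⟨(adet g : ℂ)⁻¹ * s, ?_, ?_⟩
  · refine (h1.mul_left (adet g : ℂ)⁻¹).congr_fun fun z => ?_
    rw [hch (fun x => u (g.symm x) * ex (inner ℝ (intVec z) x)),
      hch (fun x => v (g.symm x) * ex (inner ℝ (intVec z) x))]
    simp only [ContinuousLinearEquiv.symm_apply_apply, map_mul, Complex.conj_ofReal]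
    field_simp
  · refine (h2.mul_left (adet g : ℂ)⁻¹).congr_fun fun k => ?_
    rw [hch (fun x => u (g.symm x) * conj (v (g.symm (x + intVec k))))]
    simp only [ContinuousLinearEquiv.symm_apply_apply, map_add]
    field_simp

end OrthFrames

/-! ### Expanding maps: orbits, lattice counting and off-diagonal mass -/

namespace OrthFrames

variable {d : ℕ}

/-- All sufficiently high negative powers of `b` are contractions by any prescribed factor. -/
def IsExpanding (b : EuclideanSpace ℝ (Fin d) ≃L[ℝ] EuclideanSpace ℝ (Fin d)) : Prop :=
  ∀ δ : ℝ, 0 < δ → ∃ N : ℕ, ∀ n : ℕ, N ≤ n → ∀ x, ‖(b ^ (-(n : ℤ))) x‖ ≤ δ * ‖x‖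

/-- A closed annulus around the origin. -/
def annulus (d : ℕ) (R : ℝ) : Set (EuclideanSpace ℝ (Fin d)) := {x | R⁻¹ ≤ ‖x‖ ∧ ‖x‖ ≤ R}

theorem measurableSet_annulus (R : ℝ) : MeasurableSet (annulus d R) :=
  (measurableSet_le measurable_const measurable_norm).inter
    (measurableSet_le measurable_norm measurable_const)

/-- The indicator function of an annulus. -/
noncomputable def annInd (d : ℕ) (R : ℝ) : EuclideanSpace ℝ (Fin d) → ℝ≥0∞ :=
  (annulus d R).indicator 1

theorem measurable_annInd (R : ℝ) : Measurable (annInd d R) :=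
  measurable_one.indicator (measurableSet_annulus R)

theorem annInd_le_one (R : ℝ) (x : EuclideanSpace ℝ (Fin d)) : annInd d R x ≤ 1 :=
  Set.indicator_le_self' (by simp) x

theorem annInd_of_notMem {R : ℝ} {x : EuclideanSpace ℝ (Fin d)} (h : x ∉ annulus d R) :
    annInd d R x = 0 := Set.indicator_of_notMem h _

theorem annInd_of_mem {R : ℝ} {x : EuclideanSpace ℝ (Fin d)} (h : x ∈ annulus d R) :
    annInd d R x = 1 := Set.indicator_of_mem h _

section Powers

variable (b : EuclideanSpace ℝ (Fin d) ≃L[ℝ] EuclideanSpace ℝ (Fin d))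

theorem zpow_add_apply (m n : ℤ) (x : EuclideanSpace ℝ (Fin d)) :
    (b ^ (m + n)) x = (b ^ m) ((b ^ n) x) := by
  rw [zpow_add]; rfl

theorem zpow_zero_apply (x : EuclideanSpace ℝ (Fin d)) : (b ^ (0 : ℤ)) x = x := by
  rw [zpow_zero]; rfl

theorem zpow_neg_apply_zpow (n : ℤ) (x : EuclideanSpace ℝ (Fin d)) :
    (b ^ (-n)) ((b ^ n) x) = x := by
  rw [← zpow_add_apply, neg_add_cancel, zpow_zero_apply]

variable {b}

/-- Write `b ^ n` as `b ^ N` after `b ^ (-m)` with `m ≥ 0`; all but finitely many of the latter do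
not increase norms. This bounds uniformly the diameters of the dilated cubes in the lattice count.
-/
theorem IsExpanding.exists_bound (hb : IsExpanding b) (N : ℤ) :
    ∃ c : ℝ, 0 ≤ c ∧ ∀ n ≤ N, ∀ x, ‖(b ^ n) x‖ ≤ c * ‖x‖ := by
  obtain ⟨N0, h0⟩ := hb 1 one_pos
  obtain ⟨nm, hnm0, hnm⟩ :
      ∃ nm : (EuclideanSpace ℝ (Fin d) ≃L[ℝ] EuclideanSpace ℝ (Fin d)) → ℝ,
        (∀ g, 0 ≤ nm g) ∧ ∀ g x, ‖g x‖ ≤ nm g * ‖x‖ :=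
    ⟨fun g => ‖(g : EuclideanSpace ℝ (Fin d) →L[ℝ] EuclideanSpace ℝ (Fin d))‖,
      fun g => norm_nonneg _, fun g x =>
      (g : EuclideanSpace ℝ (Fin d) →L[ℝ] EuclideanSpace ℝ (Fin d)).le_opNorm x⟩
  have h1 : ∀ m : ℕ, ∀ x, ‖(b ^ (-(m : ℤ))) x‖ ≤
      (1 + ∑ m ∈ Finset.range N0, nm (b ^ (-(m : ℤ)))) * ‖x‖ := by
    intro m x
    have hs : 0 ≤ ∑ m ∈ Finset.range N0, nm (b ^ (-(m : ℤ))) := Finset.sum_nonneg fun _ _ => hnm0 _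
    rcases le_or_gt N0 m with h | h
    · refine (h0 m h x).trans ?_
      gcongr
      linarith
    · refine (hnm _ x).trans ?_
      gcongr
      have := Finset.single_le_sum (f := fun m : ℕ => nm (b ^ (-(m : ℤ)))) (fun i _ => hnm0 _)
        (Finset.mem_range.mpr h)
      linarith
  refine ⟨nm (b ^ N) * (1 + ∑ m ∈ Finset.range N0, nm (b ^ (-(m : ℤ)))), ?_, fun n hn x => ?_⟩
  · have hs : 0 ≤ ∑ m ∈ Finset.range N0, nm (b ^ (-(m : ℤ))) := Finset.sum_nonneg fun _ _ => hnm0 _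
    have := hnm0 (b ^ N)
    positivity
  · obtain ⟨m, hm⟩ := Int.eq_ofNat_of_zero_le (sub_nonneg.mpr hn)
    have : n = N + -(m : ℤ) := by omega
    rw [this, zpow_add_apply, mul_assoc]
    exact (hnm _ _).trans (mul_le_mul_of_nonneg_left (h1 m x) (hnm0 _))

/-- Any two visits of an orbit to the annulus are fewer than `N` steps apart, so all lie in a window
of length `2 * N + 1`. Keeping away from the origin is essential here. -/
theorem IsExpanding.exists_orbit_bound (hb : IsExpanding b) {R : ℝ} (hR : 0 < R) :
    ∃ M : ℕ, ∀ x, ∑' n : ℤ, annInd d R ((b ^ n) x) ≤ M := by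
  -- Contraction by this factor sends norms at most `R` to norms at most `R⁻¹ / 2`, inside the hole
  -- of the annulus.
  obtain ⟨N, hN⟩ := hb (1 / (2 * R ^ 2)) (by positivity)
  have key : ∀ x, ∀ n n' : ℤ, (b ^ n) x ∈ annulus d R → (b ^ n') x ∈ annulus d R → n' < n + N := by
    intro x n n' h h'
    by_contra! hlt
    obtain ⟨m, hm⟩ := Int.eq_ofNat_of_zero_le (sub_nonneg.mpr ((by omega : n ≤ n')))
    have e : n = -(m : ℤ) + n' := by omega
    have h2 := hN m (by omega) ((b ^ n') x)
    rw [← zpow_add_apply, ← e] at h2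
    have h3 := h.1.trans (h2.trans (mul_le_mul_of_nonneg_left h'.2 (by positivity)))
    have h4 : 1 / (2 * R ^ 2) * R = R⁻¹ / 2 := by field_simp
    rw [h4] at h3
    have : 0 < R⁻¹ := by positivity
    linarith
  refine ⟨2 * N + 1, fun x => ?_⟩
  by_cases hne : ∃ n₀ : ℤ, (b ^ n₀) x ∈ annulus d R
  · obtain ⟨n₀, hn₀⟩ := hne
    rw [tsum_eq_sum (s := Finset.Icc (n₀ - N) (n₀ + N))]
    · refine (Finset.sum_le_card_nsmul _ _ 1 fun n _ => annInd_le_one R _).trans ?_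
      rw [Int.card_Icc, nsmul_eq_mul, mul_one]
      exact_mod_cast (by omega : (n₀ + N + 1 - (n₀ - N)).toNat ≤ 2 * N + 1)
    · intro n hn
      refine annInd_of_notMem fun h => hn ?_
      have h1 := key x n n₀ h hn₀
      have h2 := key x n₀ n hn₀ h
      exact Finset.mem_Icc.mpr ⟨by omega, by omega⟩
  · push Not at hne
    simp [annInd_of_notMem (hne _)]

theorem one_le_norm_intVec {k : Fin d → ℤ} (hk : k ≠ 0) : 1 ≤ ‖intVec k‖ := by
  obtain ⟨i, hi⟩ := Function.ne_iff.mp hk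
  refine le_trans ?_ (PiLp.norm_apply_le (intVec k) i)
  rw [intVec_apply, Real.norm_eq_abs]
  exact_mod_cast Int.one_le_abs hi

/-- Nonzero integer vectors have norm at least 1, and undoing `b ^ n` contracts by `1 / (|R| + 1)`.
-/
theorem IsExpanding.exists_lattice_far (hb : IsExpanding b) (R : ℝ) :
    ∃ N : ℤ, ∀ n ≥ N, ∀ k : Fin d → ℤ, k ≠ 0 → R < ‖(b ^ n) (intVec k)‖ := by
  obtain ⟨N, hN⟩ := hb (1 / (|R| + 1)) (by positivity)
  refine ⟨N, fun n hn k hk => ?_⟩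
  lift n to ℕ using by omega
  have h1 := hN n (by exact_mod_cast hn) ((b ^ (n : ℤ)) (intVec k))
  rw [zpow_neg_apply_zpow] at h1
  have h2 := (one_le_norm_intVec hk).trans h1
  rw [div_mul_eq_mul_div, one_mul, le_div_iff₀ (by positivity)] at h2
  have := le_abs_self R
  linarith

theorem norm_le_of_mem_cube_zero {x : EuclideanSpace ℝ (Fin d)} (hx : x ∈ cube 0) :
    ‖x‖ ≤ Real.sqrt d := by
  rw [EuclideanSpace.norm_eq]
  apply Real.sqrt_le_sqrt
  have : ∀ i ∈ Finset.univ, ‖x i‖ ^ 2 ≤ 1 := by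
    intro i _
    have := Int.ceil_eq_iff.mp (hx i)
    simp only [Pi.zero_apply, Int.cast_zero, zero_sub] at this
    rw [Real.norm_eq_abs, sq_abs]
    nlinarith
  simpa using Finset.sum_le_card_nsmul _ _ _ this

theorem volume_cube (m : Fin d → ℤ) : volume (cube m) = 1 := by
  have h0 : volume (cube (0 : Fin d → ℤ)) = 1 := by
    have h := (measurePreserving_torusRep (d := d)).measure_preimage
      (s := Set.univ) MeasurableSet.univ.nullMeasurableSet
    rw [Measure.restrict_apply_univ] at h
    rw [← h]
    exact measure_univ
  have := setLIntegral_cube_add (fun _ => 1) 0 m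
  simpa [h0] using this.symm

/-- Volume packing: the cells `y + b ^ n (cube k)` are disjoint, have volume `adet (b ^ n)`, and
those whose lattice point lies in the annulus fit in one ball, since their diameters are bounded for
`n ≤ N`. -/
theorem IsExpanding.exists_lattice_count (hb : IsExpanding b) (R : ℝ) (N : ℤ) :
    ∃ C : ℝ≥0∞, C ≠ ∞ ∧ ∀ n ≤ N, ∀ y, ∑' k : Fin d → ℤ, annInd d R (y + (b ^ n) (intVec k)) ≤
      C * ENNReal.ofReal (adet (b ^ n))⁻¹ := by
  obtain ⟨c, hc0, hc⟩ := hb.exists_bound N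
  set B : Set (EuclideanSpace ℝ (Fin d)) := Metric.closedBall 0 (R + c * Real.sqrt d) with hB
  refine ⟨volume B, measure_closedBall_lt_top.ne, fun n hn y => ?_⟩
  have hterm : ∀ k : Fin d → ℤ, annInd d R (y + (b ^ n) (intVec k)) ≤
      ∫⁻ x in cube k, B.indicator 1 (y + (b ^ n) x) := by
    intro k
    by_cases hk : y + (b ^ n) (intVec k) ∈ annulus d R
    · rw [setLIntegral_congr_fun (measurableSet_cube k) (g := fun _ => 1)]
      · simpa [volume_cube] using annInd_le_one R _
      · intro x hx
        refine Set.indicator_of_mem ?_ _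
        rw [hB, mem_closedBall_zero_iff]
        have h1 : x - intVec k ∈ cube 0 := by
          rw [← add_intVec_mem_cube _ 0 k]
          simpa using hx
        have h2 : y + (b ^ n) x = (y + (b ^ n) (intVec k)) + (b ^ n) (x - intVec k) := by
          rw [map_sub]; abel
        rw [h2]
        refine (norm_add_le _ _).trans (add_le_add hk.2 ((hc n hn _).trans ?_))
        gcongr
        exact norm_le_of_mem_cube_zero h1
    · rw [annInd_of_notMem hk]; exact zero_le
  refine (ENNReal.tsum_le_tsum hterm).trans ?_
  rw [← lintegral_iUnion (fun k => measurableSet_cube k) pairwise_disjoint_cube, iUnion_cube,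
    setLIntegral_univ, lintegral_comp_equiv (b ^ n) (fun x => B.indicator 1 (y + x)),
    lintegral_add_left_eq_self (B.indicator 1) y, lintegral_indicator_one
    Metric.isClosed_closedBall.measurableSet, mul_comm]

/-- The local integrability condition for dilates and lattice translates of a function. -/
theorem IsExpanding.lattice_energy_lt_top (hb : IsExpanding b) {R : ℝ} (hR : 0 < R)
    {u : EuclideanSpace ℝ (Fin d) → ℂ} (hum : Measurable u) (hu : MemLp u 2) :
    ∑' n : ℤ, ∑' k : Fin d → ℤ, (if k = 0 then 0 else
      ∫⁻ x, annInd d R x * annInd d R (x + (b ^ n) (intVec k)) * ‖u ((b ^ (-n)) x)‖ₑ ^ 2) < ∞ := by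
  obtain ⟨N, hN⟩ := hb.exists_lattice_far (2 * R)
  obtain ⟨C, hC, hcount⟩ := hb.exists_lattice_count R N
  obtain ⟨M, hM⟩ := hb.exists_orbit_bound hR
  have hmeas : ∀ g : EuclideanSpace ℝ (Fin d) ≃L[ℝ] EuclideanSpace ℝ (Fin d), Measurable g :=
    fun g => g.continuous.measurable
  have hua : ∀ n : ℤ, Measurable fun x => annInd d R x * ‖u ((b ^ (-n)) x)‖ₑ ^ 2 := fun n =>
    (measurable_annInd R).mul ((hum.comp (hmeas _)).enorm.pow_const 2)
  have hlayer : ∀ n : ℤ, ∑' k : Fin d → ℤ, (if k = 0 then 0 else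
      ∫⁻ x, annInd d R x * annInd d R (x + (b ^ n) (intVec k)) * ‖u ((b ^ (-n)) x)‖ₑ ^ 2) ≤
      C * ∫⁻ x, annInd d R ((b ^ n) x) * ‖u x‖ₑ ^ 2 := by
    intro n
    rcases le_or_gt N n with hn | hn
    -- Here the shift is longer than the diameter `2 * R`, so the annulus misses its translate.
    · have : ∀ k : Fin d → ℤ, (if k = 0 then 0 else
          ∫⁻ x, annInd d R x * annInd d R (x + (b ^ n) (intVec k)) *
            ‖u ((b ^ (-n)) x)‖ₑ ^ 2) = 0 := by
        intro k
        split_ifs with hk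
        · rfl
        · refine lintegral_eq_zero_of_ae_eq_zero (ae_of_all _ fun x => ?_)
          by_cases h1 : x ∈ annulus d R
          · by_cases h2 : x + (b ^ n) (intVec k) ∈ annulus d R
            · exfalso
              have h3 := norm_sub_le (x + (b ^ n) (intVec k)) x
              rw [add_sub_cancel_left] at h3
              linarith [hN n hn k hk, h1.2, h2.2]
            · simp [annInd_of_notMem h2]
          · simp [annInd_of_notMem h1]
      rw [ENNReal.tsum_eq_zero.mpr this]
      exact zero_le
    -- For `n < N` the lattice count supplies exactly the Jacobian of `x ↦ b ^ n x`, which moves the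
    -- dilation from `u` to the annulus.
    · calc _ ≤ ∑' k : Fin d → ℤ, ∫⁻ x, annInd d R x * annInd d R (x + (b ^ n) (intVec k)) *
              ‖u ((b ^ (-n)) x)‖ₑ ^ 2 := by
            refine ENNReal.tsum_le_tsum fun k => ?_
            split_ifs
            · exact zero_le
            · exact le_rfl
        _ = ∫⁻ x, (annInd d R x * ‖u ((b ^ (-n)) x)‖ₑ ^ 2) *
              ∑' k : Fin d → ℤ, annInd d R (x + (b ^ n) (intVec k)) := by
            rw [← lintegral_tsum]
            · refine lintegral_congr fun x => ?_
              rw [← ENNReal.tsum_mul_left]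
              exact tsum_congr fun k => by ring
            · intro k
              refine (((measurable_annInd R).mul
                ((measurable_annInd R).comp (measurable_add_const _))).mul
                  ((hum.comp (hmeas _)).enorm.pow_const 2)).aemeasurable
        _ ≤ ∫⁻ x, (annInd d R x * ‖u ((b ^ (-n)) x)‖ₑ ^ 2) *
              (C * ENNReal.ofReal (adet (b ^ n))⁻¹) := by
            refine lintegral_mono fun x => ?_
            gcongr
            exact hcount n hn.le x
        _ = C * (ENNReal.ofReal (adet (b ^ n))⁻¹ *
              ∫⁻ x, annInd d R x * ‖u ((b ^ (-n)) x)‖ₑ ^ 2) := by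
            rw [lintegral_mul_const _ (hua n)]; ring
        _ = C * ∫⁻ x, annInd d R ((b ^ n) x) * ‖u x‖ₑ ^ 2 := by
            rw [← lintegral_comp_equiv (b ^ n) (fun x => annInd d R x * ‖u ((b ^ (-n)) x)‖ₑ ^ 2)]
            simp only [zpow_neg_apply_zpow]
  have hfin : ∫⁻ x, ‖u x‖ₑ ^ 2 < ∞ := by
    have := lintegral_rpow_enorm_lt_top_of_eLpNorm_lt_top (by norm_num) (by norm_num) hu.2
    simpa using this
  calc _ ≤ ∑' n : ℤ, C * ∫⁻ x, annInd d R ((b ^ n) x) * ‖u x‖ₑ ^ 2 := ENNReal.tsum_le_tsum hlayer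
    _ = C * ∫⁻ x, (∑' n : ℤ, annInd d R ((b ^ n) x)) * ‖u x‖ₑ ^ 2 := by
        rw [ENNReal.tsum_mul_left, ← lintegral_tsum]
        · simp only [ENNReal.tsum_mul_right]
        · exact fun n => (((measurable_annInd R).comp (hmeas _)).mul
            (hum.enorm.pow_const 2)).aemeasurable
    -- The sum over scales is now the number of visits of the orbit of `x` to the annulus.
    _ ≤ C * ∫⁻ x, M * ‖u x‖ₑ ^ 2 := by
        gcongr with x
        exact hM x
    _ < ∞ := by
        rw [lintegral_const_mul _ (hum.enorm.pow_const 2)]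
        exact ENNReal.mul_lt_top hC.lt_top (ENNReal.mul_lt_top (ENNReal.natCast_lt_top M) hfin)

/-- The absolute value of the layer with scale `n` and shift `p` of the dual Gramian. -/
noncomputable def layerMass (b : EuclideanSpace ℝ (Fin d) ≃L[ℝ] EuclideanSpace ℝ (Fin d)) (R : ℝ)
    (u v : EuclideanSpace ℝ (Fin d) → ℂ) (n : ℤ) (p : EuclideanSpace ℝ (Fin d)) : ℝ≥0∞ :=
  ∫⁻ x, annInd d R x * annInd d R (x + p) * (‖u ((b ^ (-n)) x)‖ₑ * ‖v ((b ^ (-n)) (x + p))‖ₑ)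

theorem ENNReal.mul_le_sq_add_sq (s t : ℝ≥0∞) : s * t ≤ s ^ 2 + t ^ 2 := by
  rcases le_total s t with h | h
  · calc s * t ≤ t * t := by gcongr
      _ = t ^ 2 := (sq t).symm
      _ ≤ _ := le_add_self
  · calc s * t ≤ s * s := by gcongr
      _ = s ^ 2 := (sq s).symm
      _ ≤ _ := le_self_add

/-- The product is split by `s * t ≤ s ^ 2 + t ^ 2`, and translating the second square by `p` leaves
estimates for one function at a time, at shifts `p` and `-p`. -/
theorem layerMass_le {R : ℝ} {u v : EuclideanSpace ℝ (Fin d) → ℂ} (hum : Measurable u)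
    (n : ℤ) (p : EuclideanSpace ℝ (Fin d)) :
    layerMass b R u v n p ≤
      (∫⁻ x, annInd d R x * annInd d R (x + p) * ‖u ((b ^ (-n)) x)‖ₑ ^ 2) +
      ∫⁻ x, annInd d R x * annInd d R (x + -p) * ‖v ((b ^ (-n)) x)‖ₑ ^ 2 := by
  have hmeas : ∀ g : EuclideanSpace ℝ (Fin d) ≃L[ℝ] EuclideanSpace ℝ (Fin d), Measurable g :=
    fun g => g.continuous.measurable
  have h2 := lintegral_add_right_eq_self
    (fun x => annInd d R x * annInd d R (x + -p) * ‖v ((b ^ (-n)) x)‖ₑ ^ 2) p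
    (μ := (volume : Measure (EuclideanSpace ℝ (Fin d))))
  rw [← h2, ← lintegral_add_left]
  · refine lintegral_mono fun x => ?_
    simp only [add_neg_cancel_right]
    rw [mul_comm (annInd d R (x + p)), ← mul_add]
    gcongr
    exact ENNReal.mul_le_sq_add_sq _ _
  · exact ((measurable_annInd R).mul
      ((measurable_annInd R).comp (measurable_add_const _))).mul
        ((hum.comp (hmeas _)).enorm.pow_const 2)

theorem IsExpanding.offDiagonal_layerMass_lt_top (hb : IsExpanding b) {R : ℝ} (hR : 0 < R)
    {u v : EuclideanSpace ℝ (Fin d) → ℂ} (hum : Measurable u) (hu : MemLp u 2)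
    (hvm : Measurable v) (hv : MemLp v 2) :
    ∑' n : ℤ, ∑' k : Fin d → ℤ, (if k = 0 then 0 else
      layerMass b R u v n ((b ^ n) (intVec k))) < ∞ := by
  have h1 := hb.lattice_energy_lt_top hR hum hu
  have h2 := hb.lattice_energy_lt_top hR hvm hv
  refine lt_of_le_of_lt ?_ (ENNReal.add_lt_top.mpr ⟨h1, h2⟩)
  rw [← ENNReal.tsum_add]
  refine ENNReal.tsum_le_tsum fun n => ?_
  rw [← (Equiv.neg (Fin d → ℤ)).tsum_eq (fun k : Fin d → ℤ => (if k = 0 then (0 : ℝ≥0∞) else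
      ∫⁻ x, annInd d R x * annInd d R (x + (b ^ n) (intVec k)) * ‖v ((b ^ (-n)) x)‖ₑ ^ 2)),
    ← ENNReal.tsum_add]
  refine ENNReal.tsum_le_tsum fun k => ?_
  by_cases hk : k = 0
  · simp [hk]
  · simp only [hk, if_false, Equiv.neg_apply, neg_eq_zero, intVec_neg, map_neg]
    exact layerMass_le hum n _

end Powers

end OrthFrames

/-! ### Bessel sequences: mixed dual Gramian and density arguments -/

namespace OrthFrames

section Bessel

variable {H : Type*} [NormedAddCommGroup H] [InnerProductSpace ℂ H] {J : Type*}

theorem IsBessel.memℓp {X : J → H} (hX : IsBessel X) (v : H) :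
    Memℓp (fun j => inner ℂ (X j) v) 2 := by
  obtain ⟨C, -, h⟩ := hX
  refine memℓp_gen ?_
  simpa using (h v).1

theorem IsBessel.exists_analysis {X : J → H} (hX : IsBessel X) :
    ∃ T : H →L[ℂ] lp (fun _ : J => ℂ) 2, ∀ v j, T v j = inner ℂ (X j) v := by
  obtain ⟨C, hC, h⟩ := id hX
  refine ⟨LinearMap.mkContinuous
    { toFun := fun v => ⟨fun j => inner ℂ (X j) v, hX.memℓp v⟩
      map_add' := fun v w => by ext j; exact inner_add_right _ _ _
      map_smul' := fun c v => by ext j; exact inner_smul_right _ _ _ } (Real.sqrt C) ?_,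
    fun v j => rfl⟩
  intro v
  refine le_of_sq_le_sq ?_ (by positivity)
  have h1 := lp.norm_rpow_eq_tsum (p := 2) (by norm_num)
    (⟨fun j => inner ℂ (X j) v, hX.memℓp v⟩ : lp (fun _ : J => ℂ) 2)
  rw [mul_pow, Real.sq_sqrt hC.le]
  refine le_trans (le_of_eq ?_) (h v).2
  simpa using h1

/-- The mixed dual Gramian of two Bessel sequences is a bounded operator. -/
theorem IsBessel.exists_gramian [CompleteSpace H] {X Y : J → H} (hX : IsBessel X)
    (hY : IsBessel Y) :
    ∃ S : H →L[ℂ] H, ∀ v, HasSum (fun j => inner ℂ (X j) v • Y j) (S v) := by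
  classical
  obtain ⟨T, hT⟩ := hX.exists_analysis
  obtain ⟨U, hU⟩ := hY.exists_analysis
  -- Analysis by `X` followed by synthesis by `Y`; expanding `T v` along the unit vectors of ℓ²
  -- gives the unconditional convergence.
  refine ⟨(ContinuousLinearMap.adjoint U).comp T, fun v => ?_⟩
  have h1 := (lp.hasSum_single (by norm_num : (2 : ℝ≥0∞) ≠ ∞) (T v)).mapL
    (ContinuousLinearMap.adjoint U)
  refine h1.congr_fun fun j => ?_
  refine ext_inner_left ℂ fun w => ?_
  rw [ContinuousLinearMap.adjoint_inner_right, lp.inner_single_right, hU, hT, inner_smul_right,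
    RCLike.inner_apply, inner_conj_symm]

theorem IsBessel.summable_mul {X Y : J → H} [CompleteSpace H] (hX : IsBessel X) (hY : IsBessel Y)
    (f g : H) :
    Summable fun j => inner ℂ (X j) f * inner ℂ g (Y j) := by
  obtain ⟨S, hS⟩ := hX.exists_gramian hY
  have := (hS f).mapL (innerSL ℂ g)
  simpa [inner_smul_right] using this.summable

/-- Orthogonality of Bessel sequences can be tested on a dense subspace. -/
theorem isOrthogonal_iff_of_dense [CompleteSpace H] {X Y : J → H} (hX : IsBessel X)
    (hY : IsBessel Y) (D : Set H) (hD : Dense D) :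
    IsOrthogonal X Y ↔
      ∀ f ∈ D, ∀ g ∈ D, HasSum (fun j => inner ℂ (X j) f * inner ℂ g (Y j)) 0 := by
  obtain ⟨S, hS⟩ := hX.exists_gramian hY
  have hS' : ∀ f g, HasSum (fun j => inner ℂ (X j) f * inner ℂ g (Y j)) (inner ℂ g (S f)) := by
    intro f g
    have := (hS f).mapL (innerSL ℂ g)
    simpa [inner_smul_right] using this
  constructor
  · rintro ⟨-, -, h⟩ f - g -
    have := hS' f g
    rwa [(hS f).unique (h f), inner_zero_right] at this
  · intro h
    refine ⟨hX, hY, ?_⟩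
    have h1 : ∀ f ∈ D, S f = 0 := by
      intro f hf
      refine hD.eq_zero_of_inner_right ℂ fun g hg => ?_
      exact (hS' f g).unique (h f hf g hg)
    have h2 : (S : H → H) = fun _ => 0 :=
      Continuous.ext_on hD S.continuous continuous_const h1
    intro v
    have := hS v
    rwa [congrFun h2 v] at this

/-- A Bessel bound on a dense set extends to the whole space. -/
theorem isBessel_of_dense {X : J → H} (D : Set H) (hD : Dense D) {C : ℝ} (hC : 0 < C)
    (h : ∀ f ∈ D, ∀ s : Finset J, ∑ j ∈ s, ‖inner ℂ (X j) f‖ ^ 2 ≤ C * ‖f‖ ^ 2) :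
    IsBessel X := by
  have h1 : ∀ f, ∀ s : Finset J, ∑ j ∈ s, ‖inner ℂ (X j) f‖ ^ 2 ≤ C * ‖f‖ ^ 2 := by
    intro f s
    -- With finitely many indices both sides are continuous in `f`; this is why the hypothesis
    -- concerns partial sums.
    have hcl : IsClosed {f : H | ∑ j ∈ s, ‖inner ℂ (X j) f‖ ^ 2 ≤ C * ‖f‖ ^ 2} :=
      isClosed_le (by fun_prop) (by fun_prop)
    exact hcl.closure_subset_iff.mpr (fun f hf => h f hf s) (hD f)
  refine ⟨C, hC, fun v => ?_⟩
  have hs : Summable (fun j => ‖inner ℂ (X j) v‖ ^ 2) :=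
    summable_of_sum_le (fun j => by positivity) (h1 v)
  exact ⟨hs, hs.tsum_le_of_sum_le (h1 v)⟩

end Bessel

/-! ### Band-limited test functions -/

variable {d : ℕ}

/-- Bounded measurable functions supported in an annulus. -/
structure IsTest (R : ℝ) (F : EuclideanSpace ℝ (Fin d) → ℂ) : Prop where
  pos : 0 < R
  measurable : Measurable F
  bounded : ∃ M : ℝ, 0 ≤ M ∧ ∀ x, ‖F x‖ ≤ M
  support : ∀ x ∉ annulus d R, F x = 0

theorem IsTest.mono {R R' : ℝ} {F : EuclideanSpace ℝ (Fin d) → ℂ} (hF : IsTest R F)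
    (h : R ≤ R') : IsTest R' F :=
  ⟨hF.pos.trans_le h, hF.measurable, hF.bounded, fun x hx => hF.support x fun hx' =>
    hx ⟨(inv_anti₀ hF.pos h).trans hx'.1, hx'.2.trans h⟩⟩

theorem IsTest.eq_zero_of_lt {R : ℝ} {F : EuclideanSpace ℝ (Fin d) → ℂ} (hF : IsTest R F)
    {x : EuclideanSpace ℝ (Fin d)} (hx : R < ‖x‖) : F x = 0 :=
  hF.support x fun h => absurd h.2 (not_le.mpr hx)

theorem IsTest.memLp_mul {R : ℝ} {F : EuclideanSpace ℝ (Fin d) → ℂ} (hF : IsTest R F)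
    {u : EuclideanSpace ℝ (Fin d) → ℂ} (hu : MemLp u 2) : MemLp (fun x => F x * u x) 2 := by
  obtain ⟨M, hM0, hM⟩ := hF.bounded
  refine hu.of_le_mul (c := M) (hF.measurable.aestronglyMeasurable.mul hu.1)
    (ae_of_all _ fun x => ?_)
  rw [norm_mul]
  gcongr
  exact hM x

theorem IsTest.memLp {R : ℝ} {F : EuclideanSpace ℝ (Fin d) → ℂ} (hF : IsTest R F) :
    MemLp F 2 := by
  have h1 : MemLp ((Metric.closedBall (0 : EuclideanSpace ℝ (Fin d)) R).indicator
      fun _ => (1 : ℂ)) 2 :=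
    memLp_indicator_const 2 Metric.isClosed_closedBall.measurableSet 1
      (Or.inr measure_closedBall_lt_top.ne)
  refine (hF.memLp_mul h1).congr_norm hF.measurable.aestronglyMeasurable (ae_of_all _ fun x => ?_)
  by_cases hx : x ∈ Metric.closedBall (0 : EuclideanSpace ℝ (Fin d)) R
  · simp [Set.indicator_of_mem hx]
  · rw [mem_closedBall_zero_iff, not_le] at hx
    simp [hF.eq_zero_of_lt hx]

/-- The square integrable functions whose Fourier transform is bounded and supported in an
annulus. -/
def testSet (d : ℕ) : Set (L2 d) :=
  {f | ∃ R F, IsTest R F ∧ (𝓕 f : L2 d) =ᵐ[volume] F}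

theorem IsTest.exists_fourier {R : ℝ} {F : EuclideanSpace ℝ (Fin d) → ℂ} (hF : IsTest R F) :
    ∃ f : L2 d, (𝓕 f : L2 d) =ᵐ[volume] F := by
  refine ⟨𝓕⁻ (hF.memLp.toLp F), ?_⟩
  rw [FourierTransform.fourier_fourierInv_eq]
  exact hF.memLp.coeFn_toLp

/-- A function orthogonal to all test functions is orthogonal to the truncations of its own
transform to an annulus and to bounded values, so these truncations vanish. They exhaust the
transform off the origin, a null set in positive dimension. -/
theorem dense_testSet [Nonempty (Fin d)] : Dense (testSet d) := by
  let D : Submodule ℂ (L2 d) :=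
    { carrier := testSet d
      add_mem' := by
        rintro f g ⟨R, F, hF, hf⟩ ⟨R', G, hG, hg⟩
        have hF' := hF.mono (le_max_left R R')
        have hG' := hG.mono (le_max_right R R')
        refine ⟨max R R', F + G, ⟨hF'.pos, hF.measurable.add hG.measurable, ?_, ?_⟩, ?_⟩
        · obtain ⟨M, hM0, hM⟩ := hF.bounded
          obtain ⟨M', hM0', hM'⟩ := hG.bounded
          exact ⟨M + M', by positivity, fun x =>
            (norm_add_le _ _).trans (add_le_add (hM x) (hM' x))⟩
        · intro x hx
          simp [hF'.support x hx, hG'.support x hx]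
        · rw [FourierTransform.fourier_add]
          filter_upwards [Lp.coeFn_add (𝓕 f) (𝓕 g), hf, hg] with x h1 h2 h3
          rw [h1, Pi.add_apply, h2, h3, Pi.add_apply]
      zero_mem' := by
        refine ⟨1, 0, ⟨one_pos, measurable_zero, ⟨0, le_rfl, by simp⟩, fun _ _ => rfl⟩, ?_⟩
        have : (𝓕 (0 : L2 d) : L2 d) = 0 := map_zero (Lp.fourierTransformₗᵢ _ _)
        rw [this]
        exact Lp.coeFn_zero _ _ _
      smul_mem' := by
        rintro c f ⟨R, F, hF, hf⟩
        refine ⟨R, c • F, ⟨hF.pos, hF.measurable.const_smul c, ?_, ?_⟩, ?_⟩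
        · obtain ⟨M, hM0, hM⟩ := hF.bounded
          refine ⟨‖c‖ * M, by positivity, fun x => ?_⟩
          rw [Pi.smul_apply, norm_smul]
          gcongr
          exact hM x
        · intro x hx
          simp [hF.support x hx]
        · rw [FourierTransform.fourier_smul]
          filter_upwards [Lp.coeFn_smul c (𝓕 f), hf] with x h1 h2
          rw [h1, Pi.smul_apply, h2, Pi.smul_apply] }
  change Dense (D : Set (L2 d))
  rw [Submodule.dense_iff_topologicalClosure_eq_top, Submodule.topologicalClosure_eq_top_iff,
    Submodule.eq_bot_iff]
  intro f hf
  set h : L2 d := 𝓕 f with hh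
  have hmeas : Measurable h := (Lp.stronglyMeasurable h).measurable
  have key : ∀ n : ℕ, ∀ᵐ x, x ∈ annulus d (n + 1) → ‖h x‖ ≤ n + 1 → h x = 0 := by
    intro n
    classical
    set s : Set (EuclideanSpace ℝ (Fin d)) := annulus d (n + 1) ∩ {x | ‖h x‖ ≤ n + 1} with hs
    have hsm : MeasurableSet s := (measurableSet_annulus _).inter
      (measurableSet_le hmeas.norm measurable_const)
    have hF : IsTest (n + 1) (s.indicator h) := by
      refine ⟨by positivity, hmeas.indicator hsm, ⟨n + 1, by positivity, fun x => ?_⟩, fun x hx =>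
        Set.indicator_of_notMem (fun hx' => hx hx'.1) _⟩
      by_cases hx : x ∈ s
      · rw [Set.indicator_of_mem hx]; exact hx.2
      · rw [Set.indicator_of_notMem hx, norm_zero]; positivity
    obtain ⟨g, hg⟩ := hF.exists_fourier
    have h0 : inner ℂ g f = 0 := hf g ⟨_, _, hF, hg⟩
    rw [← Lp.inner_fourier_eq, L2.inner_def] at h0
    have h1 : ∫ x, inner ℂ ((𝓕 g : L2 d) x) ((𝓕 f : L2 d) x) =
        ((∫ x, ‖s.indicator h x‖ ^ 2 : ℝ) : ℂ) := by
      rw [← integral_complex_ofReal]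
      refine integral_congr_ae ?_
      filter_upwards [hg] with x hx
      rw [hx, ← hh]
      by_cases hxs : x ∈ s
      · rw [Set.indicator_of_mem hxs, inner_self_eq_norm_sq_to_K]; simp
      · simp [Set.indicator_of_notMem hxs]
    rw [h1, Complex.ofReal_eq_zero, integral_eq_zero_iff_of_nonneg (fun x => by positivity)
      hF.memLp.norm.integrable_sq] at h0
    filter_upwards [h0] with x hx hx1 hx2
    rw [Set.indicator_of_mem (show x ∈ s from ⟨hx1, hx2⟩)] at hx
    simpa using hx
  have hzero : h = 0 := by
    apply Lp.ext
    have hne : ∀ᵐ x : EuclideanSpace ℝ (Fin d), x ≠ 0 := by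
      simp [ae_iff]
    filter_upwards [ae_all_iff.mpr key, hne, Lp.coeFn_zero ℂ 2
      (volume : Measure (EuclideanSpace ℝ (Fin d)))] with x hx hx0 h0
    rw [h0, Pi.zero_apply]
    have hpos := norm_pos_iff.mpr hx0
    obtain ⟨n, hn⟩ := exists_nat_ge (max (max ‖x‖⁻¹ ‖x‖) ‖h x‖)
    have hn1 : ‖x‖⁻¹ ≤ n := (le_max_left _ _).trans ((le_max_left _ _).trans hn)
    have hn2 : ‖x‖ ≤ n := (le_max_right _ _).trans ((le_max_left _ _).trans hn)
    have hn3 : ‖h x‖ ≤ n := (le_max_right _ _).trans hn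
    exact hx n ⟨inv_le_of_inv_le₀ hpos (by linarith), by linarith⟩ (by linarith)
  have : ‖f‖ = 0 := by rw [← Lp.norm_fourier_eq f, ← hh, hzero, norm_zero]
  exact norm_eq_zero.mp this

end OrthFrames

/-! ### Averages of characters and trigonometric series -/

namespace OrthFrames

open Filter Topology

theorem ex_nat_mul (m : ℕ) (t : ℝ) : ex (m * t) = ex t ^ m := by
  induction m with
  | zero => simp [ex_zero]
  | succ m ih => rw [pow_succ, ← ih, ← ex_add]; push_cast; ring_nf

theorem norm_average_ex_le (M : ℕ) (t : ℝ) :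
    ‖(M : ℂ)⁻¹ * ∑ m ∈ Finset.range M, ex (m * t)‖ ≤ 1 := by
  rw [norm_mul, norm_inv, Complex.norm_natCast]
  have h : ‖∑ m ∈ Finset.range M, ex (m * t)‖ ≤ M := by
    refine (norm_sum_le _ _).trans ?_
    simp [norm_ex]
  rcases Nat.eq_zero_or_pos M with rfl | hM
  · simp
  · have : (0 : ℝ) < M := by exact_mod_cast hM
    rw [inv_mul_le_iff₀ this]; simpa using h

/-- A geometric sum with ratio `ex t ≠ 1` is bounded by `2 / ‖ex t - 1‖`, so division by `M` kills
it; the ratio is 1 exactly for integer `t`. -/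
theorem tendsto_average_ex (t : ℝ) [Decidable (∃ m : ℤ, t = m)] :
    Tendsto (fun M : ℕ => (M : ℂ)⁻¹ * ∑ m ∈ Finset.range M, ex (m * t)) atTop
      (𝓝 (if ∃ m : ℤ, t = m then 1 else 0)) := by
  simp only [ex_nat_mul]
  split_ifs with h
  · rw [← ex_eq_one_iff] at h
    rw [h]
    refine tendsto_const_nhds.congr' ?_
    filter_upwards [eventually_gt_atTop 0] with M hM
    have : (M : ℂ) ≠ 0 := by exact_mod_cast hM.ne'
    simp [this]
  · rw [← ex_eq_one_iff] at h
    have h1 : ∀ M : ℕ, ‖(M : ℂ)⁻¹ * ∑ m ∈ Finset.range M, ex t ^ m‖ ≤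
        (M : ℝ)⁻¹ * (2 / ‖ex t - 1‖) := by
      intro M
      rw [geom_sum_eq h, norm_mul, norm_inv, Complex.norm_natCast, norm_div]
      gcongr
      refine (norm_sub_le _ _).trans ?_
      rw [norm_pow, norm_ex, one_pow, norm_one]; norm_num
    refine squeeze_zero_norm h1 ?_
    have := (tendsto_inv_atTop_nhds_zero_nat (𝕜 := ℝ)).mul_const (2 / ‖ex t - 1‖)
    simpa using this

variable {d : ℕ}

/-- The box of natural vectors with coordinates below `M`. -/
def natBox (d M : ℕ) : Finset (Fin d → ℕ) := Fintype.piFinset fun _ => Finset.range M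

/-- The integer vector with the given natural coordinates. -/
def natVec (w : Fin d → ℕ) : EuclideanSpace ℝ (Fin d) := intVec fun i => (w i : ℤ)

theorem average_natBox (M : ℕ) (p : EuclideanSpace ℝ (Fin d)) :
    ((M : ℂ) ^ d)⁻¹ * ∑ w ∈ natBox d M, ex (inner ℝ (natVec w) p) =
      ∏ i, ((M : ℂ)⁻¹ * ∑ m ∈ Finset.range M, ex (m * p i)) := by
  have hx : ∀ s : Finset (Fin d), ∀ a : Fin d → ℝ, ex (∑ i ∈ s, a i) = ∏ i ∈ s, ex (a i) := by
    intro s a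
    induction s using Finset.cons_induction with
    | empty => simp [ex_zero]
    | cons i s hi ih => rw [Finset.sum_cons, Finset.prod_cons, ex_add, ih]
  rw [Finset.prod_mul_distrib, Finset.prod_const, Finset.card_univ, Fintype.card_fin, inv_pow,
    Finset.prod_univ_sum]
  congr 1
  refine Finset.sum_congr rfl fun w _ => ?_
  rw [PiLp.inner_apply, hx]
  refine Finset.prod_congr rfl fun i _ => ?_
  simp [natVec, intVec_apply, mul_comm]

theorem norm_average_natBox_le (M : ℕ) (p : EuclideanSpace ℝ (Fin d)) :
    ‖((M : ℂ) ^ d)⁻¹ * ∑ w ∈ natBox d M, ex (inner ℝ (natVec w) p)‖ ≤ 1 := by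
  rw [average_natBox, norm_prod]
  exact Finset.prod_le_one (fun _ _ => norm_nonneg _) fun i _ => norm_average_ex_le M (p i)

open Classical in
theorem tendsto_average_natBox (p : EuclideanSpace ℝ (Fin d)) :
    Tendsto (fun M : ℕ => ((M : ℂ) ^ d)⁻¹ * ∑ w ∈ natBox d M, ex (inner ℝ (natVec w) p)) atTop
      (𝓝 (if p ∈ Set.range intVec then 1 else 0)) := by
  simp only [average_natBox]
  have h := tendsto_finsetProd (Finset.univ : Finset (Fin d))
    (fun i _ => tendsto_average_ex (p i))
  convert h using 2
  rw [Finset.prod_ite_zero, Finset.prod_const_one]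
  congr 1
  simp only [Set.mem_range, Finset.mem_univ, true_imp_iff, eq_iff_iff]
  constructor
  · rintro ⟨z, rfl⟩ i
    exact ⟨z i, rfl⟩
  · intro hp
    choose z hz using hp
    exact ⟨z, by ext i; rw [hz i]; rfl⟩

open Classical in
/-- Averages over integer boxes extract the integer frequencies of an absolutely convergent
trigonometric series. -/
theorem tendsto_average_series {J : Type*} {c : J → ℂ} (hc : Summable c)
    (p : J → EuclideanSpace ℝ (Fin d)) :
    Tendsto (fun M : ℕ => ((M : ℂ) ^ d)⁻¹ *
        ∑ w ∈ natBox d M, ∑' j, c j * ex (inner ℝ (natVec w) (p j))) atTop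
      (𝓝 (∑' j, if p j ∈ Set.range intVec then c j else 0)) := by
  have hs : ∀ w : Fin d → ℕ, Summable fun j => c j * ex (inner ℝ (natVec w) (p j)) := fun w =>
    Summable.of_norm_bounded hc.norm fun j => by rw [norm_mul, norm_ex, mul_one]
  have h1 : ∀ M : ℕ, ((M : ℂ) ^ d)⁻¹ *
        ∑ w ∈ natBox d M, ∑' j, c j * ex (inner ℝ (natVec w) (p j)) =
      ∑' j, c j * (((M : ℂ) ^ d)⁻¹ * ∑ w ∈ natBox d M, ex (inner ℝ (natVec w) (p j))) := by
    intro M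
    rw [← Summable.tsum_finsetSum fun w _ => hs w, ← tsum_mul_left]
    refine tsum_congr fun j => ?_
    rw [← Finset.mul_sum]; ring
  simp only [h1]
  refine tendsto_tsum_of_dominated_convergence hc.norm (fun j => ?_) (Eventually.of_forall
    fun M j => ?_)
  · have := (tendsto_average_natBox (p j)).const_mul (c j)
    simpa using this
  · rw [norm_mul]
    exact mul_le_of_le_one_right (norm_nonneg _) (norm_average_natBox_le M (p j))

open Classical in
/-- Uniqueness of the coefficients of an absolutely convergent trigonometric series. -/
theorem fiber_tsum_eq_zero {J : Type*} {c : J → ℂ} (hc : Summable c)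
    (p : J → EuclideanSpace ℝ (Fin d))
    (h : ∀ y, ∑' j, c j * ex (inner ℝ y (p j)) = 0) (p₀ : EuclideanSpace ℝ (Fin d)) :
    ∑' j, (if p j = p₀ then c j else 0) = 0 := by
  -- Averaging over `y ∈ (m + 1)⁻¹ ℤᵈ` after modulating by `p₀` selects the `j` with `p j - p₀ ∈ (m
  -- + 1) ℤᵈ`. As `m` grows only `p j = p₀` survives.
  have h1 : ∀ m : ℕ, ∑' j, (if ((m : ℝ) + 1)⁻¹ • (p j - p₀) ∈ Set.range intVec then c j else 0)
      = 0 := by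
    intro m
    refine tendsto_nhds_unique (tendsto_average_series hc
      fun j => ((m : ℝ) + 1)⁻¹ • (p j - p₀)) ?_
    have : ∀ w : Fin d → ℕ,
        ∑' j, c j * ex (inner ℝ (natVec w) (((m : ℝ) + 1)⁻¹ • (p j - p₀))) = 0 := by
      intro w
      have h2 := h (((m : ℝ) + 1)⁻¹ • natVec w)
      have h3 : ∀ j, c j * ex (inner ℝ (natVec w) (((m : ℝ) + 1)⁻¹ • (p j - p₀))) =
          (c j * ex (inner ℝ (((m : ℝ) + 1)⁻¹ • natVec w) (p j))) *
            ex (-inner ℝ (((m : ℝ) + 1)⁻¹ • natVec w) p₀) := by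
        intro j
        rw [mul_assoc, ← ex_add, inner_smul_right, inner_sub_right, inner_smul_left,
          inner_smul_left]
        congr 2
        simp only [conj_trivial]
        ring
      simp only [h3]
      rw [tsum_mul_right, h2, zero_mul]
    simp [this]
  refine tendsto_nhds_unique (f := fun m : ℕ => ∑' j,
    (if ((m : ℝ) + 1)⁻¹ • (p j - p₀) ∈ Set.range intVec then c j else 0)) (l := atTop) ?_ ?_
  · refine tendsto_tsum_of_dominated_convergence hc.norm (fun j => ?_) (Eventually.of_forall
      fun m j => ?_)
    · refine tendsto_const_nhds.congr' ?_
      obtain ⟨m₀, hm₀⟩ := exists_nat_ge ‖p j - p₀‖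
      filter_upwards [eventually_ge_atTop m₀] with m hm
      by_cases hj : p j = p₀
      · rw [if_pos hj, if_pos]
        exact ⟨0, by rw [hj, sub_self, smul_zero, intVec_zero]⟩
      · rw [if_neg hj, if_neg]
        rintro ⟨z, hz⟩
        have hz0 : z ≠ 0 := by
          rintro rfl
          rw [intVec_zero, eq_comm, smul_eq_zero] at hz
          rcases hz with hz | hz
          · have : (0 : ℝ) < ((m : ℝ) + 1)⁻¹ := by positivity
            exact this.ne' hz
          · exact hj (sub_eq_zero.mp hz)
        have h4 := one_le_norm_intVec hz0
        rw [hz, norm_smul, norm_inv, Real.norm_of_nonneg (by positivity),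
          le_inv_mul_iff₀ (by positivity)] at h4
        have : (m₀ : ℝ) ≤ m := by exact_mod_cast hm
        linarith
    · split_ifs
      · exact le_rfl
      · simp
  · simp only [h1]
    exact tendsto_const_nhds

/-! ### Systems with lattice structure -/

variable {r : ℕ}

/-- The Fourier transforms of the members of `X` are the modulations along the lattice of scale
`ε n` of the dilates of `ψ`. -/
def LatticeForm (b : EuclideanSpace ℝ (Fin d) ≃L[ℝ] EuclideanSpace ℝ (Fin d)) (ε : ℤ → ℤ)
    (ψ : Fin r → EuclideanSpace ℝ (Fin d) → ℂ) (X : ℤ × (Fin d → ℤ) × Fin r → L2 d) : Prop :=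
  ∀ n z i, (𝓕 (X (n, z, i)) : L2 d) =ᵐ[volume] fun x =>
    (Real.sqrt (adet (b ^ (-ε n))) : ℂ) * ex (-inner ℝ (intVec z) ((b ^ (-ε n)) x)) *
      ψ i ((b ^ (-n)) x)

/-- The contribution of the scale `n` and the shift `p` to the mixed dual Gramian. -/
noncomputable def gramTerm (b : EuclideanSpace ℝ (Fin d) ≃L[ℝ] EuclideanSpace ℝ (Fin d))
    (u v F G : EuclideanSpace ℝ (Fin d) → ℂ) (n : ℤ) (p : EuclideanSpace ℝ (Fin d)) : ℂ :=
  ∫ x, (F x * conj (u ((b ^ (-n)) x))) * conj (G (x + p) * conj (v ((b ^ (-n)) (x + p))))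

section Layers

variable {b : EuclideanSpace ℝ (Fin d) ≃L[ℝ] EuclideanSpace ℝ (Fin d)} {ε : ℤ → ℤ}
  {ψ φ : Fin r → EuclideanSpace ℝ (Fin d) → ℂ} {X Y : ℤ × (Fin d → ℤ) × Fin r → L2 d}

theorem LatticeForm.inner_eq (hX : LatticeForm b ε ψ X) {f : L2 d}
    {F : EuclideanSpace ℝ (Fin d) → ℂ} (hf : (𝓕 f : L2 d) =ᵐ[volume] F)
    (n : ℤ) (z : Fin d → ℤ) (i : Fin r) :
    inner ℂ (X (n, z, i)) f = Real.sqrt (adet (b ^ (-ε n))) *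
      ∫ x, (F x * conj (ψ i ((b ^ (-n)) x))) * ex (inner ℝ (intVec z) ((b ^ (-ε n)) x)) := by
  rw [← Lp.inner_fourier_eq, L2.inner_def, ← integral_const_mul]
  refine integral_congr_ae ?_
  filter_upwards [hf, hX n z i] with x h1 h2
  rw [h1, h2, RCLike.inner_apply, map_mul, map_mul, conj_ex, neg_neg, Complex.conj_ofReal]
  ring

/-- The coefficients of one layer are Fourier coefficients along a lattice, and their squared
normalization is the determinant in Parseval's identity. Naming the common value `s` allows layers
to be compared before the total sum is known to converge. -/
theorem LatticeForm.hasSum_layer (hX : LatticeForm b ε ψ X) (hY : LatticeForm b ε φ Y)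
    (hψ : ∀ i, MemLp (ψ i) 2) (hφ : ∀ i, MemLp (φ i) 2) {f g : L2 d}
    {F G : EuclideanSpace ℝ (Fin d) → ℂ} {R : ℝ} (hF : IsTest R F) (hG : IsTest R G)
    (hf : (𝓕 f : L2 d) =ᵐ[volume] F) (hg : (𝓕 g : L2 d) =ᵐ[volume] G) (n : ℤ) (i : Fin r) :
    ∃ s : ℂ, HasSum (fun z => inner ℂ (X (n, z, i)) f * inner ℂ g (Y (n, z, i))) s ∧
      HasSum (fun k => gramTerm b (ψ i) (φ i) F G n ((b ^ ε n) (intVec k))) s := by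
  have hu : MemLp (fun x => F x * conj (ψ i ((b ^ (-n)) x))) 2 :=
    hF.memLp_mul (memLp_comp_equiv (b ^ (-n)) (hψ i)).star
  have hv : MemLp (fun x => G x * conj (φ i ((b ^ (-n)) x))) 2 :=
    hG.memLp_mul (memLp_comp_equiv (b ^ (-n)) (hφ i)).star
  obtain ⟨s, h1, h2⟩ := hasSum_lattice_coeff_equiv (b ^ (-ε n)) hu hv (R := R)
    (fun x hx => by rw [hF.eq_zero_of_lt hx, zero_mul])
    (fun x hx => by rw [hG.eq_zero_of_lt hx, zero_mul])
  refine ⟨s, h1.congr_fun fun z => ?_, h2.congr_fun fun k => ?_⟩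
  · rw [← inner_conj_symm g, hX.inner_eq hf, hY.inner_eq hg, map_mul, Complex.conj_ofReal]
    have : (adet (b ^ (-ε n)) : ℂ) = Real.sqrt (adet (b ^ (-ε n))) *
        Real.sqrt (adet (b ^ (-ε n))) := by
      exact_mod_cast (Real.mul_self_sqrt (adet_pos _).le).symm
    rw [this]
    ring
  · have : (b ^ (-ε n)).symm (intVec k) = (b ^ ε n) (intVec k) := by
      rw [ContinuousLinearEquiv.symm_apply_eq, zpow_neg_apply_zpow]
    rw [gramTerm, this]

/-- The bound of the contribution of one layer. -/
theorem enorm_gramTerm_le {F G : EuclideanSpace ℝ (Fin d) → ℂ} {R : ℝ} (hF : IsTest R F)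
    (hG : IsTest R G) :
    ∃ C : ℝ≥0∞, C ≠ ∞ ∧ (∀ x y, ‖F x‖ₑ * ‖G y‖ₑ ≤ C * (annInd d R x * annInd d R y)) ∧
      ∀ (u v : EuclideanSpace ℝ (Fin d) → ℂ) n p,
        ‖gramTerm b u v F G n p‖ₑ ≤ C * layerMass b R u v n p := by
  obtain ⟨M, hM0, hM⟩ := hF.bounded
  obtain ⟨M', hM0', hM'⟩ := hG.bounded
  have key : ∀ (F : EuclideanSpace ℝ (Fin d) → ℂ) (M : ℝ), 0 ≤ M → (∀ x, ‖F x‖ ≤ M) →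
      IsTest R F → ∀ x, ‖F x‖ₑ ≤ ENNReal.ofReal M * annInd d R x := by
    intro F M _ hM hF x
    by_cases hx : x ∈ annulus d R
    · rw [annInd_of_mem hx, mul_one, ← ofReal_norm]
      exact ENNReal.ofReal_le_ofReal (hM x)
    · simp [hF.support x hx]
  have hb : ∀ x y, ‖F x‖ₑ * ‖G y‖ₑ ≤
      ENNReal.ofReal M * ENNReal.ofReal M' * (annInd d R x * annInd d R y) := by
    intro x y
    calc _ ≤ (ENNReal.ofReal M * annInd d R x) * (ENNReal.ofReal M' * annInd d R y) :=
          mul_le_mul' (key F M hM0 hM hF x) (key G M' hM0' hM' hG y)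
      _ = _ := by ring
  refine ⟨ENNReal.ofReal M * ENNReal.ofReal M', by finiteness, hb, fun u v n p => ?_⟩
  refine (enorm_integral_le_lintegral_enorm _).trans ?_
  rw [layerMass, ← lintegral_const_mul' _ _ (by finiteness)]
  refine lintegral_mono fun x => ?_
  simp only [enorm_mul, RCLike.enorm_conj]
  calc _ = (‖F x‖ₑ * ‖G (x + p)‖ₑ) * (‖u ((b ^ (-n)) x)‖ₑ * ‖v ((b ^ (-n)) (x + p))‖ₑ) := by ring
    _ ≤ _ := mul_le_mul' (hb x (x + p)) le_rfl
    _ = _ := by ring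

/-- All layers together have finite mass on every annulus. -/
def FiniteMass (b : EuclideanSpace ℝ (Fin d) ≃L[ℝ] EuclideanSpace ℝ (Fin d)) (ε : ℤ → ℤ)
    (ψ φ : Fin r → EuclideanSpace ℝ (Fin d) → ℂ) : Prop :=
  ∀ R : ℝ, 0 < R → ∑' q : (ℤ × Fin r) × (Fin d → ℤ),
    layerMass b R (ψ q.1.2) (φ q.1.2) q.1.1 ((b ^ ε q.1.1) (intVec q.2)) < ∞

theorem summable_of_tsum_enorm_lt_top {J : Type*} {c : J → ℂ} (h : ∑' j, ‖c j‖ₑ < ∞) :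
    Summable c := by
  refine Summable.of_norm ?_
  have := ENNReal.summable_toReal h.ne
  simpa using this

theorem FiniteMass.summable_gramTerm (hm : FiniteMass b ε ψ φ)
    {F G : EuclideanSpace ℝ (Fin d) → ℂ} {R : ℝ} (hF : IsTest R F) (hG : IsTest R G) :
    Summable fun q : (ℤ × Fin r) × (Fin d → ℤ) =>
      gramTerm b (ψ q.1.2) (φ q.1.2) F G q.1.1 ((b ^ ε q.1.1) (intVec q.2)) := by
  obtain ⟨C, hC, -, h⟩ := enorm_gramTerm_le (b := b) hF hG
  refine summable_of_tsum_enorm_lt_top ?_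
  refine (ENNReal.tsum_le_tsum fun q => h _ _ _ _).trans_lt ?_
  rw [ENNReal.tsum_mul_left]
  exact ENNReal.mul_lt_top hC.lt_top (hm R hF.pos)

/-- The index set of a system, regrouped into layers. -/
def regroup (d r : ℕ) : (ℤ × Fin r) × (Fin d → ℤ) ≃ ℤ × (Fin d → ℤ) × Fin r where
  toFun q := (q.1.1, q.2, q.1.2)
  invFun p := ((p.1, p.2.2), p.2.1)
  left_inv _ := rfl
  right_inv _ := rfl

/-- The sesquilinear form of the mixed dual Gramian on test functions. -/
theorem LatticeForm.hasSum_gramTerm (hX : LatticeForm b ε ψ X) (hY : LatticeForm b ε φ Y)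
    (hψ : ∀ i, MemLp (ψ i) 2) (hφ : ∀ i, MemLp (φ i) 2) (hm : FiniteMass b ε ψ φ) {f g : L2 d}
    {F G : EuclideanSpace ℝ (Fin d) → ℂ} {R : ℝ} (hF : IsTest R F) (hG : IsTest R G)
    (hf : (𝓕 f : L2 d) =ᵐ[volume] F) (hg : (𝓕 g : L2 d) =ᵐ[volume] G)
    (hs : Summable fun j => inner ℂ (X j) f * inner ℂ g (Y j)) :
    HasSum (fun j => inner ℂ (X j) f * inner ℂ g (Y j))
      (∑' q : (ℤ × Fin r) × (Fin d → ℤ),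
        gramTerm b (ψ q.1.2) (φ q.1.2) F G q.1.1 ((b ^ ε q.1.1) (intVec q.2))) := by
  -- Both absolutely convergent families have the same layer sums `s`, hence the same total.
  choose s h1 h2 using hX.hasSum_layer hY hψ hφ hF hG hf hg
  have e1 := ((regroup d r).hasSum_iff.mpr hs.hasSum).prod_fiberwise (g := fun m : ℤ × Fin r => s m.1 m.2)
    fun m => h1 m.1 m.2
  have e2 := (hm.summable_gramTerm hF hG).hasSum.prod_fiberwise (g := fun m : ℤ × Fin r => s m.1 m.2)
    fun m => h2 m.1 m.2
  rw [e2.unique e1]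
  exact hs.hasSum

end Layers

end OrthFrames

/-! ### Grouping the Gramian by shifts -/

namespace OrthFrames

open Filter Topology

variable {d r : ℕ}

open Classical in
/-- The contribution of the scale and the generator `m` to the coefficient of the mixed dual
Gramian at the shift `p`. -/
noncomputable def dualTerm (b : EuclideanSpace ℝ (Fin d) ≃L[ℝ] EuclideanSpace ℝ (Fin d))
    (ε : ℤ → ℤ) (ψ φ : Fin r → EuclideanSpace ℝ (Fin d) → ℂ) (p : EuclideanSpace ℝ (Fin d))
    (m : ℤ × Fin r) (x : EuclideanSpace ℝ (Fin d)) : ℂ :=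
  if ∃ k, (b ^ ε m.1) (intVec k) = p then
    conj (ψ m.2 ((b ^ (-m.1)) x)) * φ m.2 ((b ^ (-m.1)) (x + p)) else 0

variable {b : EuclideanSpace ℝ (Fin d) ≃L[ℝ] EuclideanSpace ℝ (Fin d)} {ε : ℤ → ℤ}
  {ψ φ : Fin r → EuclideanSpace ℝ (Fin d) → ℂ} {X Y : ℤ × (Fin d → ℤ) × Fin r → L2 d}

theorem measurable_dualTerm (hψ : ∀ i, Measurable (ψ i)) (hφ : ∀ i, Measurable (φ i))
    (p : EuclideanSpace ℝ (Fin d)) (m : ℤ × Fin r) : Measurable (dualTerm b ε ψ φ p m) := by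
  have hmeas : ∀ g : EuclideanSpace ℝ (Fin d) ≃L[ℝ] EuclideanSpace ℝ (Fin d), Measurable g :=
    fun g => g.continuous.measurable
  unfold dualTerm
  split_ifs
  · exact (Complex.continuous_conj.measurable.comp ((hψ _).comp (hmeas _))).mul
      ((hφ _).comp ((hmeas _).comp (measurable_add_const p)))
  · exact measurable_const

theorem FiniteMass.dualTerm_mass_lt_top (hm : FiniteMass b ε ψ φ) {R : ℝ} (hR : 0 < R)
    (p : EuclideanSpace ℝ (Fin d)) :
    ∑' m, ∫⁻ x, annInd d R x * annInd d R (x + p) * ‖dualTerm b ε ψ φ p m x‖ₑ < ∞ := by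
  refine lt_of_le_of_lt ?_ (hm R hR)
  rw [ENNReal.tsum_prod' (f := fun q : (ℤ × Fin r) × (Fin d → ℤ) =>
    layerMass b R (ψ q.1.2) (φ q.1.2) q.1.1 ((b ^ ε q.1.1) (intVec q.2)))]
  refine ENNReal.tsum_le_tsum fun m => ?_
  by_cases h : ∃ k, (b ^ ε m.1) (intVec k) = p
  · obtain ⟨k, hk⟩ := h
    refine le_trans (le_of_eq ?_) (ENNReal.le_tsum k)
    rw [hk, layerMass]
    refine lintegral_congr fun x => ?_
    rw [dualTerm, if_pos ⟨k, hk⟩, enorm_mul, RCLike.enorm_conj]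
  · simp [dualTerm, h]

theorem FiniteMass.ae_dualTerm (hm : FiniteMass b ε ψ φ)
    (hψ : ∀ i, Measurable (ψ i)) (hφ : ∀ i, Measurable (φ i)) {R : ℝ} (hR : 0 < R)
    (p : EuclideanSpace ℝ (Fin d)) :
    ∀ᵐ x, x ∈ annulus d R → x + p ∈ annulus d R → Summable fun m => dualTerm b ε ψ φ p m x := by
  have h := hm.dualTerm_mass_lt_top hR p
  have hmeas : ∀ m, Measurable fun x => annInd d R x * annInd d R (x + p) *
      ‖dualTerm b ε ψ φ p m x‖ₑ := fun m =>
    ((measurable_annInd R).mul ((measurable_annInd R).comp (measurable_add_const _))).mul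
      (measurable_dualTerm hψ hφ p m).enorm
  rw [← lintegral_tsum fun m => (hmeas m).aemeasurable] at h
  filter_upwards [ae_lt_top (Measurable.tsum hmeas) h.ne] with x hx h1 h2
  refine summable_of_tsum_enorm_lt_top ?_
  simpa [annInd_of_mem h1, annInd_of_mem h2] using hx

theorem FiniteMass.lintegral_test_mul_dualTerm_lt_top (hm : FiniteMass b ε ψ φ)
    {F G : EuclideanSpace ℝ (Fin d) → ℂ} {R : ℝ} (hF : IsTest R F) (hG : IsTest R G)
    (p : EuclideanSpace ℝ (Fin d)) :
    ∑' m, ∫⁻ x, ‖F x * conj (G (x + p)) * dualTerm b ε ψ φ p m x‖ₑ < ∞ := by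
  obtain ⟨C, hC, h, -⟩ := enorm_gramTerm_le (b := b) hF hG
  refine lt_of_le_of_lt ?_ (ENNReal.mul_lt_top hC.lt_top (hm.dualTerm_mass_lt_top hF.pos p))
  rw [← ENNReal.tsum_mul_left]
  refine ENNReal.tsum_le_tsum fun m => ?_
  rw [← lintegral_const_mul' _ _ hC]
  refine lintegral_mono fun x => ?_
  simp only [enorm_mul, RCLike.enorm_conj]
  rw [← mul_assoc]
  exact mul_le_mul' (h x (x + p)) le_rfl

theorem aestronglyMeasurable_test_mul_dualTerm
    (hψ : ∀ i, Measurable (ψ i)) (hφ : ∀ i, Measurable (φ i))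
    {F G : EuclideanSpace ℝ (Fin d) → ℂ} {R : ℝ} (hF : IsTest R F) (hG : IsTest R G)
    (p : EuclideanSpace ℝ (Fin d)) (m : ℤ × Fin r) :
    AEStronglyMeasurable (fun x => F x * conj (G (x + p)) * dualTerm b ε ψ φ p m x) volume :=
  ((hF.measurable.mul (Complex.continuous_conj.measurable.comp
    (hG.measurable.comp (measurable_add_const p)))).mul
      (measurable_dualTerm hψ hφ p m)).aestronglyMeasurable

open Classical in
/-- The total contribution of a shift to the mixed dual Gramian. -/
theorem FiniteMass.tsum_fiber (hm : FiniteMass b ε ψ φ)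
    (hψ : ∀ i, Measurable (ψ i)) (hφ : ∀ i, Measurable (φ i))
    {F G : EuclideanSpace ℝ (Fin d) → ℂ} {R : ℝ} (hF : IsTest R F) (hG : IsTest R G)
    (p : EuclideanSpace ℝ (Fin d)) :
    ∑' q : (ℤ × Fin r) × (Fin d → ℤ), (if (b ^ ε q.1.1) (intVec q.2) = p then
      gramTerm b (ψ q.1.2) (φ q.1.2) F G q.1.1 ((b ^ ε q.1.1) (intVec q.2)) else 0) =
    ∫ x, ∑' m, F x * conj (G (x + p)) * dualTerm b ε ψ φ p m x := by
  have hs : Summable fun q : (ℤ × Fin r) × (Fin d → ℤ) =>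
      (if (b ^ ε q.1.1) (intVec q.2) = p then
      gramTerm b (ψ q.1.2) (φ q.1.2) F G q.1.1 ((b ^ ε q.1.1) (intVec q.2)) else 0) := by
    refine Summable.of_norm_bounded (hm.summable_gramTerm hF hG).norm fun q => ?_
    split_ifs <;> simp
  rw [hs.tsum_prod, integral_tsum
    (fun m => aestronglyMeasurable_test_mul_dualTerm hψ hφ hF hG p m)
    (hm.lintegral_test_mul_dualTerm_lt_top hF hG p).ne]
  refine tsum_congr fun m => ?_
  by_cases h : ∃ k, (b ^ ε m.1) (intVec k) = p
  · obtain ⟨k, hk⟩ := h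
    -- By injectivity a layer reaches the shift `p` at most once.
    rw [tsum_eq_single k]
    · rw [if_pos hk, hk, gramTerm]
      refine integral_congr_ae (ae_of_all _ fun x => ?_)
      simp only [dualTerm]
      rw [if_pos ⟨k, hk⟩]
      simp only [map_mul, Complex.conj_conj]
      ring
    · intro k' hk'
      refine if_neg fun h' => hk' ?_
      exact intVec_injective ((b ^ ε m.1).injective (h'.trans hk.symm))
  · have h0 : ∀ k, ¬ (b ^ ε m.1) (intVec k) = p := fun k hk => h ⟨k, hk⟩
    have hd : ∀ x, dualTerm b ε ψ φ p m x = 0 := fun x => if_neg h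
    simp only [hd, h0, if_false, tsum_zero, mul_zero, integral_zero]

theorem IsTest.modulate {R : ℝ} {F : EuclideanSpace ℝ (Fin d) → ℂ} (hF : IsTest R F)
    (y : EuclideanSpace ℝ (Fin d)) : IsTest R fun x => F x * ex (-inner ℝ y x) := by
  obtain ⟨M, hM0, hM⟩ := hF.bounded
  refine ⟨hF.pos, hF.measurable.mul (continuous_ex.comp (by fun_prop)).measurable,
    ⟨M, hM0, fun x => ?_⟩, fun x hx => by rw [hF.support x hx, zero_mul]⟩
  rw [norm_mul, norm_ex, mul_one]
  exact hM x

/-- Modulating both transforms means translating `f` and `g` by `y`: the characters at `x` cancel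
and only the one at `p` remains. This creates the trigonometric series whose coefficients are
separated. -/
theorem gramTerm_modulate (u v F G : EuclideanSpace ℝ (Fin d) → ℂ) (n : ℤ)
    (p y : EuclideanSpace ℝ (Fin d)) :
    gramTerm b u v (fun x => F x * ex (-inner ℝ y x)) (fun x => G x * ex (-inner ℝ y x)) n p =
      gramTerm b u v F G n p * ex (inner ℝ y p) := by
  rw [gramTerm, gramTerm, ← integral_mul_const]
  refine integral_congr_ae (ae_of_all _ fun x => ?_)
  have h := ex_mul_neg (inner ℝ y x)
  simp only [map_mul, conj_ex, neg_neg, inner_add_right, ex_add]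
  linear_combination (F x * conj (u ((b ^ (-n)) x)) * conj (G (x + p)) *
    conj (conj (v ((b ^ (-n)) (x + p)))) * ex (inner ℝ y p)) * h

theorem isTest_indicator {R : ℝ} (hR : 0 < R) {s : Set (EuclideanSpace ℝ (Fin d))}
    (hs : MeasurableSet s) (hsR : s ⊆ annulus d R) : IsTest R (s.indicator fun _ => (1 : ℂ)) := by
  refine ⟨hR, measurable_const.indicator hs, ⟨1, zero_le_one, fun x => ?_⟩, fun x hx =>
    Set.indicator_of_notMem (fun h => hx (hsR h)) _⟩
  refine (norm_indicator_le_norm_self _ _).trans ?_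
  simp

/-- Vanishing of all the coefficients of the mixed dual Gramian on an annulus. -/
theorem FiniteMass.ae_tsum_dualTerm_eq_zero (hm : FiniteMass b ε ψ φ)
    (hψ : ∀ i, Measurable (ψ i)) (hφ : ∀ i, Measurable (φ i)) {R : ℝ} (hR : 0 < R)
    (p : EuclideanSpace ℝ (Fin d))
    (h : ∀ F G : EuclideanSpace ℝ (Fin d) → ℂ, IsTest R F → IsTest R G →
      ∫ x, ∑' m, F x * conj (G (x + p)) * dualTerm b ε ψ φ p m x = 0) :
    ∀ᵐ x, x ∈ annulus d R → x + p ∈ annulus d R → ∑' m, dualTerm b ε ψ φ p m x = 0 := by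
  set F₀ : EuclideanSpace ℝ (Fin d) → ℂ := (annulus d R).indicator fun _ => (1 : ℂ) with hF₀
  have hF : IsTest R F₀ := isTest_indicator hR (measurableSet_annulus R) le_rfl
  set w : ℤ × Fin r → EuclideanSpace ℝ (Fin d) → ℂ := fun m x =>
    F₀ x * conj (F₀ (x + p)) * dualTerm b ε ψ φ p m x with hw
  have hwm : ∀ m, AEStronglyMeasurable (w m) volume :=
    aestronglyMeasurable_test_mul_dualTerm hψ hφ hF hF p
  have hwi := hm.lintegral_test_mul_dualTerm_lt_top hF hF p
  rw [← lintegral_tsum fun m => (hwm m).enorm] at hwi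
  have hae : ∀ᵐ x, Summable fun m => w m x := by
    filter_upwards [ae_lt_top' (AEMeasurable.tsum fun m => (hwm m).enorm) hwi.ne]
      with x hx
    exact summable_of_tsum_enorm_lt_top hx
  have hint : Integrable fun x => ∑' m, w m x := by
    refine ⟨aestronglyMeasurable_of_tendsto_ae atTop (f := fun (s : Finset (ℤ × Fin r)) x =>
      ∑ m ∈ s, w m x) (fun s => Finset.aestronglyMeasurable_fun_sum s fun m _ => hwm m) ?_, ?_⟩
    · filter_upwards [hae] with x hx using hx.hasSum
    · exact (lintegral_mono fun x => enorm_tsum_le_tsum_enorm).trans_lt hwi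
  have hzero := hint.ae_eq_zero_of_forall_setIntegral_eq_zero fun s hs _ => by
    -- Indicators as test functions make the integral over every measurable `s` vanish.
    have h1 := h (((s ∩ annulus d R).indicator fun _ => (1 : ℂ))) F₀
      (isTest_indicator hR (hs.inter (measurableSet_annulus R)) Set.inter_subset_right) hF
    rw [← integral_indicator hs, ← h1]
    refine integral_congr_ae (ae_of_all _ fun x => ?_)
    by_cases hx : x ∈ s
    · have e : (s ∩ annulus d R).indicator (fun _ => (1 : ℂ)) x = F₀ x := by
        by_cases hx' : x ∈ annulus d R
        · rw [hF₀, Set.indicator_of_mem hx', Set.indicator_of_mem (Set.mem_inter hx hx')]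
        · rw [hF₀, Set.indicator_of_notMem hx', Set.indicator_of_notMem fun h => hx' h.2]
      simp only [Set.indicator_of_mem hx, hw, e]
    · have : x ∉ s ∩ annulus d R := fun h => hx h.1
      simp only [Set.indicator_of_notMem hx, Set.indicator_of_notMem this, zero_mul, tsum_zero]
  filter_upwards [hzero] with x hx h1 h2
  refine Eq.trans (tsum_congr fun m => ?_) hx
  simp only [hw, hF₀, Set.indicator_of_mem h1, Set.indicator_of_mem h2, map_one, one_mul]

/-- Growing annuli capture every `x` other than `0` and `-p`, which are null in positive dimension.
-/
theorem ae_of_forall_annulus [Nonempty (Fin d)] (p : EuclideanSpace ℝ (Fin d))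
    {P : EuclideanSpace ℝ (Fin d) → Prop}
    (h : ∀ R : ℝ, 0 < R → ∀ᵐ x, x ∈ annulus d R → x + p ∈ annulus d R → P x) :
    ∀ᵐ x, P x := by
  have hall : ∀ᵐ x, ∀ n : ℕ, x ∈ annulus d (n + 1) → x + p ∈ annulus d (n + 1) → P x :=
    ae_all_iff.mpr fun n => h (n + 1) (by positivity)
  have hne : ∀ y : EuclideanSpace ℝ (Fin d), ∀ᵐ x : EuclideanSpace ℝ (Fin d), x ≠ y := by
    intro y
    simp [ae_iff]
  filter_upwards [hall, hne 0, hne (-p)] with x hx h0 hp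
  have hpos := norm_pos_iff.mpr h0
  have hpos' : 0 < ‖x + p‖ := norm_pos_iff.mpr fun h => hp (eq_neg_of_add_eq_zero_left h)
  obtain ⟨n, hn⟩ := exists_nat_ge (max (max ‖x‖⁻¹ ‖x‖) (max ‖x + p‖⁻¹ ‖x + p‖))
  have h1 := (max_le_iff.mp hn).1
  have h2 := (max_le_iff.mp hn).2
  rw [max_le_iff] at h1 h2
  exact hx n ⟨inv_le_of_inv_le₀ hpos (by linarith), by linarith⟩
    ⟨inv_le_of_inv_le₀ hpos' (by linarith), by linarith⟩

/-- Orthogonality of systems with lattice structure in terms of the coefficients of their mixed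
dual Gramian. -/
theorem LatticeForm.isOrthogonal_iff [Nonempty (Fin d)] (hX : LatticeForm b ε ψ X)
    (hY : LatticeForm b ε φ Y) (hψm : ∀ i, Measurable (ψ i)) (hφm : ∀ i, Measurable (φ i))
    (hψ : ∀ i, MemLp (ψ i) 2) (hφ : ∀ i, MemLp (φ i) 2) (hm : FiniteMass b ε ψ φ)
    (hXb : IsBessel X) (hYb : IsBessel Y) :
    IsOrthogonal X Y ↔ ∀ p, ∀ᵐ x, HasSum (fun m => dualTerm b ε ψ φ p m x) 0 := by
  rw [isOrthogonal_iff_of_dense hXb hYb _ dense_testSet]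
  constructor
  · intro h p
    refine ae_of_forall_annulus p fun R hR => ?_
    have hzero : ∀ F G : EuclideanSpace ℝ (Fin d) → ℂ, IsTest R F → IsTest R G →
        ∑' q : (ℤ × Fin r) × (Fin d → ℤ),
          gramTerm b (ψ q.1.2) (φ q.1.2) F G q.1.1 ((b ^ ε q.1.1) (intVec q.2)) = 0 := by
      intro F G hF hG
      obtain ⟨f, hf⟩ := hF.exists_fourier
      obtain ⟨g, hg⟩ := hG.exists_fourier
      exact (hX.hasSum_gramTerm hY hψ hφ hm hF hG hf hg (hXb.summable_mul hYb f g)).unique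
        (h f ⟨R, F, hF, hf⟩ g ⟨R, G, hG, hg⟩)
    have h1 := hm.ae_tsum_dualTerm_eq_zero hψm hφm hR p fun F G hF hG => by
      rw [← hm.tsum_fiber hψm hφm hF hG p]
      -- The form vanishes on all translated pairs, so the series in `y` is zero and its coefficient
      -- at `p` can be isolated.
      refine fiber_tsum_eq_zero (hm.summable_gramTerm hF hG)
        (fun q : (ℤ × Fin r) × (Fin d → ℤ) => (b ^ ε q.1.1) (intVec q.2)) (fun y => ?_) p
      rw [← hzero _ _ (hF.modulate y) (hG.modulate y)]
      exact tsum_congr fun q => (gramTerm_modulate _ _ _ _ _ _ _).symm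
    filter_upwards [h1, hm.ae_dualTerm hψm hφm hR p] with x hx1 hx2 h3 h4
    have := (hx2 h3 h4).hasSum
    rwa [hx1 h3 h4] at this
  · rintro h f ⟨R, F, hF, hf⟩ g ⟨R', G, hG, hg⟩
    have hF' := hF.mono (le_max_left R R')
    have hG' := hG.mono (le_max_right R R')
    have key := hX.hasSum_gramTerm hY hψ hφ hm hF' hG' hf hg (hXb.summable_mul hYb f g)
    -- Conversely, each fibre over a shift integrates a test weight against an a.e. vanishing sum.
    have h1 := (hm.summable_gramTerm hF' hG').hasSum.tsum_fiberwise
      fun q : (ℤ × Fin r) × (Fin d → ℤ) => (b ^ ε q.1.1) (intVec q.2)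
    have h2 : ∀ p : EuclideanSpace ℝ (Fin d),
        ∑' q : (fun q : (ℤ × Fin r) × (Fin d → ℤ) => (b ^ ε q.1.1) (intVec q.2)) ⁻¹' {p},
          gramTerm b (ψ q.1.1.2) (φ q.1.1.2) F G q.1.1.1 ((b ^ ε q.1.1.1) (intVec q.1.2)) = 0 := by
      intro p
      classical
      rw [tsum_subtype _ fun q : (ℤ × Fin r) × (Fin d → ℤ) =>
        gramTerm b (ψ q.1.2) (φ q.1.2) F G q.1.1 ((b ^ ε q.1.1) (intVec q.2))]
      have h3 := hm.tsum_fiber hψm hφm hF' hG' p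
      have h4 : ∫ x, ∑' m, F x * conj (G (x + p)) * dualTerm b ε ψ φ p m x = 0 := by
        refine integral_eq_zero_of_ae ?_
        filter_upwards [h p] with x hx
        rw [tsum_mul_left, hx.tsum_eq, mul_zero, Pi.zero_apply]
      rw [h4] at h3
      rw [← h3]
      refine tsum_congr fun q => ?_
      simp [Set.indicator_apply]
    simp only [h2] at h1
    rwa [← hasSum_zero.unique h1] at key

end OrthFrames

/-! ### Finite mass and the Bessel bound for the quasi-affine system -/

namespace OrthFrames

open Filter Topology

variable {d r : ℕ}

variable {b : EuclideanSpace ℝ (Fin d) ≃L[ℝ] EuclideanSpace ℝ (Fin d)} {ε : ℤ → ℤ}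
  {ψ φ : Fin r → EuclideanSpace ℝ (Fin d) → ℂ} {X Y : ℤ × (Fin d → ℤ) × Fin r → L2 d}

theorem inner_mul_inner_self {H : Type*} [NormedAddCommGroup H] [InnerProductSpace ℂ H] (x f : H) :
    inner ℂ x f * inner ℂ f x = ((‖inner ℂ x f‖ ^ 2 : ℝ) : ℂ) := by
  rw [← inner_conj_symm f x, Complex.mul_conj, Complex.normSq_eq_norm_sq]

theorem IsExpanding.tsum_offDiagonal_lt_top (hb : IsExpanding b)
    (hψm : ∀ i, Measurable (ψ i)) (hφm : ∀ i, Measurable (φ i))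
    (hψ : ∀ i, MemLp (ψ i) 2) (hφ : ∀ i, MemLp (φ i) 2) {R : ℝ} (hR : 0 < R) :
    ∑' q : (ℤ × Fin r) × (Fin d → ℤ), (if q.2 = 0 then 0 else
      layerMass b R (ψ q.1.2) (φ q.1.2) q.1.1 ((b ^ q.1.1) (intVec q.2))) < ∞ := by
  rw [ENNReal.tsum_prod' (f := fun q : (ℤ × Fin r) × (Fin d → ℤ) => if q.2 = 0 then (0 : ℝ≥0∞)
    else layerMass b R (ψ q.1.2) (φ q.1.2) q.1.1 ((b ^ q.1.1) (intVec q.2))),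
    ENNReal.tsum_prod' (f := fun m : ℤ × Fin r => ∑' k : Fin d → ℤ, if k = 0 then (0 : ℝ≥0∞)
    else layerMass b R (ψ m.2) (φ m.2) m.1 ((b ^ m.1) (intVec k))), ENNReal.tsum_comm, tsum_fintype]
  change ∑ i, ∑' n : ℤ, ∑' k : Fin d → ℤ, (if k = 0 then (0 : ℝ≥0∞) else
    layerMass b R (ψ i) (φ i) n ((b ^ n) (intVec k))) < ∞
  exact ENNReal.sum_lt_top.mpr fun i _ =>
    hb.offDiagonal_layerMass_lt_top hR (hψm i) (hψ i) (hφm i) (hφ i)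

/-- For equal generators and zero shift the integrand is a square modulus, so summability of the
complex diagonal terms yields finite mass. -/
theorem annulus_indicator_layer {R : ℝ} (hR : 0 < R) {u : EuclideanSpace ℝ (Fin d) → ℂ}
    (hu : MemLp u 2) (n : ℤ) :
    ∃ t : ℝ, 0 ≤ t ∧ layerMass b R u u n 0 = ENNReal.ofReal t ∧
      gramTerm b u u ((annulus d R).indicator fun _ => 1) ((annulus d R).indicator fun _ => 1) n 0
        = (t : ℂ) := by
  have hF : IsTest R ((annulus d R).indicator fun _ => (1 : ℂ)) :=
    isTest_indicator hR (measurableSet_annulus R) le_rfl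
  set h : EuclideanSpace ℝ (Fin d) → ℂ := fun x =>
    ((annulus d R).indicator (fun _ => (1 : ℂ)) x) * conj (u ((b ^ (-n)) x)) with hh
  have hm : MemLp h 2 := hF.memLp_mul (memLp_comp_equiv (b ^ (-n)) hu).star
  refine ⟨∫ x, ‖h x‖ ^ 2, integral_nonneg fun x => by positivity, ?_, ?_⟩
  · rw [ofReal_integral_eq_lintegral_ofReal hm.norm.integrable_sq (ae_of_all _ fun x => by
      positivity), layerMass]
    refine lintegral_congr fun x => ?_
    rw [add_zero, ENNReal.ofReal_pow (norm_nonneg _), ofReal_norm, hh]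
    simp only [enorm_mul, RCLike.enorm_conj]
    by_cases hx : x ∈ annulus d R
    · simp [annInd_of_mem hx, Set.indicator_of_mem hx, sq]
    · simp [annInd_of_notMem hx, Set.indicator_of_notMem hx]
  · rw [gramTerm, ← integral_complex_ofReal]
    refine integral_congr_ae (ae_of_all _ fun x => ?_)
    simp only [add_zero]
    rw [Complex.mul_conj, Complex.normSq_eq_norm_sq]

/-- The diagonal layers of a Bessel affine system have finite mass on every annulus. -/
theorem LatticeForm.tsum_diagonal_lt_top (hX : LatticeForm b id ψ X) (hb : IsExpanding b)
    (hψm : ∀ i, Measurable (ψ i)) (hψ : ∀ i, MemLp (ψ i) 2) (hXb : IsBessel X)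
    {R : ℝ} (hR : 0 < R) :
    ∑' m : ℤ × Fin r, layerMass b R (ψ m.2) (ψ m.2) m.1 0 < ∞ := by
  have hF : IsTest R ((annulus d R).indicator fun _ => (1 : ℂ)) :=
    isTest_indicator hR (measurableSet_annulus R) le_rfl
  obtain ⟨f, hf⟩ := hF.exists_fourier
  choose s h1 h2 using hX.hasSum_layer hX hψ hψ hF hF hf hf
  have e1 := (((regroup d r).hasSum_iff.mpr (hXb.summable_mul hXb f f).hasSum).prod_fiberwise
    (g := fun m : ℤ × Fin r => s m.1 m.2) fun m => h1 m.1 m.2).summable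
  obtain ⟨C, hC, -, hbd⟩ := enorm_gramTerm_le (b := b) hF hF
  set F := (annulus d R).indicator fun _ : EuclideanSpace ℝ (Fin d) => (1 : ℂ) with hFdef
  have e2 : Summable fun q : (ℤ × Fin r) × (Fin d → ℤ) => if q.2 = 0 then 0 else
      gramTerm b (ψ q.1.2) (ψ q.1.2) F F q.1.1 ((b ^ q.1.1) (intVec q.2)) := by
    refine summable_of_tsum_enorm_lt_top (lt_of_le_of_lt ?_ (ENNReal.mul_lt_top hC.lt_top
      (hb.tsum_offDiagonal_lt_top hψm hψm hψ hψ hR)))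
    rw [← ENNReal.tsum_mul_left]
    refine ENNReal.tsum_le_tsum fun q => ?_
    split_ifs
    · simp
    · exact hbd _ _ _ _
  -- The layer values are summable by the Bessel property and the off-diagonal parts by `e2`; so,
  -- therefore, is the diagonal.
  have e3 : ∀ m : ℤ × Fin r, gramTerm b (ψ m.2) (ψ m.2) F F m.1 0 = s m.1 m.2 -
      ∑' k : Fin d → ℤ, (if k = 0 then 0 else
        gramTerm b (ψ m.2) (ψ m.2) F F m.1 ((b ^ m.1) (intVec k))) := by
    intro m
    have h3 := (h2 m.1 m.2).summable.tsum_eq_add_tsum_ite 0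
    rw [(h2 m.1 m.2).tsum_eq, intVec_zero, map_zero] at h3
    rw [h3]
    simp only [id_eq, add_sub_cancel_right]
  choose t ht0 ht1 ht2 using fun m : ℤ × Fin r =>
    annulus_indicator_layer (b := b) hR (hψ m.2) m.1
  have e4 : Summable t := by
    have := e1.sub e2.prod
    simp only [← e3] at this
    rw [← Complex.summable_ofReal]
    exact this.congr fun m => ht2 m
  simp only [ht1]
  exact e4.tsum_ofReal_lt_top

/-- The diagonal is dominated by the diagonals of the two systems taken separately, where Bessel
applies; the off-diagonal part needs only square integrability. -/
theorem LatticeForm.finiteMass (hX : LatticeForm b id ψ X) (hY : LatticeForm b id φ Y)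
    (hb : IsExpanding b)
    (hψm : ∀ i, Measurable (ψ i)) (hφm : ∀ i, Measurable (φ i))
    (hψ : ∀ i, MemLp (ψ i) 2) (hφ : ∀ i, MemLp (φ i) 2) (hXb : IsBessel X) (hYb : IsBessel Y) :
    FiniteMass b id ψ φ := by
  intro R hR
  have h1 := hX.tsum_diagonal_lt_top hb hψm hψ hXb hR
  have h2 := hY.tsum_diagonal_lt_top hb hφm hφ hYb hR
  have h3 := hb.tsum_offDiagonal_lt_top hψm hφm hψ hφ hR
  have hdiag : ∑' m : ℤ × Fin r, layerMass b R (ψ m.2) (φ m.2) m.1 0 < ∞ := by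
    refine lt_of_le_of_lt ?_ (ENNReal.add_lt_top.mpr ⟨h1, h2⟩)
    rw [← ENNReal.tsum_add]
    refine ENNReal.tsum_le_tsum fun m => ?_
    refine (layerMass_le (hψm _) _ _).trans (le_of_eq ?_)
    simp only [layerMass, neg_zero, add_zero, sq]
  refine lt_of_le_of_lt ?_ (ENNReal.add_lt_top.mpr ⟨hdiag, h3⟩)
  have h4 : ∑' q : (ℤ × Fin r) × (Fin d → ℤ), (if q.2 = 0 then
      layerMass b R (ψ q.1.2) (φ q.1.2) q.1.1 0 else 0) =
      ∑' m : ℤ × Fin r, layerMass b R (ψ m.2) (φ m.2) m.1 0 := by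
    rw [ENNReal.tsum_prod' (f := fun q : (ℤ × Fin r) × (Fin d → ℤ) => if q.2 = 0 then
      layerMass b R (ψ q.1.2) (φ q.1.2) q.1.1 0 else 0)]
    exact tsum_congr fun m => tsum_ite_eq 0 _
  rw [← h4, ← ENNReal.tsum_add]
  refine ENNReal.tsum_le_tsum fun q => ?_
  by_cases hq : q.2 = 0
  · simp [hq, intVec_zero]
  · simp [hq]

/-- `b` maps the integer lattice into itself. -/
def PreservesLattice (b : EuclideanSpace ℝ (Fin d) ≃L[ℝ] EuclideanSpace ℝ (Fin d)) : Prop :=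
  ∀ k, ∃ k', b (intVec k) = intVec k'

theorem PreservesLattice.zpow (hbi : PreservesLattice b) {n : ℤ} (hn : 0 ≤ n) (k : Fin d → ℤ) :
    ∃ k', (b ^ n) (intVec k) = intVec k' := by
  lift n to ℕ using hn
  induction n with
  | zero => exact ⟨k, by rw [Nat.cast_zero, zpow_zero_apply]⟩
  | succ n ih =>
    obtain ⟨k', hk'⟩ := ih
    obtain ⟨l, hl⟩ := hbi k'
    refine ⟨l, ?_⟩
    rw [Nat.cast_succ, add_comm, zpow_add_apply, hk', zpow_one, hl]

/-- The lattices of a coarser system are contained in those of the affine system. -/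
theorem PreservesLattice.exists_index (hbi : PreservesLattice b) (hε : ∀ n, n ≤ ε n) :
    ∃ σ : ℤ → (Fin d → ℤ) → (Fin d → ℤ), (∀ n, Function.Injective (σ n)) ∧
      (∀ n k, (b ^ ε n) (intVec k) = (b ^ n) (intVec (σ n k))) ∧
      ∀ n k, (b ^ (ε n - n)) (intVec k) = intVec (σ n k) := by
  choose σ hσ using fun n k => hbi.zpow (sub_nonneg.mpr (hε n)) k
  refine ⟨σ, fun n k k' h => ?_, fun n k => ?_, hσ⟩
  · apply intVec_injective
    apply (b ^ (ε n - n)).injective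
    rw [hσ, hσ, h]
  · rw [← hσ, ← zpow_add_apply]
    congr 2
    omega

/-- The shifts of the coarser lattices occur among the affine ones, each at most once, so this is a
subsum. -/
theorem FiniteMass.of_le (hm : FiniteMass b id ψ φ) (hbi : PreservesLattice b)
    (hε : ∀ n, n ≤ ε n) : FiniteMass b ε ψ φ := by
  intro R hR
  obtain ⟨σ, hσi, hσ, -⟩ := hbi.exists_index hε
  refine lt_of_le_of_lt ?_ (hm R hR)
  simp only [hσ]
  refine ENNReal.tsum_comp_le_tsum_of_injective
    (f := fun q : (ℤ × Fin r) × (Fin d → ℤ) => (q.1, σ q.1.1 q.2)) ?_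
    (fun q : (ℤ × Fin r) × (Fin d → ℤ) =>
      layerMass b R (ψ q.1.2) (φ q.1.2) q.1.1 ((b ^ q.1.1) (intVec q.2)))
  rintro ⟨m, k⟩ ⟨m', k'⟩ h
  simp only [Prod.mk.injEq] at h
  obtain ⟨rfl, h⟩ := h
  rw [hσi m.1 h]

-- Since `b` preserves ℤᵈ, the lattice of scale `max n 0` is the integer part of the lattice of
-- scale `n`: passing to the quasi-affine system discards the non-integer shifts.
open Classical in
theorem tsum_gramTerm_max (hbi : PreservesLattice b) (F G : EuclideanSpace ℝ (Fin d) → ℂ) :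
    ∑' q : (ℤ × Fin r) × (Fin d → ℤ),
      gramTerm b (ψ q.1.2) (φ q.1.2) F G q.1.1 ((b ^ max q.1.1 0) (intVec q.2)) =
    ∑' q : (ℤ × Fin r) × (Fin d → ℤ), if (b ^ q.1.1) (intVec q.2) ∈ Set.range intVec then
      gramTerm b (ψ q.1.2) (φ q.1.2) F G q.1.1 ((b ^ q.1.1) (intVec q.2)) else 0 := by
  obtain ⟨σ, hσi, hσ, hσ'⟩ := hbi.exists_index (ε := fun n => max n 0) fun n => le_max_left n 0
  have hinj : Function.Injective
      (fun q : (ℤ × Fin r) × (Fin d → ℤ) => (q.1, σ q.1.1 q.2)) := by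
    rintro ⟨m, k⟩ ⟨m', k'⟩ h
    simp only [Prod.mk.injEq] at h
    obtain ⟨rfl, h⟩ := h
    rw [hσi m.1 h]
  refine Eq.trans ?_ (hinj.tsum_eq ?_)
  · refine tsum_congr fun q => ?_
    rw [if_pos, ← hσ]
    rw [← hσ]
    obtain ⟨k', hk'⟩ := hbi.zpow (le_max_right q.1.1 0) q.2
    exact ⟨k', hk'.symm⟩
  · rintro ⟨⟨n, i⟩, k⟩ hq
    rw [Function.mem_support] at hq
    have hk : (b ^ n) (intVec k) ∈ Set.range intVec := by
      by_contra h
      exact hq (if_neg h)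
    obtain ⟨l, hl⟩ := hk
    rcases le_or_gt 0 n with hn | hn
    · refine ⟨((n, i), k), ?_⟩
      simp only [Prod.mk.injEq, true_and]
      apply intVec_injective
      rw [← hσ', max_eq_left hn, sub_self, zpow_zero_apply]
    · refine ⟨((n, i), l), ?_⟩
      simp only [Prod.mk.injEq, true_and]
      apply intVec_injective
      rw [← hσ', max_eq_right hn.le, hl, zero_sub, zpow_neg_apply_zpow]

theorem card_natBox (d M : ℕ) : (natBox d M).card = M ^ d := by
  simp [natBox]

/-- The quasi-affine system of a Bessel affine system is Bessel. -/
theorem LatticeForm.isBessel_max [Nonempty (Fin d)] (hX : LatticeForm b id ψ X)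
    (hY : LatticeForm b (fun n => max n 0) ψ Y) (hb : IsExpanding b) (hbi : PreservesLattice b)
    (hψm : ∀ i, Measurable (ψ i)) (hψ : ∀ i, MemLp (ψ i) 2) (hXb : IsBessel X) :
    IsBessel Y := by
  classical
  obtain ⟨C, hC, hbound⟩ := id hXb
  have hm := hX.finiteMass hX hb hψm hψm hψ hψ hXb hXb
  have hm' : FiniteMass b (fun n => max n 0) ψ ψ := hm.of_le hbi fun n => le_max_left n 0
  refine isBessel_of_dense _ dense_testSet hC ?_
  rintro f ⟨R, F, hF, hf⟩ S
  have hsum : Summable fun j => ‖inner ℂ (Y j) f‖ ^ 2 := by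
    choose s h1 h2 using hY.hasSum_layer hY hψ hψ hF hF hf hf
    simp only [inner_mul_inner_self] at h1
    have e2 := ((hm'.summable_gramTerm hF hF).hasSum.prod_fiberwise
      (g := fun m : ℤ × Fin r => s m.1 m.2) fun m => h2 m.1 m.2).summable
    rw [← (regroup d r).summable_iff]
    refine (summable_prod_of_nonneg fun q => by simp only [Function.comp_apply]; positivity).mpr
      ⟨fun m => Complex.summable_ofReal.mp (h1 m.1 m.2).summable, ?_⟩
    rw [← Complex.summable_ofReal]
    refine e2.congr fun m => ?_
    rw [Complex.ofReal_tsum]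
    exact (h1 m.1 m.2).tsum_eq.symm
  refine (hsum.sum_le_tsum S fun j _ => by positivity).trans ?_
  have hsumc : Summable fun j => inner ℂ (Y j) f * inner ℂ f (Y j) := by
    simp only [inner_mul_inner_self]
    exact Complex.summable_ofReal.mpr hsum
  have h1 := (hY.hasSum_gramTerm hY hψ hψ hm' hF hF hf hf hsumc).tsum_eq
  simp only [inner_mul_inner_self, tsum_gramTerm_max hbi] at h1
  rw [← Complex.ofReal_tsum] at h1
  -- Averaging the affine forms at the translates of `f` by integer vectors keeps exactly the
  -- integer shifts, that is, the quasi-affine form.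
  have hlim := tendsto_average_series (hm.summable_gramTerm hF hF)
    fun q : (ℤ × Fin r) × (Fin d → ℤ) => (b ^ q.1.1) (intVec q.2)
  simp only [id_eq] at hlim
  rw [← h1] at hlim
  have hre := (Complex.continuous_re.tendsto _).comp hlim
  rw [Complex.ofReal_re] at hre
  refine le_of_tendsto hre ?_
  -- Each averaged quantity is the affine Bessel sum of a function with the norm of `f`, so the
  -- constant `C` is inherited.
  have hW : ∀ y : EuclideanSpace ℝ (Fin d), ∃ t : ℝ, t ≤ C * ‖f‖ ^ 2 ∧
      ∑' q : (ℤ × Fin r) × (Fin d → ℤ),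
        gramTerm b (ψ q.1.2) (ψ q.1.2) F F q.1.1 ((b ^ q.1.1) (intVec q.2)) *
          ex (inner ℝ y ((b ^ q.1.1) (intVec q.2))) = (t : ℂ) := by
    intro y
    obtain ⟨g, hg⟩ := (hF.modulate y).exists_fourier
    have hnorm : ‖g‖ = ‖f‖ := by
      rw [← Lp.norm_fourier_eq g, ← Lp.norm_fourier_eq f, Lp.norm_def, Lp.norm_def]
      congr 1
      refine eLpNorm_congr_norm_ae ?_
      filter_upwards [hf, hg] with x h3 h4
      rw [h3, h4, norm_mul, norm_ex, mul_one]
    refine ⟨∑' j, ‖inner ℂ (X j) g‖ ^ 2, hnorm ▸ (hbound g).2, ?_⟩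
    have h3 := (hX.hasSum_gramTerm hX hψ hψ hm (hF.modulate y) (hF.modulate y) hg hg
      (hXb.summable_mul hXb g g)).tsum_eq
    simp only [inner_mul_inner_self, gramTerm_modulate, id_eq] at h3
    rw [Complex.ofReal_tsum, h3]
  choose t ht1 ht2 using hW
  filter_upwards [eventually_gt_atTop 0] with M hM
  simp only [Function.comp_apply, ht2]
  have hMpos : (0 : ℝ) < (M : ℝ) ^ d := by positivity
  have e5 : ((M : ℂ) ^ d)⁻¹ * ∑ w ∈ natBox d M, (t (natVec w) : ℂ) =
      ((((M : ℝ) ^ d)⁻¹ * ∑ w ∈ natBox d M, t (natVec w) : ℝ) : ℂ) := by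
    push_cast; rfl
  rw [e5, Complex.ofReal_re, inv_mul_le_iff₀ hMpos]
  refine (Finset.sum_le_card_nsmul _ _ _ fun w _ => ht1 _).trans (le_of_eq ?_)
  rw [card_natBox, nsmul_eq_mul]
  push_cast; rfl

end OrthFrames

/-! ### Matrices acting on Euclidean space -/

namespace OrthFrames

variable {d r : ℕ}

/-- Invertible matrices acting on Euclidean space. -/
noncomputable def glHom (d : ℕ) :
    GL (Fin d) ℝ →* (EuclideanSpace ℝ (Fin d) ≃L[ℝ] EuclideanSpace ℝ (Fin d)) where
  toFun g := LinearEquiv.toContinuousLinearEquiv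
    { Matrix.toEuclideanLin (g : Matrix (Fin d) (Fin d) ℝ) with
      invFun := matVec (g⁻¹ : GL (Fin d) ℝ)
      left_inv := fun x => by
        change matVec (g⁻¹ : GL (Fin d) ℝ) (Matrix.toEuclideanLin (g : Matrix (Fin d) (Fin d) ℝ) x) = x
        rw [← matVec_eq, ← matVec_mul, ← Units.val_mul, inv_mul_cancel, Units.val_one, matVec_one]
      right_inv := fun x => by
        change Matrix.toEuclideanLin (g : Matrix (Fin d) (Fin d) ℝ) (matVec (g⁻¹ : GL (Fin d) ℝ) x) = x
        rw [← matVec_eq, ← matVec_mul, ← Units.val_mul, mul_inv_cancel, Units.val_one, matVec_one] }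
  map_one' := by
    refine ContinuousLinearEquiv.ext (funext fun x => ?_)
    change Matrix.toEuclideanLin ((1 : GL (Fin d) ℝ) : Matrix (Fin d) (Fin d) ℝ) x = x
    rw [← matVec_eq, Units.val_one, matVec_one]
  map_mul' g h := by
    refine ContinuousLinearEquiv.ext (funext fun x => ?_)
    change Matrix.toEuclideanLin ((g * h : GL (Fin d) ℝ) : Matrix (Fin d) (Fin d) ℝ) x =
      Matrix.toEuclideanLin (g : Matrix (Fin d) (Fin d) ℝ)
        (Matrix.toEuclideanLin (h : Matrix (Fin d) (Fin d) ℝ) x)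
    rw [← matVec_eq, ← matVec_eq, ← matVec_eq, Units.val_mul, matVec_mul]

theorem glHom_apply (g : GL (Fin d) ℝ) (x : EuclideanSpace ℝ (Fin d)) :
    glHom d g x = matVec (g : Matrix (Fin d) (Fin d) ℝ) x := by
  rw [matVec_eq]; rfl

theorem adet_glHom (g : GL (Fin d) ℝ) :
    adet (glHom d g) = |(g : Matrix (Fin d) (Fin d) ℝ).det| := by
  have : ((glHom d g : EuclideanSpace ℝ (Fin d) ≃L[ℝ] EuclideanSpace ℝ (Fin d)) :
      EuclideanSpace ℝ (Fin d) →ₗ[ℝ] EuclideanSpace ℝ (Fin d)) =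
      Matrix.toEuclideanLin (g : Matrix (Fin d) (Fin d) ℝ) := rfl
  rw [adet, this, Matrix.toEuclideanLin, Matrix.toLpLin_eq_toLin, LinearMap.det_toLin]

theorem inner_matVec_transpose (M : Matrix (Fin d) (Fin d) ℝ) (x y : EuclideanSpace ℝ (Fin d)) :
    inner ℝ (matVec M x) y = inner ℝ x (matVec M.transpose y) := by
  have h : ∀ u v : EuclideanSpace ℝ (Fin d), inner ℝ u v = u.ofLp ⬝ᵥ v.ofLp := by
    intro u v
    rw [PiLp.inner_apply]
    exact Finset.sum_congr rfl fun i _ => by simp [mul_comm]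
  rw [h, h]
  change M.mulVec x.ofLp ⬝ᵥ y.ofLp = x.ofLp ⬝ᵥ M.transpose.mulVec y.ofLp
  rw [Matrix.mulVec_transpose, dotProduct_comm, Matrix.dotProduct_mulVec, dotProduct_comm]

/-! ### Translations and dilations on the Fourier side -/

theorem memLp_ex_mul (y : EuclideanSpace ℝ (Fin d)) (f : L2 d) :
    MemLp (fun x => ex (-inner ℝ y x) * f x) 2 volume := by
  refine (Lp.memLp f).congr_norm ?_ (ae_of_all _ fun x => by rw [norm_mul, norm_ex, one_mul])
  exact (continuous_ex.comp (by fun_prop)).aestronglyMeasurable.mul (Lp.aestronglyMeasurable f)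

/-- Modulation as a continuous linear map of `L²(ℝᵈ)`. -/
noncomputable def modulationCLM (y : EuclideanSpace ℝ (Fin d)) : L2 d →L[ℂ] L2 d :=
  LinearMap.mkContinuous
    { toFun := fun f => (memLp_ex_mul y f).toLp _
      map_add' := fun f g => by
        apply Lp.ext
        filter_upwards [(memLp_ex_mul y (f + g)).coeFn_toLp,
          (memLp_ex_mul y f).coeFn_toLp, (memLp_ex_mul y g).coeFn_toLp,
          Lp.coeFn_add ((memLp_ex_mul y f).toLp _) ((memLp_ex_mul y g).toLp _),
          Lp.coeFn_add f g] with x h1 h2 h3 h4 h5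
        rw [h1, h4, Pi.add_apply, h2, h3, h5, Pi.add_apply, mul_add]
      map_smul' := fun c f => by
        apply Lp.ext
        filter_upwards [(memLp_ex_mul y (c • f)).coeFn_toLp, (memLp_ex_mul y f).coeFn_toLp,
          Lp.coeFn_smul c ((memLp_ex_mul y f).toLp _), Lp.coeFn_smul c f] with x h1 h2 h4 h5
        rw [h1, RingHom.id_apply, h4, Pi.smul_apply, h2, h5, Pi.smul_apply, smul_eq_mul,
          smul_eq_mul]
        ring } 1
    (fun f => by
      simp only [LinearMap.coe_mk, AddHom.coe_mk, Lp.norm_toLp, one_mul]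
      rw [Lp.norm_def]
      refine le_of_eq ?_
      congr 1
      exact eLpNorm_congr_norm_ae (ae_of_all _ fun x => by rw [norm_mul, norm_ex, one_mul]))

theorem modulationCLM_coeFn (y : EuclideanSpace ℝ (Fin d)) (f : L2 d) :
    modulationCLM y f =ᵐ[volume] fun x => ex (-inner ℝ y x) * f x :=
  (memLp_ex_mul y f).coeFn_toLp

theorem fourier_schwartz_eq (s : SchwartzMap (EuclideanSpace ℝ (Fin d)) ℂ)
    (w : EuclideanSpace ℝ (Fin d)) : (𝓕 s : SchwartzMap (EuclideanSpace ℝ (Fin d)) ℂ) w =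
      ∫ v, ex (-inner ℝ v w) * s v := by
  rw [SchwartzMap.fourier_coe, Real.fourier_eq']
  refine integral_congr_ae (ae_of_all _ fun v => ?_)
  simp only [ex, smul_eq_mul]
  congr 2
  push_cast
  ring

/-- Two continuous maps on `L²` that agree on Schwartz functions are equal. -/
theorem eq_of_eq_on_schwartz {S T : L2 d → L2 d} (hS : Continuous S) (hT : Continuous T)
    (h : ∀ s : SchwartzMap (EuclideanSpace ℝ (Fin d)) ℂ, S (s.toLp 2) = T (s.toLp 2)) (f : L2 d) :
    S f = T f :=
  congrFun (DenseRange.equalizer (SchwartzMap.denseRange_toLpCLM (F := ℂ) (p := 2)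
    ENNReal.ofNat_ne_top) hS hT (funext fun s => h s)) f

theorem continuous_fourier_L2 : Continuous fun f : L2 d => (𝓕 f : L2 d) :=
  (Lp.fourierTransformₗᵢ (EuclideanSpace ℝ (Fin d)) ℂ).continuous

theorem translation_coeFn (y : EuclideanSpace ℝ (Fin d)) (f : L2 d) :
    translation y f =ᵐ[volume] fun x => f (x - y) :=
  Lp.coeFn_compMeasurePreserving f (measurePreserving_sub_right volume y)

theorem fourier_translation (y : EuclideanSpace ℝ (Fin d)) (f : L2 d) :
    (𝓕 (translation y f) : L2 d) = modulationCLM y (𝓕 f) := by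
  refine eq_of_eq_on_schwartz (S := fun f => 𝓕 (translation y f))
    (T := fun f => modulationCLM y (𝓕 f)) ?_ ?_ (fun s => ?_) f
  · exact continuous_fourier_L2.comp
      (Lp.isometry_compMeasurePreserving (measurePreserving_sub_right volume y)).continuous
  · exact (modulationCLM y).continuous.comp continuous_fourier_L2
  · have h1 : translation y (s.toLp 2) = (s.compSubConstCLM ℂ y).toLp 2 := by
      apply Lp.ext
      filter_upwards [translation_coeFn y (s.toLp 2), (s.compSubConstCLM ℂ y).coeFn_toLp 2 volume,
        (measurePreserving_sub_right volume y).quasiMeasurePreserving.ae (s.coeFn_toLp 2 volume)]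
        with x h1 h2 h3
      rw [h1, h2, h3, SchwartzMap.compSubConstCLM_apply]
    simp only
    rw [h1, SchwartzMap.toLp_fourier_eq, SchwartzMap.toLp_fourier_eq]
    apply Lp.ext
    filter_upwards [(𝓕 (s.compSubConstCLM ℂ y)).coeFn_toLp 2 volume,
      modulationCLM_coeFn y ((𝓕 s).toLp 2), (𝓕 s).coeFn_toLp 2 volume] with w h2 h3 h4
    rw [h2, h3, h4, fourier_schwartz_eq, fourier_schwartz_eq, ← integral_const_mul,
      ← integral_add_right_eq_self _ y]
    refine integral_congr_ae (ae_of_all _ fun v => ?_)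
    simp only [SchwartzMap.compSubConstCLM_apply, add_sub_cancel_right, inner_add_left, neg_add,
      ex_add]
    ring

/-- On Schwartz functions this is the substitution `v ↦ A v` in the Fourier integral; density does
the rest. `B` is kept separate so that it can be instantiated by a power of the transpose. -/
theorem fourier_substCLM {A B : GL (Fin d) ℝ}
    (hAB : (B : Matrix (Fin d) (Fin d) ℝ) = (A : Matrix (Fin d) (Fin d) ℝ).transpose) (f : L2 d) :
    (𝓕 (substCLM A f) : L2 d) =
      ((|(A : Matrix (Fin d) (Fin d) ℝ).det|⁻¹ : ℝ) : ℂ) • substCLM B⁻¹ (𝓕 f) := by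
  refine eq_of_eq_on_schwartz (S := fun f => 𝓕 (substCLM A f))
    (T := fun f => ((|(A : Matrix (Fin d) (Fin d) ℝ).det|⁻¹ : ℝ) : ℂ) • substCLM B⁻¹ (𝓕 f))
    ?_ ?_ (fun s => ?_) f
  · exact continuous_fourier_L2.comp (substCLM A).continuous
  · exact ((substCLM B⁻¹).continuous.comp continuous_fourier_L2).const_smul
      ((|(A : Matrix (Fin d) (Fin d) ℝ).det|⁻¹ : ℝ) : ℂ)
  · have h1 : substCLM A (s.toLp 2) =
        (SchwartzMap.compCLMOfContinuousLinearEquiv ℂ (glHom d A) s).toLp 2 := by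
      apply Lp.ext
      filter_upwards [substCLM_coeFn A (s.toLp 2),
        (SchwartzMap.compCLMOfContinuousLinearEquiv ℂ (glHom d A) s).coeFn_toLp 2 volume,
        (quasiMeasurePreserving_matVec A).ae (s.coeFn_toLp 2 volume)] with x h1 h2 h3
      rw [h1, h2, h3, SchwartzMap.compCLMOfContinuousLinearEquiv_apply, Function.comp_apply,
        glHom_apply]
    simp only
    rw [h1, SchwartzMap.toLp_fourier_eq, SchwartzMap.toLp_fourier_eq]
    apply Lp.ext
    filter_upwards [(𝓕 (SchwartzMap.compCLMOfContinuousLinearEquiv ℂ (glHom d A) s)).coeFn_toLp 2 volume,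
      Lp.coeFn_smul ((|(A : Matrix (Fin d) (Fin d) ℝ).det|⁻¹ : ℝ) : ℂ)
        (substCLM B⁻¹ ((𝓕 s).toLp 2)),
      substCLM_coeFn B⁻¹ ((𝓕 s).toLp 2),
      (quasiMeasurePreserving_matVec B⁻¹).ae ((𝓕 s).coeFn_toLp 2 volume)] with w h2 h3 h4 h5
    rw [h2, h3, Pi.smul_apply, h4, h5, fourier_schwartz_eq, fourier_schwartz_eq]
    have h6 := integral_comp_equiv (glHom d A) fun v =>
      ex (-inner ℝ v (matVec ((B⁻¹ : GL (Fin d) ℝ) : Matrix (Fin d) (Fin d) ℝ) w)) * s v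
    rw [adet_glHom] at h6
    rw [Complex.coe_smul, ← h6]
    refine integral_congr_ae (ae_of_all _ fun v => ?_)
    simp only [SchwartzMap.compCLMOfContinuousLinearEquiv_apply, Function.comp_apply]
    rw [glHom_apply, inner_matVec_transpose, ← hAB, ← matVec_mul, ← Units.val_mul, mul_inv_cancel,
      Units.val_one, matVec_one]

theorem scalar_apply (c : ℂˣ) (f : L2 d) : scalar c f = (c : ℂ) • f := rfl

theorem subst_apply (A : GL (Fin d) ℝ) (f : L2 d) : subst A f = substCLM A f := rfl

theorem scalar_zpow (c : ℂˣ) (n : ℤ) : scalar (d := d) c ^ n = scalar (c ^ n) :=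
  (map_zpow (ContinuousLinearEquiv.smulLeft : ℂˣ →* (L2 d ≃L[ℂ] L2 d)) c n).symm

theorem subst_zpow (A : GL (Fin d) ℝ) (n : ℤ) : subst A ^ n = subst (A ^ n) := by
  -- Substitution reverses products; composing with inversion gives a homomorphism.
  let φ : GL (Fin d) ℝ →* (L2 d ≃L[ℂ] L2 d) :=
    { toFun := fun g => subst g⁻¹
      map_one' := by
        refine ContinuousLinearEquiv.ext (funext fun f => ?_)
        rw [inv_one, subst_apply, substCLM_one]
        rfl
      map_mul' := fun g h => by
        refine ContinuousLinearEquiv.ext (funext fun f => ?_)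
        change subst (g * h)⁻¹ f = subst g⁻¹ (subst h⁻¹ f)
        rw [subst_apply, subst_apply, subst_apply, substCLM_comp, mul_inv_rev] }
  have h := map_zpow φ A⁻¹ n
  change subst (A⁻¹ ^ n)⁻¹ = subst (A⁻¹)⁻¹ ^ n at h
  rw [inv_inv, inv_zpow, inv_inv] at h
  exact h.symm

theorem scalar_mul_subst_zpow (c : ℂˣ) (A : GL (Fin d) ℝ) (n : ℤ) :
    (scalar c * subst A) ^ n = scalar (c ^ n) * subst (A ^ n) := by
  have hc : Commute (scalar (d := d) c) (subst A) := by
    refine ContinuousLinearEquiv.ext (funext fun f => ?_)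
    change scalar c (subst A f) = subst A (scalar c f)
    rw [scalar_apply, scalar_apply, map_smul]
  rw [hc.mul_zpow, scalar_zpow, subst_zpow]

theorem abs_det_zpow (A : GL (Fin d) ℝ) (n : ℤ) :
    |((A ^ n : GL (Fin d) ℝ) : Matrix (Fin d) (Fin d) ℝ).det| =
      |(A : Matrix (Fin d) (Fin d) ℝ).det| ^ n := by
  have h := congrArg Units.val (map_zpow (Matrix.GeneralLinearGroup.det (n := Fin d) (R := ℝ)) A n)
  rw [Units.val_zpow_eq_zpow_val] at h
  rw [← abs_zpow]
  exact congrArg abs h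

/-- The transpose of an invertible matrix. -/
noncomputable def glTranspose (A : GL (Fin d) ℝ) : GL (Fin d) ℝ where
  val := (A : Matrix (Fin d) (Fin d) ℝ).transpose
  inv := ((A⁻¹ : GL (Fin d) ℝ) : Matrix (Fin d) (Fin d) ℝ).transpose
  val_inv := by rw [← Matrix.transpose_mul, ← Units.val_mul, inv_mul_cancel, Units.val_one,
    Matrix.transpose_one]
  inv_val := by rw [← Matrix.transpose_mul, ← Units.val_mul, mul_inv_cancel, Units.val_one,
    Matrix.transpose_one]

theorem glTranspose_val (A : GL (Fin d) ℝ) : (glTranspose A : Matrix (Fin d) (Fin d) ℝ) =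
    (A : Matrix (Fin d) (Fin d) ℝ).transpose := rfl

theorem glTranspose_zpow_val (A : GL (Fin d) ℝ) (n : ℤ) :
    ((glTranspose A ^ n : GL (Fin d) ℝ) : Matrix (Fin d) (Fin d) ℝ) =
      ((A ^ n : GL (Fin d) ℝ) : Matrix (Fin d) (Fin d) ℝ).transpose := by
  rw [Matrix.coe_units_zpow, Matrix.coe_units_zpow, Matrix.transpose_zpow, glTranspose_val]

/-- The Fourier transform of a power of a scaled substitution. -/
theorem fourier_scalar_mul_subst_zpow (c : ℂˣ) (A : GL (Fin d) ℝ) (n : ℤ) (f : L2 d) :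
    (𝓕 (((scalar c * subst A) ^ n : L2 d ≃L[ℂ] L2 d) f) : L2 d) =
      ((c : ℂ) ^ n * ((|(A : Matrix (Fin d) (Fin d) ℝ).det| ^ n : ℝ) : ℂ)⁻¹) •
        substCLM (glTranspose A ^ n)⁻¹ (𝓕 f) := by
  have h : (((scalar c * subst A) ^ n : L2 d ≃L[ℂ] L2 d) f : L2 d) = ((c ^ n : ℂˣ) : ℂ) • substCLM (A ^ n) f := by
    rw [scalar_mul_subst_zpow]; rfl
  rw [h, FourierTransform.fourier_smul, fourier_substCLM (glTranspose_zpow_val A n), smul_smul,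
    Units.val_zpow_eq_zpow_val, abs_det_zpow, Complex.ofReal_inv]

end OrthFrames

/-! ### Expansive matrices are expanding -/

namespace OrthFrames

open Filter Topology

/-- The powers of an element of a complex Banach algebra with spectrum in the open unit disc tend
to zero. -/
theorem tendsto_norm_pow_of_spectrum {𝔸 : Type*} [NormedRing 𝔸] [NormedAlgebra ℂ 𝔸]
    [CompleteSpace 𝔸] [Nontrivial 𝔸] (a : 𝔸) (h : ∀ z ∈ spectrum ℂ a, ‖z‖ < 1) :
    Tendsto (fun n : ℕ => ‖a ^ n‖) atTop (𝓝 0) := by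
  have h1 : spectralRadius ℂ a < (1 : NNReal) :=
    spectrum.spectralRadius_lt_of_forall_lt a fun z hz => by
      have := h z hz
      rw [← NNReal.coe_lt_coe]; simpa using this
  obtain ⟨t, ht1, ht2⟩ := ENNReal.lt_iff_exists_nnreal_btwn.mp h1
  have ht3 : t < 1 := by exact_mod_cast ht2
  -- Gelfand's formula: eventually `‖a ^ n‖ ≤ t ^ n` for a `t` between the spectral radius and 1.
  have h2 := (spectrum.pow_nnnorm_pow_one_div_tendsto_nhds_spectralRadius a).eventually_lt_const ht1
  refine squeeze_zero' (Eventually.of_forall fun n => norm_nonneg _) ?_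
    (tendsto_pow_atTop_nhds_zero_of_lt_one t.coe_nonneg (by exact_mod_cast ht3))
  filter_upwards [h2, eventually_gt_atTop 0] with n hn hpos
  have hn' : (0 : ℝ) < n := by exact_mod_cast hpos
  have h3 : (‖a ^ n‖₊ : ℝ≥0∞) ≤ (t : ℝ≥0∞) ^ n := by
    calc (‖a ^ n‖₊ : ℝ≥0∞) = ((‖a ^ n‖₊ : ℝ≥0∞) ^ (1 / n : ℝ)) ^ (n : ℝ) := by
          rw [← ENNReal.rpow_mul, one_div, inv_mul_cancel₀ hn'.ne', ENNReal.rpow_one]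
      _ ≤ (t : ℝ≥0∞) ^ (n : ℝ) := ENNReal.rpow_le_rpow hn.le hn'.le
      _ = (t : ℝ≥0∞) ^ n := ENNReal.rpow_natCast _ _
  have h4 : ‖a ^ n‖₊ ≤ t ^ n := by exact_mod_cast h3
  exact_mod_cast h4

attribute [local instance] Matrix.linftyOpNormedRing Matrix.linftyOpNormedAlgebra in
theorem tendsto_matrix_pow_of_spectrum {ι : Type*} [Fintype ι] [DecidableEq ι] [Nonempty ι]
    (C : Matrix ι ι ℂ) (h : ∀ z ∈ spectrum ℂ C, ‖z‖ < 1) (i j : ι) :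
    Tendsto (fun n : ℕ => ‖(C ^ n) i j‖) atTop (𝓝 0) := by
  have : CompleteSpace (Matrix ι ι ℂ) := FiniteDimensional.complete ℂ _
  refine squeeze_zero (fun n => norm_nonneg _) (fun n => ?_) (tendsto_norm_pow_of_spectrum C h)
  have h1 : ‖(C ^ n) i j‖₊ ≤ ‖C ^ n‖₊ := by
    rw [Matrix.linfty_opNNNorm_def]
    refine le_trans ?_ (Finset.le_sup (f := fun i => ∑ j, ‖(C ^ n) i j‖₊) (Finset.mem_univ i))
    exact Finset.single_le_sum (f := fun j => ‖(C ^ n) i j‖₊) (fun _ _ => zero_le)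
      (Finset.mem_univ j)
  exact_mod_cast h1

variable {d : ℕ}

theorem norm_matVec_le (M : Matrix (Fin d) (Fin d) ℝ) (x : EuclideanSpace ℝ (Fin d)) :
    ‖matVec M x‖ ≤ (∑ i, ∑ j, |M i j|) * ‖x‖ := by
  have h1 : ‖matVec M x‖ ≤ ∑ i, |matVec M x i| := by
    have h2 : matVec M x = ∑ i, EuclideanSpace.single i (matVec M x i) := by
      ext j
      simp [Finset.sum_apply]
    conv_lhs => rw [h2]
    refine (norm_sum_le _ _).trans (le_of_eq ?_)
    simp
  refine h1.trans ?_
  rw [Finset.sum_mul]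
  refine Finset.sum_le_sum fun i _ => ?_
  change |∑ j, M i j * x j| ≤ _
  refine (Finset.abs_sum_le_sum_abs _ _).trans ?_
  rw [Finset.sum_mul]
  refine Finset.sum_le_sum fun j _ => ?_
  rw [abs_mul]
  gcongr
  exact PiLp.norm_apply_le x j

theorem IsExpansive.norm_lt_one {A : GL (Fin d) ℝ}
    (hA : IsExpansive (A : Matrix (Fin d) (Fin d) ℝ)) :
    ∀ z ∈ spectrum ℂ (((A⁻¹ : GL (Fin d) ℝ) : Matrix (Fin d) (Fin d) ℝ).map
      (fun t : ℝ => (t : ℂ))), ‖z‖ < 1 := by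
  intro z hz
  let φ : Matrix (Fin d) (Fin d) ℝ →* Matrix (Fin d) (Fin d) ℂ :=
    (RingHom.mapMatrix Complex.ofRealHom : Matrix (Fin d) (Fin d) ℝ →+* Matrix (Fin d) (Fin d) ℂ)
  set U : (Matrix (Fin d) (Fin d) ℂ)ˣ := Units.map φ A with hU
  have hUinv : ((U⁻¹ : (Matrix (Fin d) (Fin d) ℂ)ˣ) : Matrix (Fin d) (Fin d) ℂ) =
      ((A⁻¹ : GL (Fin d) ℝ) : Matrix (Fin d) (Fin d) ℝ).map (fun t : ℝ => (t : ℂ)) := rfl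
  rw [← hUinv] at hz
  have hz0 : z ≠ 0 := by
    rintro rfl
    exact spectrum.zero_notMem_iff ℂ |>.mpr (Units.isUnit U⁻¹) hz
  have h1 := (spectrum.inv_mem_iff (r := Units.mk0 z hz0) (a := U⁻¹)).mp hz
  rw [inv_inv, Units.val_inv_eq_inv_val, Units.val_mk0] at h1
  have h2 : (z⁻¹ : ℂ) ∈ spectrum ℂ (Matrix.toLin'
      ((A : Matrix (Fin d) (Fin d) ℝ).map (fun t : ℝ => (t : ℂ)))) := by
    rw [Matrix.spectrum_toLin']
    exact h1
  have h3 := hA _ (Module.End.hasEigenvalue_iff_mem_spectrum.mpr h2)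
  rw [norm_inv] at h3
  exact (one_lt_inv₀ (norm_pos_iff.mpr hz0)).mp h3

/-- The inverse has spectrum in the open unit disc, so the entries of its powers tend to 0; the sum
of their absolute values bounds the operator norm and ignores transposition. -/
theorem IsExpansive.isExpanding [Nonempty (Fin d)] {A : GL (Fin d) ℝ}
    (hA : IsExpansive (A : Matrix (Fin d) (Fin d) ℝ)) :
    IsExpanding (glHom d (glTranspose A)) := by
  set C := ((A⁻¹ : GL (Fin d) ℝ) : Matrix (Fin d) (Fin d) ℝ).map (fun t : ℝ => (t : ℂ)) with hC
  have h1 := tendsto_matrix_pow_of_spectrum C hA.norm_lt_one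
  have h2 : ∀ (n : ℕ) i j, ‖(C ^ n) i j‖ =
      |((A⁻¹ ^ n : GL (Fin d) ℝ) : Matrix (Fin d) (Fin d) ℝ) i j| := by
    intro n i j
    have h : C ^ n = (RingHom.mapMatrix Complex.ofRealHom)
        ((A⁻¹ ^ n : GL (Fin d) ℝ) : Matrix (Fin d) (Fin d) ℝ) := by
      rw [Units.val_pow_eq_pow_val, map_pow]; rfl
    rw [h, RingHom.mapMatrix_apply, Matrix.map_apply, Complex.ofRealHom_eq_coe, Complex.norm_real,
      Real.norm_eq_abs]
  have h3 : Tendsto (fun n : ℕ => ∑ i, ∑ j,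
      |((A⁻¹ ^ n : GL (Fin d) ℝ) : Matrix (Fin d) (Fin d) ℝ) j i|) atTop (𝓝 0) := by
    have := tendsto_finsetSum Finset.univ fun (i : Fin d) _ =>
      tendsto_finsetSum Finset.univ fun (j : Fin d) _ => h1 j i
    simpa [h2] using this
  intro δ hδ
  obtain ⟨N, hN⟩ := eventually_atTop.mp (h3.eventually_le_const hδ)
  refine ⟨N, fun n hn x => ?_⟩
  rw [← map_zpow, glHom_apply, glTranspose_zpow_val]
  refine (norm_matVec_le _ _).trans ?_
  gcongr
  rw [zpow_neg, zpow_natCast, ← inv_pow]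
  exact hN n hn

end OrthFrames

namespace OrthFrames

open Filter Topology

variable {d r : ℕ}

/-! ### The affine and quasi-affine systems -/

theorem IsIntegerValued.preservesLattice {A : GL (Fin d) ℝ}
    (hA : IsIntegerValued (A : Matrix (Fin d) (Fin d) ℝ)) :
    PreservesLattice (glHom d (glTranspose A)) := by
  choose M hM using hA
  intro k
  refine ⟨fun i => ∑ j, M j i * k j, ?_⟩
  rw [glHom_apply, glTranspose_val]
  ext i
  change ∑ j, (A : Matrix (Fin d) (Fin d) ℝ) j i * (k j : ℝ) = ((∑ j, M j i * k j : ℤ) : ℝ)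
  push_cast
  exact Finset.sum_congr rfl fun j _ => by rw [hM]

theorem glTranspose_zpow_inv_apply (A : GL (Fin d) ℝ) (n : ℤ) (x : EuclideanSpace ℝ (Fin d)) :
    matVec (((glTranspose A ^ n)⁻¹ : GL (Fin d) ℝ) : Matrix (Fin d) (Fin d) ℝ) x =
      ((glHom d (glTranspose A)) ^ (-n)) x := by
  rw [← map_zpow, glHom_apply, zpow_neg]

theorem adet_glHom_zpow (A : GL (Fin d) ℝ) (n : ℤ) :
    adet ((glHom d (glTranspose A)) ^ n) = |(A : Matrix (Fin d) (Fin d) ℝ).det| ^ n := by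
  rw [← map_zpow, adet_glHom, glTranspose_zpow_val, Matrix.det_transpose, abs_det_zpow]

theorem sqrt_zpow_mul_inv {D : ℝ} (hD : 0 < D) (n : ℤ) :
    Real.sqrt D ^ n * (D ^ n)⁻¹ = Real.sqrt (D ^ (-n)) := by
  have hs : 0 < Real.sqrt D := Real.sqrt_pos.mpr hD
  have h1 : D = Real.sqrt D ^ 2 := (Real.sq_sqrt hD.le).symm
  generalize Real.sqrt D = s at hs h1
  subst h1
  have h2 : (s ^ 2) ^ (-n) = (s ^ (-n)) ^ 2 := by
    rw [← zpow_natCast, ← zpow_natCast, ← zpow_mul, ← zpow_mul, mul_comm]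
  have h3 : (s ^ 2) ^ n = s ^ n * s ^ n := by rw [sq, mul_zpow]
  have h4 : s ^ n ≠ 0 := (zpow_pos hs n).ne'
  rw [h2, Real.sqrt_sq (by positivity), zpow_neg, h3]
  field_simp

theorem affine_layer_fourier (A : GL (Fin d) ℝ) (n : ℤ) (z : Fin d → ℤ) (f : L2 d) :
    (𝓕 ((dilation A ^ n) (translation (intVec z) f)) : L2 d) =ᵐ[volume] fun x =>
      (Real.sqrt (adet ((glHom d (glTranspose A)) ^ (-n))) : ℂ) *
        ex (-inner ℝ (intVec z) (((glHom d (glTranspose A)) ^ (-n)) x)) *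
        (𝓕 f : L2 d) (((glHom d (glTranspose A)) ^ (-n)) x) := by
  have hD : 0 < |(A : Matrix (Fin d) (Fin d) ℝ).det| :=
    lt_of_le_of_ne (abs_nonneg _) (abs_det_ne_zero A).symm
  rw [dilation, fourier_scalar_mul_subst_zpow, fourier_translation, Units.val_mk0,
    adet_glHom_zpow, ← sqrt_zpow_mul_inv hD]
  filter_upwards [Lp.coeFn_smul
      ((((Real.sqrt |(A : Matrix (Fin d) (Fin d) ℝ).det| : ℝ) : ℂ)) ^ n *
        ((|(A : Matrix (Fin d) (Fin d) ℝ).det| ^ n : ℝ) : ℂ)⁻¹)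
      (substCLM (glTranspose A ^ n)⁻¹ (modulationCLM (intVec z) (𝓕 f))),
    substCLM_coeFn (glTranspose A ^ n)⁻¹ (modulationCLM (intVec z) (𝓕 f)),
    (quasiMeasurePreserving_matVec (glTranspose A ^ n)⁻¹).ae
      (modulationCLM_coeFn (intVec z) (𝓕 f))] with x h1 h2 h3
  rw [h1, Pi.smul_apply, h2, h3, glTranspose_zpow_inv_apply, smul_eq_mul, ← mul_assoc]
  push_cast
  rfl

/-- The factor `|det A| ^ n` cancels the Jacobian and the translation comes last, so the modulations
run along ℤᵈ itself: lattice scale 0. -/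
theorem renorm_layer_fourier (A : GL (Fin d) ℝ) (n : ℤ) (z : Fin d → ℤ) (f : L2 d) :
    (𝓕 (translation (intVec z) ((renormDilation A ^ n) f)) : L2 d) =ᵐ[volume] fun x =>
        ex (-inner ℝ (intVec z) x) *
        (𝓕 f : L2 d) (((glHom d (glTranspose A)) ^ (-n)) x) := by
  rw [fourier_translation, renormDilation, fourier_scalar_mul_subst_zpow, Units.val_mk0]
  have hc : ((|(A : Matrix (Fin d) (Fin d) ℝ).det| : ℝ) : ℂ) ^ n *
      ((|(A : Matrix (Fin d) (Fin d) ℝ).det| ^ n : ℝ) : ℂ)⁻¹ = 1 := by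
    rw [Complex.ofReal_zpow]
    exact mul_inv_cancel₀ (zpow_ne_zero _ (by exact_mod_cast abs_det_ne_zero A))
  rw [hc, one_smul]
  filter_upwards [modulationCLM_coeFn (intVec z) (substCLM (glTranspose A ^ n)⁻¹ (𝓕 f)),
    substCLM_coeFn (glTranspose A ^ n)⁻¹ (𝓕 f)] with x h1 h2
  rw [h1, h2, glTranspose_zpow_inv_apply]

theorem latticeForm_affineSystem (A : GL (Fin d) ℝ) (Ψ : Fin r → L2 d) :
    LatticeForm (glHom d (glTranspose A)) id (fun i => (𝓕 (Ψ i) : L2 d)) (affineSystem A Ψ) :=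
  fun n z i => affine_layer_fourier A n z (Ψ i)

theorem latticeForm_quasiAffineSystem (A : GL (Fin d) ℝ) (Ψ : Fin r → L2 d) :
    LatticeForm (glHom d (glTranspose A)) (fun n => max n 0) (fun i => (𝓕 (Ψ i) : L2 d))
      (quasiAffineSystem A Ψ) := by
  intro n z i
  rcases le_or_gt 0 n with hn | hn
  · have h : quasiAffineSystem A Ψ (n, z, i) =
        (dilation A ^ n) (translation (intVec z) (Ψ i)) := if_pos hn
    have e : max n 0 = n := max_eq_left hn
    simp only [h, e]
    exact affine_layer_fourier A n z (Ψ i)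
  · have h : quasiAffineSystem A Ψ (n, z, i) =
        translation (intVec z) ((renormDilation A ^ n) (Ψ i)) := if_neg (not_le.mpr hn)
    have e : max n 0 = 0 := max_eq_right hn.le
    simp only [h, e]
    filter_upwards [renorm_layer_fourier A n z (Ψ i)] with x hx
    rw [hx, adet_glHom_zpow, neg_zero, zpow_zero, Real.sqrt_one, Complex.ofReal_one, one_mul,
      zpow_zero_apply]

/-! ### The equations -/

section Equations

variable {b : EuclideanSpace ℝ (Fin d) ≃L[ℝ] EuclideanSpace ℝ (Fin d)}
  {ψ φ : Fin r → EuclideanSpace ℝ (Fin d) → ℂ}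

theorem hasSum_dualTerm_zero_iff (ε : ℤ → ℤ) (x : EuclideanSpace ℝ (Fin d)) :
    HasSum (fun m => dualTerm b ε ψ φ 0 m x) 0 ↔
      HasSum (fun m : ℤ × Fin r => conj (ψ m.2 ((b ^ m.1) x)) * φ m.2 ((b ^ m.1) x)) 0 := by
  rw [← ((Equiv.neg ℤ).prodCongr (Equiv.refl (Fin r))).hasSum_iff]
  refine iff_of_eq (congrArg (fun f => HasSum f 0) (funext fun m => ?_))
  have h : ∃ k : Fin d → ℤ, (b ^ ε (-m.1)) (intVec k) = 0 := ⟨0, by rw [intVec_zero, map_zero]⟩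
  change dualTerm b ε ψ φ 0 (-m.1, m.2) x = _
  rw [dualTerm, if_pos h, add_zero]
  simp only [neg_neg]

/-- If `n > m`, then `q` would be `b ^ (n - m)` of a lattice point, hence in the image of `b`. -/
theorem exists_zpow_intVec_iff (hbi : PreservesLattice b) {q : Fin d → ℤ}
    (hq : ¬ ∃ z, intVec q = b (intVec z)) (m n : ℤ) :
    (∃ k, (b ^ n) (intVec k) = (b ^ m) (intVec q)) ↔ n ≤ m := by
  constructor
  · rintro ⟨k, hk⟩
    by_contra! h
    obtain ⟨z, hz⟩ := hbi.zpow (n := n - m - 1) (by omega) k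
    refine hq ⟨z, ?_⟩
    rw [← hz]
    have h1 : n = m + (1 + (n - m - 1)) := by omega
    rw [h1, zpow_add_apply, zpow_add_apply, zpow_one] at hk
    exact ((b ^ m).injective hk).symm
  · intro h
    obtain ⟨k, hk⟩ := hbi.zpow (sub_nonneg.mpr h) q
    refine ⟨k, ?_⟩
    rw [← hk, ← zpow_add_apply]
    congr 2
    omega

/-- Only scales `n ≤ m` reach the shift; with `j = m - n` the series becomes the first equation at
the point `(b ^ (-m)) x`. -/
theorem hasSum_dualTerm_iff (hbi : PreservesLattice b) {q : Fin d → ℤ}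
    (hq : ¬ ∃ z, intVec q = b (intVec z)) (m : ℤ) (x : EuclideanSpace ℝ (Fin d)) :
    HasSum (fun j => dualTerm b id ψ φ ((b ^ m) (intVec q)) j x) 0 ↔
      HasSum (fun j : ℕ × Fin r => conj (ψ j.2 ((b ^ (j.1 : ℤ)) ((b ^ (-m)) x))) *
        φ j.2 ((b ^ (j.1 : ℤ)) ((b ^ (-m)) x + intVec q))) 0 := by
  have hinj : Function.Injective fun j : ℕ × Fin r => (m - (j.1 : ℤ), j.2) := by
    rintro ⟨j, i⟩ ⟨j', i'⟩ h
    simp only [Prod.mk.injEq] at h ⊢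
    exact ⟨by omega, h.2⟩
  rw [← hinj.hasSum_iff]
  · refine iff_of_eq (congrArg (fun f => HasSum f 0) (funext fun j => ?_))
    simp only [Function.comp_apply]
    have h1 : ∃ k, (b ^ id (m - (j.1 : ℤ))) (intVec k) = (b ^ m) (intVec q) :=
      (exists_zpow_intVec_iff hbi hq m _).mpr (by simp only [id_eq]; omega)
    rw [dualTerm, if_pos h1]
    have h2 : -(m - (j.1 : ℤ)) = j.1 + -m := by omega
    simp only [h2]
    rw [zpow_add_apply, zpow_add_apply, map_add (b ^ (-m)), zpow_neg_apply_zpow]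
  · rintro ⟨n, i⟩ hn
    refine if_neg fun h => hn ?_
    have h1 := (exists_zpow_intVec_iff hbi hq m n).mp h
    refine ⟨((m - n).toNat, i), ?_⟩
    simp only [Prod.mk.injEq, and_true]
    omega

theorem exists_zpow_max_iff (hbi : PreservesLattice b) (n : ℤ) (p : EuclideanSpace ℝ (Fin d)) :
    (∃ k, (b ^ max n 0) (intVec k) = p) ↔
      p ∈ Set.range intVec ∧ ∃ k, (b ^ n) (intVec k) = p := by
  constructor
  · rintro ⟨k, rfl⟩
    obtain ⟨k', hk'⟩ := hbi.zpow (le_max_right n 0) k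
    refine ⟨⟨k', hk'.symm⟩, ?_⟩
    obtain ⟨k'', hk''⟩ := hbi.zpow (n := max n 0 - n) (by omega) k
    refine ⟨k'', ?_⟩
    rw [← hk'', ← zpow_add_apply]
    congr 2
    omega
  · rintro ⟨⟨q, rfl⟩, k, hk⟩
    rcases le_or_gt 0 n with hn | hn
    · exact ⟨k, by rw [max_eq_left hn, hk]⟩
    · exact ⟨q, by rw [max_eq_right hn.le, zpow_zero_apply]⟩

theorem dualTerm_max (hbi : PreservesLattice b) {p : EuclideanSpace ℝ (Fin d)}
    (hp : p ∈ Set.range intVec) (m : ℤ × Fin r) (x : EuclideanSpace ℝ (Fin d)) :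
    dualTerm b (fun n => max n 0) ψ φ p m x = dualTerm b id ψ φ p m x := by
  have h := exists_zpow_max_iff hbi m.1 p
  simp only [hp, true_and] at h
  by_cases hk : ∃ k, (b ^ m.1) (intVec k) = p
  · exact (if_pos (h.mpr hk)).trans (if_pos hk).symm
  · exact (if_neg (mt h.mp hk)).trans (if_neg hk).symm

theorem dualTerm_max_of_notMem (hbi : PreservesLattice b) {p : EuclideanSpace ℝ (Fin d)}
    (hp : p ∉ Set.range intVec) (m : ℤ × Fin r) (x : EuclideanSpace ℝ (Fin d)) :
    dualTerm b (fun n => max n 0) ψ φ p m x = 0 :=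
  if_neg fun h => hp ((exists_zpow_max_iff hbi m.1 p).mp h).1

/-- A nonzero point of the union of all the dilated lattices is the dilate of a lattice point
outside the image of the lattice. -/
theorem IsExpanding.exists_primitive (hb : IsExpanding b)
    {p : EuclideanSpace ℝ (Fin d)} (hp : p ≠ 0) (h : ∃ n : ℤ, ∃ k, (b ^ n) (intVec k) = p) :
    ∃ (m : ℤ) (q : Fin d → ℤ), (¬ ∃ z, intVec q = b (intVec z)) ∧ (b ^ m) (intVec q) = p := by
  -- The scales reaching `p` are bounded above, and a lattice point at the largest one cannot be in
  -- the image of `b`.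
  obtain ⟨N, hN⟩ := hb.exists_lattice_far ‖p‖
  obtain ⟨m, ⟨q, hq⟩, hmax⟩ := Int.exists_greatest_of_bdd
    (P := fun n => ∃ k, (b ^ n) (intVec k) = p) ⟨N, fun n ⟨k, hk⟩ => by
      by_contra! hn
      have hk0 : k ≠ 0 := by
        rintro rfl
        rw [intVec_zero, map_zero] at hk
        exact hp hk.symm
      have := hN n hn.le k hk0
      rw [hk] at this
      exact lt_irrefl _ this⟩ h
  refine ⟨m, q, ?_, hq⟩
  rintro ⟨z, hz⟩
  have := hmax (m + 1) ⟨z, by rw [zpow_add_apply, zpow_one, ← hz, hq]⟩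
  omega

theorem ae_hasSum_dualTerm_iff (hb : IsExpanding b) (hbi : PreservesLattice b) :
    (∀ p, ∀ᵐ x, HasSum (fun m => dualTerm b id ψ φ p m x) 0) ↔
      (∀ q : Fin d → ℤ, (¬ ∃ z, intVec q = b (intVec z)) →
        ∀ᵐ x, HasSum (fun j : ℕ × Fin r => conj (ψ j.2 ((b ^ (j.1 : ℤ)) x)) *
          φ j.2 ((b ^ (j.1 : ℤ)) (x + intVec q))) 0) ∧
      ∀ᵐ x, HasSum (fun m : ℤ × Fin r =>
          conj (ψ m.2 ((b ^ m.1) x)) * φ m.2 ((b ^ m.1) x)) 0 := by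
  refine ⟨fun h => ⟨fun q hq => ?_, ?_⟩, fun h p => ?_⟩
  · filter_upwards [h (intVec q)] with x hx
    have := (hasSum_dualTerm_iff (ψ := ψ) (φ := φ) hbi hq 0 x).mp
      (by rw [zpow_zero_apply]; exact hx)
    simpa only [neg_zero, zpow_zero_apply] using this
  · filter_upwards [h 0] with x hx using (hasSum_dualTerm_zero_iff _ x).mp hx
  · rcases eq_or_ne p 0 with rfl | hp
    · filter_upwards [h.2] with x hx using (hasSum_dualTerm_zero_iff _ x).mpr hx
    by_cases hk : ∃ n : ℤ, ∃ k, (b ^ n) (intVec k) = p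
    · obtain ⟨m, q, hq, rfl⟩ := hb.exists_primitive hp hk
      filter_upwards [(quasiMeasurePreserving_equiv (b ^ (-m))).ae (h.1 q hq)] with x hx
      exact (hasSum_dualTerm_iff hbi hq m x).mpr hx
    · refine ae_of_all _ fun x => ?_
      have h0 : ∀ m, dualTerm b id ψ φ p m x = 0 := fun m => if_neg fun h => hk ⟨_, h⟩
      simp only [h0]
      exact hasSum_zero

/-- The equations refer only to integer shifts, where the two families of coefficients agree. -/
theorem ae_hasSum_dualTerm_max_iff (hb : IsExpanding b) (hbi : PreservesLattice b) :
    (∀ p, ∀ᵐ x, HasSum (fun m => dualTerm b (fun n => max n 0) ψ φ p m x) 0) ↔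
      ∀ p, ∀ᵐ x, HasSum (fun m => dualTerm b id ψ φ p m x) 0 := by
  constructor
  · intro h
    refine (ae_hasSum_dualTerm_iff hb hbi).mpr ⟨fun q hq => ?_, ?_⟩
    · filter_upwards [h (intVec q)] with x hx
      simp only [dualTerm_max hbi ⟨q, rfl⟩] at hx
      have := (hasSum_dualTerm_iff (ψ := ψ) (φ := φ) hbi hq 0 x).mp
        (by rw [zpow_zero_apply]; exact hx)
      simpa only [neg_zero, zpow_zero_apply] using this
    · filter_upwards [h 0] with x hx using (hasSum_dualTerm_zero_iff _ x).mp hx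
  · intro h p
    by_cases hp : p ∈ Set.range intVec
    · simp only [dualTerm_max hbi hp]
      exact h p
    · simp only [dualTerm_max_of_notMem hbi hp]
      exact ae_of_all _ fun _ => hasSum_zero

end Equations

theorem orthogonalityEquations_iff (A : GL (Fin d) ℝ) (Ψ Φ : Fin r → L2 d) :
    OrthogonalityEquations A Ψ Φ ↔
      (∀ q : Fin d → ℤ, (¬ ∃ z, intVec q = glHom d (glTranspose A) (intVec z)) →
        ∀ᵐ x, HasSum (fun j : ℕ × Fin r =>
          conj ((𝓕 (Ψ j.2) : L2 d) (((glHom d (glTranspose A)) ^ (j.1 : ℤ)) x)) *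
          (𝓕 (Φ j.2) : L2 d) (((glHom d (glTranspose A)) ^ (j.1 : ℤ)) (x + intVec q))) 0) ∧
      ∀ᵐ x, HasSum (fun m : ℤ × Fin r =>
          conj ((𝓕 (Ψ m.2) : L2 d) (((glHom d (glTranspose A)) ^ m.1) x)) *
          (𝓕 (Φ m.2) : L2 d) (((glHom d (glTranspose A)) ^ m.1) x)) 0 := by
  have h1 : ∀ (n : ℤ) (x : EuclideanSpace ℝ (Fin d)), ((glHom d (glTranspose A)) ^ n) x =
      matVec ((A : Matrix (Fin d) (Fin d) ℝ).transpose ^ n) x := by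
    intro n x
    rw [← map_zpow, glHom_apply, Matrix.coe_units_zpow, glTranspose_val]
  simp only [h1]
  simp only [zpow_natCast, glHom_apply, glTranspose_val]
  rfl

/-! ### Dimension zero -/

/-- In dimension zero all dilations are trivial, so each generator recurs at every scale and square
summability forces it to vanish. -/
theorem eq_zero_of_isBessel_of_isEmpty [IsEmpty (Fin d)] {A : GL (Fin d) ℝ} {Ψ : Fin r → L2 d}
    (h : IsBessel (affineSystem A Ψ)) (i : Fin r) : Ψ i = 0 := by
  have hX : ∀ n : ℤ, affineSystem A Ψ (n, 0, i) = Ψ i := by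
    intro n
    have h1 := latticeForm_affineSystem A Ψ n 0 i
    have h2 : (𝓕 (affineSystem A Ψ (n, 0, i)) : L2 d) = 𝓕 (Ψ i) := by
      apply Lp.ext
      filter_upwards [h1] with x hx
      rw [hx, adet_glHom_zpow, Matrix.det_isEmpty, abs_one, one_zpow, Real.sqrt_one,
        Complex.ofReal_one, one_mul, intVec_zero, inner_zero_left, neg_zero, ex_zero, one_mul]
      congr 1
      exact Subsingleton.elim _ _
    exact (Lp.fourierTransformₗᵢ (EuclideanSpace ℝ (Fin d)) ℂ).injective h2
  obtain ⟨C, hC, hb⟩ := h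
  have h1 := (hb (Ψ i)).1.comp_injective (i := fun n : ℤ => (n, (0 : Fin d → ℤ), i))
    fun m n hmn => (Prod.mk.inj hmn).1
  simp only [Function.comp_def, hX] at h1
  have h2 := (summable_const_iff _).mp h1
  simpa using h2

theorem corollary_of_isEmpty [IsEmpty (Fin d)] {A : GL (Fin d) ℝ} {Ψ Φ : Fin r → L2 d}
    (hΨ : ∀ i, Ψ i = 0) (hΦ : ∀ i, Φ i = 0) :
    IsOrthogonal (affineSystem A Ψ) (affineSystem A Φ) ∧ OrthogonalityEquations A Ψ Φ ∧
      IsOrthogonal (quasiAffineSystem A Ψ) (quasiAffineSystem A Φ) := by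
  have horth : IsOrthogonal (fun _ : ℤ × (Fin d → ℤ) × Fin r => (0 : L2 d)) fun _ => 0 := by
    have : IsBessel (fun _ : ℤ × (Fin d → ℤ) × Fin r => (0 : L2 d)) :=
      ⟨1, one_pos, fun v => by simp⟩
    exact ⟨this, this, fun v => by simp⟩
  have e1 : ∀ Θ : Fin r → L2 d, (∀ i, Θ i = 0) → affineSystem A Θ = fun _ => 0 := by
    intro Θ h
    funext p
    simp only [affineSystem, h, map_zero]
  have e2 : ∀ Θ : Fin r → L2 d, (∀ i, Θ i = 0) → quasiAffineSystem A Θ = fun _ => 0 := by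
    intro Θ h
    funext p
    simp only [quasiAffineSystem, h, map_zero, ite_self]
  have hF : (𝓕 (0 : L2 d) : L2 d) = 0 := map_zero (Lp.fourierTransformₗᵢ _ _)
  -- The space is a single point, so an a.e. value is the value everywhere.
  have hz : ∀ᵐ x, ∀ y, (0 : L2 d) y = (0 : ℂ) ∨ x ≠ y := by
    filter_upwards [Lp.coeFn_zero ℂ 2 (volume : Measure (EuclideanSpace ℝ (Fin d)))] with x hx y
    left
    rw [Subsingleton.elim y x, hx, Pi.zero_apply]
  rw [e1 Ψ hΨ, e1 Φ hΦ, e2 Ψ hΨ, e2 Φ hΦ]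
  refine ⟨horth, ⟨fun q _ => ?_, ?_⟩, horth⟩
  all_goals
    filter_upwards [hz] with x hx
    have h0 : ∀ y, (0 : L2 d) y = (0 : ℂ) := fun y =>
      (hx y).resolve_right fun h => h (Subsingleton.elim _ _)
    simp only [hΨ, hΦ, hF, h0, mul_zero]
    exact hasSum_zero

end OrthFrames

/-! ### The theorem -/

theorem corollaryC (d r : ℕ) (A : GL (Fin d) ℝ)
    (hAint : OrthFrames.IsIntegerValued (A : Matrix (Fin d) (Fin d) ℝ))
    (hAexp : OrthFrames.IsExpansive (A : Matrix (Fin d) (Fin d) ℝ))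
    (Ψ Φ : Fin r → OrthFrames.L2 d)
    (hΨ : OrthFrames.IsBessel (OrthFrames.affineSystem A Ψ))
    (hΦ : OrthFrames.IsBessel (OrthFrames.affineSystem A Φ)) :
    (OrthFrames.IsOrthogonal (OrthFrames.affineSystem A Ψ) (OrthFrames.affineSystem A Φ) ↔
      OrthFrames.OrthogonalityEquations A Ψ Φ) ∧
    OrthFrames.IsBessel (OrthFrames.quasiAffineSystem A Ψ) ∧
    OrthFrames.IsBessel (OrthFrames.quasiAffineSystem A Φ) ∧
    (OrthFrames.IsOrthogonal (OrthFrames.quasiAffineSystem A Ψ)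
        (OrthFrames.quasiAffineSystem A Φ) ↔
      OrthFrames.OrthogonalityEquations A Ψ Φ) := by
  open OrthFrames in
  -- Dimension zero is separate because the origin, which the test functions avoid, then has
  -- positive measure.
  rcases isEmpty_or_nonempty (Fin d) with hd | hd
  · obtain ⟨h1, h2, h3⟩ := corollary_of_isEmpty (A := A) (eq_zero_of_isBessel_of_isEmpty hΨ)
      (eq_zero_of_isBessel_of_isEmpty hΦ)
    exact ⟨iff_of_true h1 h2, h3.1, h3.2.1, iff_of_true h3 h2⟩
  · have hb := hAexp.isExpanding
    have hbi := hAint.preservesLattice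
    have hmeas : ∀ (Θ : Fin r → L2 d) (i : Fin r), Measurable (𝓕 (Θ i) : L2 d) := fun Θ i =>
      (Lp.stronglyMeasurable _).measurable
    have hmem : ∀ (Θ : Fin r → L2 d) (i : Fin r), MemLp (𝓕 (Θ i) : L2 d) 2 := fun Θ i =>
      Lp.memLp _
    have hfin := (latticeForm_affineSystem A Ψ).finiteMass (latticeForm_affineSystem A Φ) hb
      (hmeas Ψ) (hmeas Φ) (hmem Ψ) (hmem Φ) hΨ hΦ
    have hqΨ := (latticeForm_affineSystem A Ψ).isBessel_max (latticeForm_quasiAffineSystem A Ψ)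
      hb hbi (hmeas Ψ) (hmem Ψ) hΨ
    have hqΦ := (latticeForm_affineSystem A Φ).isBessel_max (latticeForm_quasiAffineSystem A Φ)
      hb hbi (hmeas Φ) (hmem Φ) hΦ
    refine ⟨?_, hqΨ, hqΦ, ?_⟩
    · rw [orthogonalityEquations_iff,
        ← ae_hasSum_dualTerm_iff (ψ := fun i => (𝓕 (Ψ i) : L2 d))
          (φ := fun i => (𝓕 (Φ i) : L2 d)) hb hbi]
      exact (latticeForm_affineSystem A Ψ).isOrthogonal_iff (latticeForm_affineSystem A Φ)
        (hmeas Ψ) (hmeas Φ) (hmem Ψ) (hmem Φ) hfin hΨ hΦ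
    · rw [orthogonalityEquations_iff,
        ← ae_hasSum_dualTerm_iff (ψ := fun i => (𝓕 (Ψ i) : L2 d))
          (φ := fun i => (𝓕 (Φ i) : L2 d)) hb hbi, ← ae_hasSum_dualTerm_max_iff hb hbi]
      exact (latticeForm_quasiAffineSystem A Ψ).isOrthogonal_iff (latticeForm_quasiAffineSystem A Φ)
        (hmeas Ψ) (hmeas Φ) (hmem Ψ) (hmem Φ) (hfin.of_le hbi fun n => le_max_left n 0) hqΨ hqΦ
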